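/- Let $k$ be a commutative ring and $A$ a commutative $k$-algebra. **Notation.** A co-ideal $\Delta\subset\mathbb N^p$ is a non-empty subset closed under passing to smaller elements; $A[[\mathbf s]]_\Delta$ is the quotient of $A[[s_1,\dots,s_p]]$ by the ideal of series with support outside $\Delta$. $\mathrm{HS}^p_k(A;\Delta)$ is the set of families $D=(D_\alpha)_{\alpha\in\Delta}$ of $k$-linear endomorphisms of $A$ with $D_0=\mathrm{Id}$ and $D_\alpha(xy)=\sum_{\beta+\gamma=\alpha}D_\beta(x)D_\gamma(y)$; its identity $\mathbb I$ has $\mathbb I_\alpha=0$ for $\alpha\neq0$, and $(D\circ E)_\alpha=\sum_{\beta+\gamma=\alpha}D_\beta\circ E_\gamma$. For an integer $m\ge 1$, $\mathrm{HS}_k(A;m)$ is the case $p=1$, $\Delta=\{0,\dots,m\}$. A substitution map $\varphi:A[[\mathbf s]]_\Delta\to A[[\mathbf t]]_\nabla$ is a map of $A$-algebras such that every $\varphi(s_i)$ has zero constant term; $\mathbf C_\beta(\varphi,\alpha)$ is the coefficient of $\mathbf t^\beta$ in $\varphi(\mathbf s^\alpha)$, and $(\varphi\bullet D)_\beta=\sum_{\alpha\in\Delta,|\alpha|\le|\beta|}\mathbf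 C_\beta(\varphi,\alpha)D_\alpha$. Put $\ell_\alpha(D)=\min\{r\ge1:\exists\,\beta\le\alpha,\ |\beta|=r,\ D_\beta\ne0\}$ ($\infty$ if there is no such $r$). $\mathrm{Ider}_k(A;m)$ is the $A$-module of the $k$-derivations $\delta$ of $A$ for which there is $D\in\mathrm{HS}_k(A;m)$ with $D_1=\delta$ (an $m$-integral of $\delta$), and $\mathrm{Ider}^f_k(A)=\bigcap_{m\ge1}\mathrm{Ider}_k(A;m)$, over the integers $m\geq 1$. The enveloping algebra $U=U_{A/k}$ is the quotient of the free associative $k$-algebra on the symbols $S_a$ ($a\in A$) and $T_{p,\Delta,D,\alpha}$ ($p\in\mathbb N$, $\Delta\subset\mathbb N^p$ a co-ideal, $D\in\mathrm{HS}^p_k(A;\Delta)$, $\alpha\in\Delta$) by the relations $S_{c1}=c$, $S_{a+a'}=S_a+S_{a'}$, $S_{aa'}=S_aS_{a'}$; $T_{p,\{0\},\mathbb I,0}=1$; $T_{p,\Delta,\mathbb I,\alpha}=0$ for $|\alpha|>0$; $T_{p,\Delta,D\circ E,\alpha}=\sum_{\beta+\gamma=\alpha}T_{p,\Delta,D,\beta}T_{p,\Delta,E,\gamma}$;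 $T_{p,\Delta,D,\alpha}S_a=\sum_{\beta+\gamma=\alpha}S_{D_\beta(a)}T_{p,\Delta,D,\gamma}$; $T_{q,\nabla,\varphi\bullet D,\beta}=\sum_{\alpha\in\Delta,|\alpha|\le|\beta|}S_{\mathbf C_\beta(\varphi,\alpha)}T_{p,\Delta,D,\alpha}$ (for $c\in k$, $a,a'\in A$, all $p,q,\Delta,\nabla,D,E,\varphi$, $\alpha\in\Delta$, $\beta\in\nabla$). It is filtered by the degree of elements of the free algebra, where $\deg S_a=0$ and $\deg T_{p,\Delta,D,\alpha}=\lfloor|\alpha|/\ell_\alpha(D)\rfloor$. Classes in $U$ are written in bold. Let $\mathcal D=\mathcal D_{A/k}$ be the ring of $k$-linear differential operators of $A$, filtered by the order. The map of filtered $k$-algebras $\upsilon:U\to\mathcal D$ sends $\mathbf S_a\mapsto a$ and $\mathbf T_{p,\Delta,D,\alpha}\mapsto D_\alpha$. Write $\sigma_i$ for the symbol in degree $i$ in an associated graded ring. The ring $\mathrm{gr}\,\mathcal D$ is commutative, and it is an $A$-algebra. For a commutative $A$-algebra $B$ and $m\in\mathbb N\cup\{\infty\}$, let $\mathrm{EXP}_m(B)$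 be the set of series $\sum_{i\le m}r_it^i$ over $B$ with $r_0=1$ and $\binom{i+j}{i}r_{i+j}=r_ir_j$ for $i+j\le m$. It is an $A$-module whose addition is the product of (truncated) series and on which $a\in A$ acts by $t\mapsto at$; write $\mathrm{EXP}=\mathrm{EXP}_\infty$. Let $\Gamma_A M$ be the divided power algebra of an $A$-module $M$ and $\gamma:M\to\mathrm{EXP}(\Gamma_A M)$ the map $x\mapsto\sum_n\gamma_n(x)t^n$. The map $\vartheta^f_{A/k}:\Gamma_A\mathrm{Ider}^f_k(A)\to\mathrm{gr}\,\mathcal D$ is the map of $A$-algebras that the universal property of $\gamma$ attaches to the $A$-linear map $\chi^f:\mathrm{Ider}^f_k(A)\to\mathrm{EXP}(\mathrm{gr}\,\mathcal D)$, $\delta\mapsto\sum_n\sigma_n(D^n_n)t^n$, with $D^n$ any integral of $\delta$ of length at least $n$. **Statement.** The ring $\mathrm{gr}\,U$ is commutative; it is an $A$-algebra through $a\mapsto\sigma_0(\mathbf S_a)$. There are $A$-linear maps $$\chi_m:\mathrm{Ider}_k(A;m)\to\mathrm{EXP}_m(\mathrm{gr}\,U),\qquad m\ge1 \text{ an integer},$$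 with $\chi_m(\delta)=\sum_{i=0}^m\sigma_i(\mathbf T_{1,m,D,i})\,t^i$ for every $m$-integral $D$ of $\delta$ (here $\mathbf T_{1,m,D,i}=\mathbf T_{1,\{0,\dots,m\},D,i}$). For $m\le m'$ they are compatible with the inclusion $\mathrm{Ider}_k(A;m')\subset\mathrm{Ider}_k(A;m)$ and the truncation $\mathrm{EXP}_{m'}\to\mathrm{EXP}_m$. There is an $A$-linear map $\chi:\mathrm{Ider}^f_k(A)\to\mathrm{EXP}(\mathrm{gr}\,U)$ whose truncation to $\mathrm{EXP}_m$ is, for every integer $m\ge1$, the restriction of $\chi_m$. There is a unique map of $A$-algebras $$\vartheta:\Gamma_A\,\mathrm{Ider}^f_k(A)\to\mathrm{gr}\,U\quad\text{with}\quad \mathrm{EXP}(\vartheta)\circ\gamma=\chi .$$ It satisfies $\vartheta(\gamma_m(\delta))=\sigma_m(\mathbf T_{1,m,D,m})$ for all integers $m\ge1$, all $\delta\in\mathrm{Ider}^f_k(A)$ and all $D\in\mathrm{HS}_k(A;m)$ with $D_1=\delta$; it is a map of graded algebras; and $$\mathrm{gr}\,\upsilon\circ\vartheta=\vartheta^f_{A/k}.$$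 -/

import Mathlib

namespace HasseSchmidt

open scoped DirectSum
open Finset.HasAntidiagonal (antidiagonal mem_antidiagonal)

/-! ### Filtered rings and associated graded rings -/

/-- An increasing `ℕ`-filtration of a `k`-algebra `R` by `k`-submodules, compatible with the
ring structure. -/
structure RingFiltration (k R : Type*) [CommRing k] [Ring R] [Algebra k R] where
  deg : ℕ → Submodule k R
  mono : Monotone deg
  one_mem : (1 : R) ∈ deg 0
  mul_mem : ∀ {i j : ℕ} {x y : R}, x ∈ deg i → y ∈ deg j → x * y ∈ deg (i + j)

namespace RingFiltration

section

variable {k R : Type*} [CommRing k] [Ring R] [Algebra k R] (F : RingFiltration k R)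

/-- The step `F_{d-1}` of the filtration, with `F_{-1} = 0`. -/
def below : ℕ → Submodule k R
  | 0 => ⊥
  | d + 1 => F.deg d

theorem below_le (d : ℕ) : F.below d ≤ F.deg d := by
  cases d with
  | zero => exact bot_le
  | succ d => exact F.mono (Nat.le_succ d)

theorem below_mul {i j : ℕ} {x y : R} (hx : x ∈ F.below i) (hy : y ∈ F.deg j) :
    x * y ∈ F.below (i + j) := by
  cases i with
  | zero =>
    have : x = 0 := by simpa [below] using hx
    simp [this]
  | succ i =>
    have h := F.mul_mem (i := i) hx hy
    rwa [show i + 1 + j = (i + j) + 1 by omega]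

theorem mul_below {i j : ℕ} {x y : R} (hx : x ∈ F.deg i) (hy : y ∈ F.below j) :
    x * y ∈ F.below (i + j) := by
  cases j with
  | zero =>
    have : y = 0 := by simpa [below] using hy
    simp [this]
  | succ j => exact F.mul_mem (j := j) hx hy

/-- The homogeneous piece `F_d / F_{d-1}`. -/
def Piece (d : ℕ) : Type _ := F.deg d ⧸ (F.below d).comap (F.deg d).subtype

instance instAddCommGroupPiece (d : ℕ) : AddCommGroup (F.Piece d) :=
  inferInstanceAs (AddCommGroup (F.deg d ⧸ (F.below d).comap (F.deg d).subtype))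

instance instModulePiece (d : ℕ) : Module k (F.Piece d) :=
  inferInstanceAs (Module k (F.deg d ⧸ (F.below d).comap (F.deg d).subtype))

/-- The class in `F_d / F_{d-1}` of an element of `F_d`. -/
def cls (d : ℕ) : F.deg d →ₗ[k] F.Piece d :=
  ((F.below d).comap (F.deg d).subtype).mkQ

theorem cls_eq {d : ℕ} {x y : F.deg d} : F.cls d x = F.cls d y ↔ (x : R) - y ∈ F.below d := by
  exact Submodule.Quotient.eq ((F.below d).comap (F.deg d).subtype)

instance instGMul : GradedMonoid.GMul F.Piece where
  mul {i j} := Quotient.map₂ (fun x y => ⟨(x : R) * y, F.mul_mem x.2 y.2⟩) (by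
    intro x x' hx y y' hy
    have hx' : (x : R) - x' ∈ F.below i := (Submodule.quotientRel_def ((F.below i).comap (F.deg i).subtype)).1 hx
    have hy' : (y : R) - y' ∈ F.below j := (Submodule.quotientRel_def ((F.below j).comap (F.deg j).subtype)).1 hy
    refine (Submodule.quotientRel_def _).2 ?_
    change (x : R) * y - x' * y' ∈ F.below (i + j)
    have h := (F.below (i + j)).add_mem (F.below_mul hx' y.2) (F.mul_below x'.2 hy')
    convert! h using 1
    noncomm_ring)

instance instGOne : GradedMonoid.GOne F.Piece where
  one := F.cls 0 ⟨1, F.one_mem⟩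

theorem gmul_cls {i j : ℕ} (x : F.deg i) (y : F.deg j) :
    GradedMonoid.GMul.mul (F.cls i x) (F.cls j y) =
      F.cls (i + j) ⟨(x : R) * y, F.mul_mem x.2 y.2⟩ := rfl

theorem mk_eq {i j : ℕ} (h : i = j) (x : F.deg i) (y : F.deg j) (hxy : (x : R) = y) :
    (GradedMonoid.mk i (F.cls i x) : GradedMonoid F.Piece) = GradedMonoid.mk j (F.cls j y) := by
  subst h
  rw [Subtype.ext hxy]

theorem cls_ind {d : ℕ} {P : F.Piece d → Prop} (h : ∀ x, P (F.cls d x)) (x : F.Piece d) : P x := by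
  obtain ⟨x, rfl⟩ := Submodule.mkQ_surjective _ x
  exact h x

instance instGRing : DirectSum.GRing F.Piece where
  mul_zero {i j} a := by
    induction a using F.cls_ind with | _ a
    rw [← map_zero (F.cls j), gmul_cls, ← map_zero (F.cls (i + j))]
    congr 1
    ext
    simp
  zero_mul {i j} b := by
    induction b using F.cls_ind with | _ b
    rw [← map_zero (F.cls i), gmul_cls, ← map_zero (F.cls (i + j))]
    congr 1
    ext
    simp
  mul_add {i j} a b c := by
    induction a using F.cls_ind with | _ a
    induction b using F.cls_ind with | _ b
    induction c using F.cls_ind with | _ c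
    rw [← map_add, gmul_cls, gmul_cls, gmul_cls, ← map_add]
    congr 1
    ext
    simp [mul_add]
  add_mul {i j} a b c := by
    induction a using F.cls_ind with | _ a
    induction b using F.cls_ind with | _ b
    induction c using F.cls_ind with | _ c
    rw [← map_add, gmul_cls, gmul_cls, gmul_cls, ← map_add]
    congr 1
    ext
    simp [add_mul]
  one_mul := by
    rintro ⟨i, a⟩
    induction a using F.cls_ind with | _ a
    exact F.mk_eq (zero_add i) _ _ (one_mul _)
  mul_one := by
    rintro ⟨i, a⟩
    induction a using F.cls_ind with | _ a
    exact F.mk_eq (add_zero i) _ _ (mul_one _)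
  mul_assoc := by
    rintro ⟨i, a⟩ ⟨j, b⟩ ⟨l, c⟩
    induction a using F.cls_ind with | _ a
    induction b using F.cls_ind with | _ b
    induction c using F.cls_ind with | _ c
    exact F.mk_eq (add_assoc i j l) _ _ (mul_assoc _ _ _)
  natCast n := n • F.cls 0 ⟨1, F.one_mem⟩
  natCast_zero := zero_smul _ _
  natCast_succ n := succ_nsmul _ _
  intCast n := n • F.cls 0 ⟨1, F.one_mem⟩
  intCast_ofNat n := natCast_zsmul _ _
  intCast_negSucc_ofNat n := negSucc_zsmul _ _

/-- The associated graded ring `gr R = ⨁_d F_d / F_{d-1}`. -/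
abbrev Gr : Type _ := ⨁ d, F.Piece d

/-- The symbol map `σ_d : F_d → gr R`. -/
noncomputable def symbol (d : ℕ) (x : F.deg d) : F.Gr :=
  DirectSum.of F.Piece d (F.cls d x)

theorem symbol_eq {d : ℕ} {x y : F.deg d} (h : (x : R) - y ∈ F.below d) :
    F.symbol d x = F.symbol d y := by
  unfold symbol
  rw [F.cls_eq.2 h]

theorem symbol_congr {i j : ℕ} (h : i = j) (x : F.deg i) (y : F.deg j) (hxy : (x : R) = y) :
    F.symbol i x = F.symbol j y := by
  subst h
  rw [Subtype.ext hxy]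

theorem symbol_add {d : ℕ} (x y : F.deg d) :
    F.symbol d (x + y) = F.symbol d x + F.symbol d y := by
  simp only [symbol, map_add]

theorem symbol_mul {i j : ℕ} (x : F.deg i) (y : F.deg j) :
    F.symbol i x * F.symbol j y = F.symbol (i + j) ⟨(x : R) * y, F.mul_mem x.2 y.2⟩ := by
  simp only [symbol, DirectSum.of_mul_of, gmul_cls]

theorem symbol_one : F.symbol 0 ⟨1, F.one_mem⟩ = 1 := rfl

/-- The homogeneous component of degree `d` of `gr R`, as an additive subgroup. -/
noncomputable def homogeneous (d : ℕ) : AddSubgroup F.Gr := (DirectSum.of F.Piece d).range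

/-- A ring map `A → R` with image in `F_0` makes `gr R` a ring over `A`, through `a ↦ σ_0(a)`. -/
noncomputable def structureMap {A : Type*} [CommRing A] (f : A →+* R)
    (hf : ∀ a, f a ∈ F.deg 0) : A →+* F.Gr where
  toFun a := F.symbol 0 ⟨f a, hf a⟩
  map_one' := F.symbol_congr rfl _ _ (map_one f)
  map_zero' := by
    rw [F.symbol_congr rfl _ (0 : F.deg 0) (map_zero f)]
    simp [symbol]
  map_add' a b := by
    rw [← symbol_add]
    exact F.symbol_congr rfl _ _ (map_add f a b)
  map_mul' a b := by
    rw [symbol_mul]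
    exact F.symbol_congr rfl _ _ (map_mul f a b)

theorem gr_mul_comm
    (h : ∀ (i j : ℕ) (x y : R), x ∈ F.deg i → y ∈ F.deg j → x * y - y * x ∈ F.below (i + j))
    (x y : F.Gr) : x * y = y * x := by
  induction x using DirectSum.induction_on with
  | zero => simp
  | add a b ha hb => rw [add_mul, mul_add, ha, hb]
  | of i x =>
    induction y using DirectSum.induction_on with
    | zero => simp
    | add a b ha hb => rw [add_mul, mul_add, ha, hb]
    | of j y =>
      induction x using F.cls_ind with | _ x
      induction y using F.cls_ind with | _ y
      change F.symbol i x * F.symbol j y = F.symbol j y * F.symbol i x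
      rw [symbol_mul, symbol_mul]
      rw [F.symbol_congr (add_comm j i) _
        ⟨(y : R) * x, by rw [add_comm]; exact F.mul_mem y.2 x.2⟩ rfl]
      exact F.symbol_eq (h i j _ _ x.2 y.2)

end

section

variable {k R R' : Type*} [CommRing k] [Ring R] [Algebra k R] [Ring R'] [Algebra k R']
  (F : RingFiltration k R) (F' : RingFiltration k R') (f : R →ₐ[k] R')
  (hf : ∀ d x, x ∈ F.deg d → f x ∈ F'.deg d)

/-- The map `F_d / F_{d-1} → F'_d / F'_{d-1}` induced by a map of filtered algebras. -/
def pieceMap (d : ℕ) : F.Piece d →+ F'.Piece d :=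
  (Submodule.mapQ ((F.below d).comap (F.deg d).subtype) ((F'.below d).comap (F'.deg d).subtype)
    (LinearMap.restrict (p := F.deg d) (q := F'.deg d) f.toLinearMap (fun x hx => hf d x hx)) (by
      intro x hx
      cases d with
      | zero =>
        have h0 : (x : R) = 0 := by simpa [below] using hx
        have h1 : f (x : R) = 0 := by rw [h0, map_zero]
        exact h1
      | succ d => exact hf d _ hx)).toAddMonoidHom

theorem pieceMap_cls (d : ℕ) (x : F.deg d) :
    pieceMap F F' f hf d (F.cls d x) = F'.cls d ⟨f x, hf d x x.2⟩ := rfl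

/-- The ring map `gr f : gr R → gr R'` induced by a map of filtered algebras. -/
noncomputable def grMap : F.Gr →+* F'.Gr :=
  DirectSum.toSemiring (fun d => (DirectSum.of F'.Piece d).comp (pieceMap F F' f hf d))
    (F'.symbol_congr rfl ⟨f 1, hf 0 1 F.one_mem⟩ ⟨1, F'.one_mem⟩ (map_one f))
    (by
      intro i j x y
      induction x using F.cls_ind with | _ x
      induction y using F.cls_ind with | _ y
      change F'.symbol (i + j) ⟨f ((x : R) * y), hf _ _ (F.mul_mem x.2 y.2)⟩ =
        F'.symbol i ⟨f x, hf i x x.2⟩ * F'.symbol j ⟨f y, hf j y y.2⟩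
      rw [symbol_mul]
      exact F'.symbol_congr rfl _ _ (map_mul f _ _))

theorem grMap_symbol (d : ℕ) (x : F.deg d) :
    grMap F F' f hf (F.symbol d x) = F'.symbol d ⟨f x, hf d x x.2⟩ :=
  DirectSum.toSemiring_of _ _ _ _ _

end

end RingFiltration

theorem sum_antidiagonal_assoc {ι M : Type*} [AddCommMonoid ι] [Finset.HasAntidiagonal ι]
    [AddCommMonoid M] (f : ι → ι → ι → M) (n : ι) :
    ∑ c ∈ antidiagonal n, ∑ d ∈ antidiagonal c.1, f d.1 d.2 c.2 =
      ∑ c ∈ antidiagonal n, ∑ d ∈ antidiagonal c.2, f c.1 d.1 d.2 := by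
  rw [Finset.sum_sigma', Finset.sum_sigma']
  refine Finset.sum_nbij' (fun x => ⟨(x.2.1, x.2.2 + x.1.2), (x.2.2, x.1.2)⟩)
    (fun x => ⟨(x.1.1 + x.2.1, x.2.2), (x.1.1, x.2.1)⟩) ?_ ?_ ?_ ?_ ?_
  · rintro ⟨⟨a, b⟩, ⟨c, d⟩⟩ h
    simp only [Finset.mem_sigma, mem_antidiagonal] at h ⊢
    exact ⟨by rw [← h.1, ← h.2, add_assoc], trivial⟩
  · rintro ⟨⟨a, b⟩, ⟨c, d⟩⟩ h
    simp only [Finset.mem_sigma, mem_antidiagonal] at h ⊢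
    exact ⟨by rw [← h.1, ← h.2, add_assoc], trivial⟩
  · rintro ⟨⟨a, b⟩, ⟨c, d⟩⟩ h
    simp only [Finset.mem_sigma, mem_antidiagonal] at h
    obtain ⟨rfl, rfl⟩ := h
    rfl
  · rintro ⟨⟨a, b⟩, ⟨c, d⟩⟩ h
    simp only [Finset.mem_sigma, mem_antidiagonal] at h
    obtain ⟨rfl, rfl⟩ := h
    rfl
  · intro x _
    rfl

/-! ### Exponential type series -/

/-- Series `∑_{i ≤ m} r_i t^i` of exponential type with coefficients in `B`, where `m` is a
natural number or `∞`: `r_0 = 1` and `binom (i+j) i * r_{i+j} = r_i * r_j` for `i + j ≤ m`.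
The coefficients beyond `m` are set to `0`. -/
@[ext]
structure ExpSeries (m : ℕ∞) (B : Type*) [CommRing B] where
  coeff : ℕ → B
  coeff_of_lt : ∀ i : ℕ, m < i → coeff i = 0
  coeff_zero : coeff 0 = 1
  choose_mul : ∀ i j : ℕ, ((i + j : ℕ) : ℕ∞) ≤ m →
    ((i + j).choose i : B) * coeff (i + j) = coeff i * coeff j

namespace ExpSeries

theorem sum_choose_mul {B : Type*} [CommRing B] (f g : ℕ → B) (i j : ℕ) (a : ℕ × ℕ)
    (ha : a ∈ antidiagonal i) :
    ∑ c ∈ antidiagonal (i + j), (c.1.choose a.1 * c.2.choose a.2 : B) * (f c.1 * g c.2) =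
      ∑ b ∈ antidiagonal j,
        ((a.1 + b.1).choose a.1 * (a.2 + b.2).choose a.2 : B) *
          (f (a.1 + b.1) * g (a.2 + b.2)) := by
  symm
  rw [mem_antidiagonal] at ha
  refine Finset.sum_of_injOn (fun b => (a.1 + b.1, a.2 + b.2)) ?_ ?_ ?_ ?_
  · intro b _ b' _ h
    simp only [Prod.mk.injEq] at h
    ext <;> omega
  · intro b hb
    rw [Finset.mem_coe, mem_antidiagonal] at hb ⊢
    change a.1 + b.1 + (a.2 + b.2) = i + j
    omega
  · intro c hc hc'
    rw [mem_antidiagonal] at hc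
    by_cases h1 : c.1 < a.1
    · simp [Nat.choose_eq_zero_of_lt h1]
    by_cases h2 : c.2 < a.2
    · simp [Nat.choose_eq_zero_of_lt h2]
    exfalso
    refine hc' ⟨(c.1 - a.1, c.2 - a.2), ?_, ?_⟩
    · simp only [Finset.mem_coe, mem_antidiagonal]
      omega
    · ext
      · simp only; omega
      · simp only; omega
  · intro b _
    rfl

section

variable {m : ℕ∞} {B : Type*} [CommRing B]

theorem coe_le_of_le {i n : ℕ} (h : i ≤ n) (hn : (n : ℕ∞) ≤ m) : (i : ℕ∞) ≤ m :=
  le_trans (Nat.cast_le.2 h) hn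

/-- The group law of exponential type series, written additively, is the product of truncated
power series. -/
instance : Add (ExpSeries m B) where
  add r s :=
    { coeff := fun n => open Classical in
        if (n : ℕ∞) ≤ m then ∑ c ∈ antidiagonal n, r.coeff c.1 * s.coeff c.2 else 0
      coeff_of_lt := fun i hi => if_neg (not_le.2 hi)
      coeff_zero := by simp [r.coeff_zero, s.coeff_zero]
      choose_mul := by
        intro i j hij
        rw [if_pos hij, if_pos (coe_le_of_le (Nat.le_add_right i j) hij),
          if_pos (coe_le_of_le (Nat.le_add_left j i) hij), Finset.sum_mul_sum, Finset.mul_sum]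
        have h1 : ∀ c ∈ antidiagonal (i + j),
            ((i + j).choose i : B) * (r.coeff c.1 * s.coeff c.2) =
              ∑ a ∈ antidiagonal i,
                (c.1.choose a.1 * c.2.choose a.2 : B) * (r.coeff c.1 * s.coeff c.2) := by
          intro c hc
          rw [mem_antidiagonal] at hc
          rw [← hc, Nat.add_choose_eq, Nat.cast_sum, Finset.sum_mul]
          simp
        rw [Finset.sum_congr rfl h1, Finset.sum_comm]
        refine Finset.sum_congr rfl fun a ha => ?_
        rw [sum_choose_mul r.coeff s.coeff i j a ha]
        rw [mem_antidiagonal] at ha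
        refine Finset.sum_congr rfl fun b hb => ?_
        rw [mem_antidiagonal] at hb
        have e1 := r.choose_mul a.1 b.1 (coe_le_of_le (by omega) hij)
        have e2 := s.choose_mul a.2 b.2 (coe_le_of_le (by omega) hij)
        linear_combination (s.coeff a.2 * s.coeff b.2) * e1 +
          ((a.1 + b.1).choose a.1 : B) * r.coeff (a.1 + b.1) * e2 }

instance : Zero (ExpSeries m B) where
  zero :=
    { coeff := fun n => if n = 0 then 1 else 0
      coeff_of_lt := fun i hi => if_neg (by rintro rfl; simp at hi)
      coeff_zero := if_pos rfl
      choose_mul := by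
        intro i j _
        rcases Nat.eq_zero_or_pos i with rfl | hi
        · simp
        · simp [hi.ne'] }

instance : Neg (ExpSeries m B) where
  neg r :=
    { coeff := fun n => (-1) ^ n * r.coeff n
      coeff_of_lt := fun i hi => by simp [r.coeff_of_lt i hi]
      coeff_zero := by simp [r.coeff_zero]
      choose_mul := by
        intro i j hij
        have := r.choose_mul i j hij
        rw [pow_add]
        linear_combination ((-1) ^ i * (-1) ^ j) * this }

open Classical in
theorem coeff_add (r s : ExpSeries m B) (n : ℕ) : (r + s).coeff n =
    if (n : ℕ∞) ≤ m then ∑ c ∈ antidiagonal n, r.coeff c.1 * s.coeff c.2 else 0 := rfl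

theorem coeff_add_of_le (r s : ExpSeries m B) (n : ℕ) (h : (n : ℕ∞) ≤ m) : (r + s).coeff n =
    ∑ c ∈ antidiagonal n, r.coeff c.1 * s.coeff c.2 := if_pos h

theorem coeff_zero_series (n : ℕ) : (0 : ExpSeries m B).coeff n = if n = 0 then 1 else 0 := rfl

theorem coeff_neg (r : ExpSeries m B) (n : ℕ) : (-r).coeff n = (-1) ^ n * r.coeff n := rfl

theorem ext_of_le {r s : ExpSeries m B} (h : ∀ n : ℕ, (n : ℕ∞) ≤ m → r.coeff n = s.coeff n) :
    r = s := by
  ext n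
  by_cases hn : (n : ℕ∞) ≤ m
  · exact h n hn
  · rw [r.coeff_of_lt n (not_le.1 hn), s.coeff_of_lt n (not_le.1 hn)]

theorem le_of_mem {n : ℕ} (hn : (n : ℕ∞) ≤ m) {c : ℕ × ℕ} (hc : c ∈ antidiagonal n) :
    (c.1 : ℕ∞) ≤ m ∧ (c.2 : ℕ∞) ≤ m := by
  rw [mem_antidiagonal] at hc
  exact ⟨coe_le_of_le (by omega) hn, coe_le_of_le (by omega) hn⟩

theorem sum_binomial (r : ExpSeries m B) (x y : B) (n : ℕ) (hn : (n : ℕ∞) ≤ m) :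
    ∑ c ∈ antidiagonal n, (x ^ c.1 * r.coeff c.1) * (y ^ c.2 * r.coeff c.2) =
      (x + y) ^ n * r.coeff n := by
  rw [(Commute.all x y).add_pow', Finset.sum_mul]
  refine Finset.sum_congr rfl fun c hc => ?_
  rw [mem_antidiagonal] at hc
  have := r.choose_mul c.1 c.2 (by rwa [hc])
  rw [hc] at this
  rw [nsmul_eq_mul]
  linear_combination (-(x ^ c.1 * y ^ c.2)) * this

instance : AddCommGroup (ExpSeries m B) where
  add_assoc r s u := by
    refine ext_of_le fun n hn => ?_
    rw [coeff_add_of_le _ _ _ hn, coeff_add_of_le _ _ _ hn]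
    have h1 : ∀ c ∈ antidiagonal n, (r + s).coeff c.1 * u.coeff c.2 =
        ∑ d ∈ antidiagonal c.1, r.coeff d.1 * s.coeff d.2 * u.coeff c.2 := fun c hc => by
      rw [coeff_add_of_le _ _ _ (le_of_mem hn hc).1, Finset.sum_mul]
    have h2 : ∀ c ∈ antidiagonal n, r.coeff c.1 * (s + u).coeff c.2 =
        ∑ d ∈ antidiagonal c.2, r.coeff c.1 * s.coeff d.1 * u.coeff d.2 := fun c hc => by
      rw [coeff_add_of_le _ _ _ (le_of_mem hn hc).2, Finset.mul_sum]
      simp only [mul_assoc]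
    rw [Finset.sum_congr rfl h1, Finset.sum_congr rfl h2]
    exact sum_antidiagonal_assoc
      (fun a b c => r.coeff a * s.coeff b * u.coeff c) n
  zero_add r := by
    refine ext_of_le fun n hn => ?_
    rw [coeff_add_of_le _ _ _ hn, Finset.sum_eq_single (0, n)]
    · simp [coeff_zero_series]
    · rintro ⟨a, b⟩ hab hne
      rw [mem_antidiagonal] at hab
      have : a ≠ 0 := by
        rintro rfl
        simp_all
      simp [coeff_zero_series, this]
    · simp
  add_zero r := by
    refine ext_of_le fun n hn => ?_
    rw [coeff_add_of_le _ _ _ hn, Finset.sum_eq_single (n, 0)]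
    · simp [coeff_zero_series]
    · rintro ⟨a, b⟩ hab hne
      rw [mem_antidiagonal] at hab
      have : b ≠ 0 := by
        rintro rfl
        simp_all
      simp [coeff_zero_series, this]
    · simp
  add_comm r s := by
    refine ext_of_le fun n hn => ?_
    rw [coeff_add_of_le _ _ _ hn, coeff_add_of_le _ _ _ hn, ← Finset.Nat.sum_antidiagonal_swap]
    simp [mul_comm]
  neg_add_cancel r := by
    refine ext_of_le fun n hn => ?_
    rw [coeff_add_of_le _ _ _ hn, coeff_zero_series]
    have := r.sum_binomial (-1) 1 n hn
    simp only [one_pow, one_mul, neg_add_cancel] at this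
    simp only [coeff_neg]
    rw [this]
    by_cases h : n = 0
    · simp [h, r.coeff_zero]
    · simp [h]
  nsmul := nsmulRec
  zsmul := zsmulRec

end

section

variable {A : Type*} [CommRing A] {m : ℕ∞} {B : Type*} [CommRing B] [Algebra A B]

/-- The scalar `a` acts on series of exponential type by the substitution `t ↦ a t`. -/
instance : SMul A (ExpSeries m B) where
  smul a r :=
    { coeff := fun n => algebraMap A B a ^ n * r.coeff n
      coeff_of_lt := fun i hi => by simp [r.coeff_of_lt i hi]
      coeff_zero := by simp [r.coeff_zero]
      choose_mul := by
        intro i j hij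
        have := r.choose_mul i j hij
        rw [pow_add]
        linear_combination (algebraMap A B a ^ i * algebraMap A B a ^ j) * this }

theorem coeff_smul (a : A) (r : ExpSeries m B) (n : ℕ) :
    (a • r).coeff n = algebraMap A B a ^ n * r.coeff n := rfl

instance : Module A (ExpSeries m B) where
  one_smul r := by ext n; simp [coeff_smul]
  mul_smul a b r := by ext n; simp [coeff_smul, mul_pow, mul_assoc]
  smul_zero a := by
    ext n
    by_cases h : n = 0 <;> simp [coeff_smul, coeff_zero_series, h]
  zero_smul r := by
    ext n
    by_cases h : n = 0 <;> simp [coeff_smul, coeff_zero_series, h, r.coeff_zero]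
  smul_add a r s := by
    refine ext_of_le fun n hn => ?_
    rw [coeff_smul, coeff_add_of_le _ _ _ hn, coeff_add_of_le _ _ _ hn, Finset.mul_sum]
    refine Finset.sum_congr rfl fun c hc => ?_
    rw [mem_antidiagonal] at hc
    rw [coeff_smul, coeff_smul, ← hc, pow_add]
    ring
  add_smul a b r := by
    refine ext_of_le fun n hn => ?_
    rw [coeff_smul, coeff_add_of_le _ _ _ hn, map_add]
    exact (r.sum_binomial _ _ n hn).symm

/-- The map `EXP_m(B) → EXP_m(C)` induced by a map of commutative `A`-algebras. -/
def map {C : Type*} [CommRing C] [Algebra A C] (h : B →ₐ[A] C) :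
    ExpSeries m B →ₗ[A] ExpSeries m C where
  toFun r :=
    { coeff := fun n => h (r.coeff n)
      coeff_of_lt := fun i hi => by simp [r.coeff_of_lt i hi]
      coeff_zero := by simp [r.coeff_zero]
      choose_mul := by
        intro i j hij
        rw [← map_mul, ← r.choose_mul i j hij, map_mul, map_natCast] }
  map_add' r s := by
    refine ext_of_le fun n hn => ?_
    simp only [coeff_add_of_le _ _ _ hn, map_sum, map_mul]
  map_smul' a r := by
    ext n
    simp [coeff_smul]

/-- The truncation map `EXP_q(B) → EXP_m(B)` for `m ≤ q`. -/
def trunc {q m : ℕ∞} (hmq : m ≤ q) : ExpSeries q B →ₗ[A] ExpSeries m B where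
  toFun r :=
    { coeff := fun n => open Classical in if (n : ℕ∞) ≤ m then r.coeff n else 0
      coeff_of_lt := fun i hi => if_neg (not_le.2 hi)
      coeff_zero := by simp [r.coeff_zero]
      choose_mul := by
        intro i j hij
        rw [if_pos hij, if_pos (coe_le_of_le (Nat.le_add_right i j) hij),
          if_pos (coe_le_of_le (Nat.le_add_left j i) hij)]
        exact r.choose_mul i j (hij.trans hmq) }
  map_add' r s := by
    refine ext_of_le fun n hn => ?_
    rw [coeff_add_of_le _ _ _ hn]
    simp only [if_pos hn, coeff_add_of_le _ _ _ (hn.trans hmq)]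
    refine Finset.sum_congr rfl fun c hc => ?_
    rw [if_pos (le_of_mem hn hc).1, if_pos (le_of_mem hn hc).2]
  map_smul' a r := by
    refine ext_of_le fun n hn => ?_
    simp [coeff_smul, hn]

end

end ExpSeries

/-! ### Divided power algebras -/

section DividedPowers

variable (A M : Type*) [CommRing A] [AddCommGroup M] [Module A M]

/-- The canonical map `γ : M → EXP(Γ_A M)`, `x ↦ ∑ γ_n(x) t^n`. -/
noncomputable def gammaSeries : M →ₗ[A] ExpSeries ⊤ (DividedPowerAlgebra A M) where
  toFun x :=
    { coeff := fun n => DividedPowerAlgebra.dp A n x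
      coeff_of_lt := fun i hi => absurd hi (by simp)
      coeff_zero := DividedPowerAlgebra.dp_zero
      choose_mul := by
        intro i j _
        rw [DividedPowerAlgebra.dp_mul, nsmul_eq_mul] }
  map_add' x y := by
    refine ExpSeries.ext_of_le fun n hn => ?_
    rw [ExpSeries.coeff_add_of_le _ _ _ hn]
    exact DividedPowerAlgebra.dp_add
  map_smul' a x := by
    ext n
    simp [ExpSeries.coeff_smul, DividedPowerAlgebra.dp_smul, Algebra.smul_def]

variable {A M}

/-- The `A`-algebra map `Γ_A M → B` that the universal property of `γ` attaches to an `A`-linear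
map `M → EXP(B)`. -/
noncomputable def gammaLift {B : Type*} [CommRing B] [Algebra A B]
    (H : M →ₗ[A] ExpSeries ⊤ B) : DividedPowerAlgebra A M →ₐ[A] B :=
  DividedPowerAlgebra.lift' (f := fun x => (H x.2).coeff x.1)
    (fun x => (H x).coeff_zero)
    (fun n a x => by
      rw [map_smul, ExpSeries.coeff_smul, Algebra.smul_def, map_pow])
    (fun n q x => by
      rw [nsmul_eq_mul]
      exact ((H x).choose_mul n q le_top).symm)
    (fun n x y => by
      rw [map_add]
      exact ExpSeries.coeff_add_of_le _ _ _ le_top)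

theorem gammaLift_dp {B : Type*} [CommRing B] [Algebra A B] (H : M →ₗ[A] ExpSeries ⊤ B)
    (n : ℕ) (x : M) : gammaLift H (DividedPowerAlgebra.dp A n x) = (H x).coeff n := by
  unfold gammaLift
  rw [DividedPowerAlgebra.lift'_apply_dp]

theorem map_gammaLift {B : Type*} [CommRing B] [Algebra A B] (H : M →ₗ[A] ExpSeries ⊤ B) :
    ExpSeries.map (gammaLift H) ∘ₗ gammaSeries A M = H := by
  ext x n
  exact gammaLift_dp H n x

theorem gammaLift_unique {B : Type*} [CommRing B] [Algebra A B] (H : M →ₗ[A] ExpSeries ⊤ B)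
    (h : DividedPowerAlgebra A M →ₐ[A] B)
    (hh : ExpSeries.map h ∘ₗ gammaSeries A M = H) : h = gammaLift H := by
  refine DividedPowerAlgebra.algHom_ext fun n x => ?_
  rw [gammaLift_dp, ← hh]
  rfl

variable (A M) in
/-- The homogeneous component `Γ^d_A M`: the `A`-span of the products
`γ_{n_1}(x_1) ⋯ γ_{n_r}(x_r)` with `n_1 + ⋯ + n_r = d`. -/
noncomputable def gammaHomogeneous (d : ℕ) : Submodule A (DividedPowerAlgebra A M) :=
  Submodule.span A {z | ∃ l : List (ℕ × M), (l.map Prod.fst).sum = d ∧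
    z = (l.map fun x => DividedPowerAlgebra.dp A x.1 x.2).prod}

end DividedPowers

/-! ### Truncated power series and substitution maps -/

/-- A non-empty co-ideal of `ℕ^p`. -/
structure CoIdeal (p : ℕ) where
  carrier : Set (Fin p →₀ ℕ)
  lower : ∀ {α β : Fin p →₀ ℕ}, β ≤ α → α ∈ carrier → β ∈ carrier
  nonempty : carrier.Nonempty

namespace CoIdeal

variable {p : ℕ}

instance : Membership (Fin p →₀ ℕ) (CoIdeal p) := ⟨fun Δ α => α ∈ Δ.carrier⟩

theorem zero_mem (Δ : CoIdeal p) : (0 : Fin p →₀ ℕ) ∈ Δ :=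
  Δ.lower (zero_le) Δ.nonempty.some_mem

theorem mem_of_antidiagonal (Δ : CoIdeal p) {α : Fin p →₀ ℕ} (hα : α ∈ Δ)
    {c : (Fin p →₀ ℕ) × (Fin p →₀ ℕ)} (hc : c ∈ antidiagonal α) : c.1 ∈ Δ ∧ c.2 ∈ Δ := by
  rw [mem_antidiagonal] at hc
  subst hc
  exact ⟨Δ.lower (le_add_of_nonneg_right (zero_le)) hα,
    Δ.lower (le_add_of_nonneg_left (zero_le)) hα⟩

variable (p) in
/-- The co-ideal `{0}`. -/
def origin : CoIdeal p where
  carrier := {0}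
  lower := by
    intro α β h hα
    rw [Set.mem_singleton_iff] at hα ⊢
    subst hα
    exact le_antisymm h (zero_le)
  nonempty := ⟨0, rfl⟩

variable (p) in
/-- The co-ideal `{α : |α| ≤ m}`. -/
def total (m : ℕ) : CoIdeal p where
  carrier := {α | α.degree ≤ m}
  lower := fun h hα => le_trans (Finsupp.degree_mono h) hα
  nonempty := ⟨0, by simp⟩

theorem mem_total {m : ℕ} {α : Fin p →₀ ℕ} : α ∈ total p m ↔ α.degree ≤ m := Iff.rfl

open Classical in
/-- The finite set of the `α ∈ Δ` with `|α| ≤ n`. -/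
noncomputable def upTo (Δ : CoIdeal p) (n : ℕ) : Finset (Fin p →₀ ℕ) :=
  (Finsupp.finite_of_degree_le n).toFinset.filter (· ∈ Δ)

theorem mem_upTo {Δ : CoIdeal p} {n : ℕ} {α : Fin p →₀ ℕ} :
    α ∈ Δ.upTo n ↔ α.degree ≤ n ∧ α ∈ Δ := by
  simp [upTo]

end CoIdeal

section TruncatedSeries

variable (A : Type*) [CommRing A] {p q : ℕ}

/-- The ideal of `A[[s_1, …, s_p]]` of the series with support outside `Δ`. -/
def truncIdeal (Δ : CoIdeal p) : Ideal (MvPowerSeries (Fin p) A) where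
  carrier := {f | ∀ α ∈ Δ, MvPowerSeries.coeff α f = 0}
  zero_mem' := fun α _ => map_zero _
  add_mem' := by
    intro f g hf hg α hα
    rw [map_add, hf α hα, hg α hα, add_zero]
  smul_mem' := by
    intro c f hf α hα
    rw [smul_eq_mul, MvPowerSeries.coeff_mul]
    refine Finset.sum_eq_zero fun x hx => ?_
    rw [hf x.2 (Δ.mem_of_antidiagonal hα hx).2, mul_zero]

/-- The `A`-algebra `A[[s_1, …, s_p]]_Δ` of power series truncated at `Δ`. -/
abbrev TruncSeries (Δ : CoIdeal p) : Type _ := MvPowerSeries (Fin p) A ⧸ truncIdeal A Δ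

variable {A}

namespace TruncSeries

variable {Δ : CoIdeal p} {nab : CoIdeal q}

/-- The class of a power series in `A[[s]]_Δ`. -/
noncomputable abbrev ofSeries (Δ : CoIdeal p) : MvPowerSeries (Fin p) A →ₐ[A] TruncSeries A Δ :=
  Ideal.Quotient.mkₐ A (truncIdeal A Δ)

open Classical in
/-- The coefficient of `s^α` in an element of `A[[s]]_Δ` (and `0` if `α ∉ Δ`). -/
noncomputable def coeff (α : Fin p →₀ ℕ) (x : TruncSeries A Δ) : A :=
  if hα : α ∈ Δ then
    Quotient.liftOn' x (fun f => MvPowerSeries.coeff α f) (fun f g h => by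
      have h' : f - g ∈ truncIdeal A Δ := (Submodule.quotientRel_def _).1 h
      have := h' α hα
      rwa [map_sub, sub_eq_zero] at this)
  else 0

theorem ofSeries_surjective (x : TruncSeries A Δ) : ∃ f, ofSeries Δ f = x :=
  Ideal.Quotient.mk_surjective x

theorem coeff_ofSeries {α : Fin p →₀ ℕ} (hα : α ∈ Δ) (f : MvPowerSeries (Fin p) A) :
    coeff α (ofSeries Δ f) = MvPowerSeries.coeff α f := by
  unfold coeff
  rw [dif_pos hα]
  rfl

theorem coeff_of_notMem {α : Fin p →₀ ℕ} (hα : α ∉ Δ) (x : TruncSeries A Δ) :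
    coeff α x = 0 := dif_neg hα

theorem ofSeries_eq {f g : MvPowerSeries (Fin p) A}
    (h : ∀ α ∈ Δ, MvPowerSeries.coeff α f = MvPowerSeries.coeff α g) : ofSeries Δ f = ofSeries Δ g := by
  refine Ideal.Quotient.eq.2 fun α hα => ?_
  rw [map_sub, h α hα, sub_self]

theorem coeff_add (α : Fin p →₀ ℕ) (x y : TruncSeries A Δ) :
    coeff α (x + y) = coeff α x + coeff α y := by
  by_cases hα : α ∈ Δ
  · obtain ⟨f, rfl⟩ := ofSeries_surjective x
    obtain ⟨g, rfl⟩ := ofSeries_surjective y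
    rw [← map_add, coeff_ofSeries hα, coeff_ofSeries hα, coeff_ofSeries hα, map_add]
  · simp only [coeff_of_notMem hα, add_zero]

theorem coeff_zero (α : Fin p →₀ ℕ) : coeff α (0 : TruncSeries A Δ) = 0 := by
  have := coeff_add α (0 : TruncSeries A Δ) 0
  simpa using this

theorem coeff_sum {ι : Type*} (s : Finset ι) (f : ι → TruncSeries A Δ) (α : Fin p →₀ ℕ) :
    coeff α (∑ i ∈ s, f i) = ∑ i ∈ s, coeff α (f i) := by
  classical
  induction s using Finset.induction_on with
  | empty => simpa using coeff_zero α
  | insert a s ha ih => rw [Finset.sum_insert ha, Finset.sum_insert ha, coeff_add, ih]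

theorem coeff_smul (a : A) (α : Fin p →₀ ℕ) (x : TruncSeries A Δ) :
    coeff α (a • x) = a * coeff α x := by
  by_cases hα : α ∈ Δ
  · obtain ⟨f, rfl⟩ := ofSeries_surjective x
    rw [← map_smul, coeff_ofSeries hα, coeff_ofSeries hα]
    simp
  · simp only [coeff_of_notMem hα, mul_zero]

theorem coeff_mul {α : Fin p →₀ ℕ} (hα : α ∈ Δ) (x y : TruncSeries A Δ) :
    coeff α (x * y) = ∑ c ∈ antidiagonal α, coeff c.1 x * coeff c.2 y := by
  obtain ⟨f, rfl⟩ := ofSeries_surjective x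
  obtain ⟨g, rfl⟩ := ofSeries_surjective y
  rw [← map_mul, coeff_ofSeries hα, MvPowerSeries.coeff_mul]
  refine Finset.sum_congr rfl fun c hc => ?_
  rw [coeff_ofSeries (Δ.mem_of_antidiagonal hα hc).1, coeff_ofSeries (Δ.mem_of_antidiagonal hα hc).2]

end TruncSeries

open TruncSeries in
variable (A) in
/-- A substitution map `A[[s_1, …, s_p]]_Δ → A[[t_1, …, t_q]]_∇`: a map of `A`-algebras such that
every `φ(s_i)` has order at least `1`. -/
structure SubstMap (Δ : CoIdeal p) (nab : CoIdeal q) where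
  toAlgHom : TruncSeries A Δ →ₐ[A] TruncSeries A nab
  order_pos : ∀ i, coeff 0 (toAlgHom (ofSeries Δ (MvPowerSeries.X i))) = 0

namespace SubstMap

open TruncSeries

variable {Δ : CoIdeal p} {nab : CoIdeal q} (φ : SubstMap A Δ nab)

/-- The coefficient `C_e(φ, α)` of `t^e` in `φ(s^α)`. -/
noncomputable def C (e : Fin q →₀ ℕ) (α : Fin p →₀ ℕ) : A :=
  coeff e (φ.toAlgHom (ofSeries Δ (MvPowerSeries.monomial α 1)))

open Classical in
theorem exists_decomposition (f : MvPowerSeries (Fin p) A) (n : ℕ)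
    (hf : ∀ α : Fin p →₀ ℕ, α.degree < n + 1 → MvPowerSeries.coeff α f = 0) :
    ∃ g : Fin p → MvPowerSeries (Fin p) A, f = ∑ i, MvPowerSeries.X i * g i ∧
      ∀ i, ∀ α : Fin p →₀ ℕ, α.degree < n → MvPowerSeries.coeff α (g i) = 0 := by
  have hex : ∀ α : Fin p →₀ ℕ, α ≠ 0 → ∃ i, α i ≠ 0 := fun α hα => by
    by_contra! h
    exact hα (Finsupp.ext h)
  by_cases hp : ¬ Nonempty (Fin p)
  · refine ⟨0, ?_, fun i => absurd ⟨i⟩ hp⟩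
    ext α
    have hα : α = 0 := by
      by_contra h
      obtain ⟨i, _⟩ := hex α h
      exact hp ⟨i⟩
    subst hα
    rw [hf 0 (by simp)]
    simp
  rw [not_not] at hp
  choose! idx hidx using hex
  let g : Fin p → MvPowerSeries (Fin p) A := fun i β =>
    if idx (β + Finsupp.single i 1) = i then
      MvPowerSeries.coeff (β + Finsupp.single i 1) f else 0
  have hg : ∀ i β, MvPowerSeries.coeff β (g i) = if idx (β + Finsupp.single i 1) = i then
      MvPowerSeries.coeff (β + Finsupp.single i 1) f else 0 := fun i β => rfl
  clear_value g
  refine ⟨g, ?_, ?_⟩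
  · ext α
    rw [map_sum]
    by_cases hα : α = 0
    · subst hα
      rw [hf 0 (by simp)]
      symm
      refine Finset.sum_eq_zero fun i _ => ?_
      rw [MvPowerSeries.coeff_zero_X_mul]
    · rw [Finset.sum_eq_single (idx α)]
      · have h1 : Finsupp.single (idx α) 1 ≤ α := by
          rw [Finsupp.single_le_iff]
          exact Nat.one_le_iff_ne_zero.2 (hidx α hα)
        generalize hj : idx α = j at h1 ⊢
        obtain ⟨β, hβ⟩ := exists_add_of_le h1
        conv_rhs => rw [hβ, MvPowerSeries.X, MvPowerSeries.coeff_add_monomial_mul, one_mul]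
        rw [add_comm] at hβ
        rw [hg, ← hβ, if_pos hj]
      · intro i _ hi
        by_cases h1 : Finsupp.single i 1 ≤ α
        · obtain ⟨β, hβ⟩ := exists_add_of_le h1
          conv_lhs => rw [hβ, MvPowerSeries.X, MvPowerSeries.coeff_add_monomial_mul, one_mul]
          rw [add_comm] at hβ
          rw [hg, ← hβ, if_neg (Ne.symm hi)]
        · rw [MvPowerSeries.X, MvPowerSeries.coeff_monomial_mul, if_neg h1]
      · simp
  · intro i α hα
    rw [hg]
    split_ifs with h
    · refine hf _ ?_
      rw [map_add, Finsupp.degree_single]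
      omega
    · rfl

theorem coeff_eq_zero_of_degree_lt (n : ℕ) : ∀ f : MvPowerSeries (Fin p) A,
    (∀ α : Fin p →₀ ℕ, α.degree < n → MvPowerSeries.coeff α f = 0) →
    ∀ e : Fin q →₀ ℕ, e.degree < n → coeff e (φ.toAlgHom (ofSeries Δ f)) = 0 := by
  induction n with
  | zero =>
    intro f _ e he
    exact absurd he (Nat.not_lt_zero _)
  | succ n ih =>
    intro f hf e he
    by_cases hen : e ∈ nab
    · obtain ⟨g, rfl, hg⟩ := exists_decomposition f n hf
      rw [map_sum, map_sum, coeff_sum]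
      refine Finset.sum_eq_zero fun i _ => ?_
      rw [map_mul, map_mul, coeff_mul hen]
      refine Finset.sum_eq_zero fun c hc => ?_
      rw [mem_antidiagonal] at hc
      by_cases hc1 : c.1 = 0
      · rw [hc1, φ.order_pos, zero_mul]
      · rw [ih (g i) (hg i) c.2, mul_zero]
        have h1 : c.1.degree ≠ 0 := fun h => hc1 ((Finsupp.degree_eq_zero_iff _).1 h)
        have h2 : c.1.degree + c.2.degree = e.degree := by rw [← map_add, hc]
        omega
    · exact coeff_of_notMem hen _

theorem C_of_notMem (e : Fin q →₀ ℕ) {α : Fin p →₀ ℕ} (hα : α ∉ Δ) : φ.C e α = 0 := by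
  classical
  have h : ofSeries Δ (MvPowerSeries.monomial α (1 : A)) = ofSeries Δ 0 := ofSeries_eq fun β hβ => by
    have hne : β ≠ α := by
      rintro rfl
      exact hα hβ
    rw [MvPowerSeries.coeff_monomial, if_neg hne, map_zero]
  unfold C
  rw [h, map_zero, map_zero, TruncSeries.coeff_zero]

/-- The explicit expression of a substitution map through the coefficients `C_e(φ, α)`. -/
theorem coeff_apply (e : Fin q →₀ ℕ) (f : MvPowerSeries (Fin p) A) :
    coeff e (φ.toAlgHom (ofSeries Δ f)) =
      ∑ α ∈ Δ.upTo e.degree, φ.C e α * MvPowerSeries.coeff α f := by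
  classical
  set S := (Finsupp.finite_of_degree_le (σ := Fin p) e.degree).toFinset with hS
  set g : MvPowerSeries (Fin p) A :=
    ∑ α ∈ S, MvPowerSeries.coeff α f • MvPowerSeries.monomial α 1 with hg
  have h1 : coeff e (φ.toAlgHom (ofSeries Δ (f - g))) = 0 := by
    refine φ.coeff_eq_zero_of_degree_lt (e.degree + 1) _ (fun α hα => ?_) e (Nat.lt_succ_self _)
    rw [map_sub, hg, map_sum, Finset.sum_eq_single α]
    · simp
    · intro β _ hβ
      rw [MvPowerSeries.coeff_smul, MvPowerSeries.coeff_monomial, if_neg (Ne.symm hβ), mul_zero]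
    · intro h
      exact absurd (by simp [hS]; omega) h
  have h2 : coeff e (φ.toAlgHom (ofSeries Δ f)) = coeff e (φ.toAlgHom (ofSeries Δ g)) := by
    have : f = (f - g) + g := by ring
    conv_lhs => rw [this, map_add, map_add, TruncSeries.coeff_add, h1, zero_add]
  rw [h2, hg, map_sum, map_sum, coeff_sum]
  symm
  refine Finset.sum_subset_zero_on_sdiff (Finset.filter_subset _ _) ?_ ?_
  · intro α hα
    rw [Finset.mem_sdiff] at hα
    rw [map_smul, map_smul, TruncSeries.coeff_smul]
    have : α ∉ Δ := fun h => hα.2 (CoIdeal.mem_upTo.2 ⟨by simpa [hS] using hα.1, h⟩)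
    have h0 := φ.C_of_notMem e this
    unfold C at h0
    rw [h0, mul_zero]
  · intro α _
    rw [map_smul, map_smul, TruncSeries.coeff_smul, mul_comm]
    rfl

end SubstMap

end TruncatedSeries

/-! ### Hasse–Schmidt derivations -/

section HasseSchmidtDerivations

variable (k A : Type*) [CommRing k] [CommRing A] [Algebra k A] {p q : ℕ}

/-- A `(p, Δ)`-variate Hasse–Schmidt derivation of `A` over `k`: a family `(D_α)_{α ∈ Δ}` of
`k`-linear endomorphisms of `A` with `D_0 = Id` and
`D_α(xy) = ∑_{β+γ=α} D_β(x) D_γ(y)`. The family is extended by `0` outside `Δ`. -/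
@[ext]
structure HS (Δ : CoIdeal p) where
  coeff : (Fin p →₀ ℕ) → Module.End k A
  coeff_of_notMem : ∀ α, α ∉ Δ → coeff α = 0
  coeff_zero : coeff 0 = 1
  leibniz : ∀ α ∈ Δ, ∀ x y : A,
    coeff α (x * y) = ∑ c ∈ antidiagonal α, coeff c.1 x * coeff c.2 y

namespace HS

variable {k A} {Δ : CoIdeal p} {nab : CoIdeal q}

variable (k A Δ) in
/-- The identity Hasse–Schmidt derivation `𝕀`. -/
def one : HS k A Δ where
  coeff α := if α = 0 then 1 else 0
  coeff_of_notMem α hα := if_neg (by rintro rfl; exact hα Δ.zero_mem)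
  coeff_zero := if_pos rfl
  leibniz := by
    intro α _ x y
    by_cases h : α = 0
    · subst h
      rw [Finset.sum_eq_single (0, 0)]
      · simp
      · rintro ⟨a, b⟩ hab hne
        rw [mem_antidiagonal, add_eq_zero] at hab
        exact absurd (Prod.ext hab.1 hab.2) hne
      · simp
    · rw [if_neg h]
      symm
      refine Finset.sum_eq_zero fun c hc => ?_
      rw [mem_antidiagonal] at hc
      by_cases h1 : c.1 = 0
      · by_cases h2 : c.2 = 0
        · exact absurd (by rw [← hc, h1, h2, add_zero]) h
        · simp [h2]
      · simp [h1]

theorem sum_four {ι M : Type*} [AddCommMonoid ι] [Finset.HasAntidiagonal ι]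
    [AddCommMonoid M] (f : ι → ι → ι → ι → M) (n : ι) :
    ∑ c ∈ antidiagonal n, ∑ u ∈ antidiagonal c.1, ∑ v ∈ antidiagonal c.2,
        f u.1 u.2 v.1 v.2 =
      ∑ c ∈ antidiagonal n, ∑ u ∈ antidiagonal c.1, ∑ v ∈ antidiagonal c.2,
        f u.1 v.1 u.2 v.2 := by
  have e : ∀ g : ι → ι → ι → ι → M,
      ∑ c ∈ antidiagonal n, ∑ u ∈ antidiagonal c.1, ∑ v ∈ antidiagonal c.2,
        g u.1 u.2 v.1 v.2 = ∑ c ∈ antidiagonal n, ∑ x ∈ antidiagonal c.1 ×ˢ antidiagonal c.2,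
        g x.1.1 x.1.2 x.2.1 x.2.2 := fun g =>
    Finset.sum_congr rfl fun c _ => by rw [Finset.sum_product]
  rw [e f, e fun a b c d => f a c b d, Finset.sum_sigma', Finset.sum_sigma']
  refine Finset.sum_nbij'
    (fun x => ⟨(x.2.1.1 + x.2.2.1, x.2.1.2 + x.2.2.2), ((x.2.1.1, x.2.2.1), (x.2.1.2, x.2.2.2))⟩)
    (fun x => ⟨(x.2.1.1 + x.2.2.1, x.2.1.2 + x.2.2.2), ((x.2.1.1, x.2.2.1), (x.2.1.2, x.2.2.2))⟩)
    ?_ ?_ ?_ ?_ ?_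
  · rintro ⟨⟨a, b⟩, ⟨⟨c, d⟩, ⟨g, h⟩⟩⟩ hx
    simp only [Finset.mem_sigma, Finset.mem_product, mem_antidiagonal] at hx ⊢
    obtain ⟨h1, rfl, rfl⟩ := hx
    exact ⟨by rw [← h1]; abel, trivial, trivial⟩
  · rintro ⟨⟨a, b⟩, ⟨⟨c, d⟩, ⟨g, h⟩⟩⟩ hx
    simp only [Finset.mem_sigma, Finset.mem_product, mem_antidiagonal] at hx ⊢
    obtain ⟨h1, rfl, rfl⟩ := hx
    exact ⟨by rw [← h1]; abel, trivial, trivial⟩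
  · rintro ⟨⟨a, b⟩, ⟨⟨c, d⟩, ⟨g, h⟩⟩⟩ hx
    simp only [Finset.mem_sigma, Finset.mem_product, mem_antidiagonal] at hx
    obtain ⟨h1, rfl, rfl⟩ := hx
    rfl
  · rintro ⟨⟨a, b⟩, ⟨⟨c, d⟩, ⟨g, h⟩⟩⟩ hx
    simp only [Finset.mem_sigma, Finset.mem_product, mem_antidiagonal] at hx
    obtain ⟨h1, rfl, rfl⟩ := hx
    rfl
  · intro x _
    rfl

open Classical in
/-- The composition `D ∘ E`, with `(D ∘ E)_α = ∑_{β+γ=α} D_β ∘ E_γ`. -/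
noncomputable def comp (D E : HS k A Δ) : HS k A Δ where
  coeff α := if α ∈ Δ then ∑ c ∈ antidiagonal α, D.coeff c.1 * E.coeff c.2 else 0
  coeff_of_notMem α hα := if_neg hα
  coeff_zero := by
    rw [if_pos Δ.zero_mem]
    simp [D.coeff_zero, E.coeff_zero]
  leibniz := by
    intro α hα x y
    rw [if_pos hα]
    have hR : ∀ c ∈ antidiagonal α,
        (if c.1 ∈ Δ then ∑ u ∈ antidiagonal c.1, D.coeff u.1 * E.coeff u.2 else 0) x *
          (if c.2 ∈ Δ then ∑ u ∈ antidiagonal c.2, D.coeff u.1 * E.coeff u.2 else 0) y =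
        ∑ u ∈ antidiagonal c.1, ∑ v ∈ antidiagonal c.2,
          D.coeff u.1 (E.coeff u.2 x) * D.coeff v.1 (E.coeff v.2 y) := fun c hc => by
      rw [if_pos (Δ.mem_of_antidiagonal hα hc).1, if_pos (Δ.mem_of_antidiagonal hα hc).2,
        LinearMap.sum_apply, LinearMap.sum_apply, Finset.sum_mul_sum]
      rfl
    rw [Finset.sum_congr rfl hR,
      sum_four (fun a b c d => D.coeff a (E.coeff b x) * D.coeff c (E.coeff d y)),
      LinearMap.sum_apply]
    refine Finset.sum_congr rfl fun c hc => ?_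
    have hc' := Δ.mem_of_antidiagonal hα hc
    rw [Module.End.mul_apply, E.leibniz _ hc'.2, map_sum, Finset.sum_comm]
    refine Finset.sum_congr rfl fun v _ => ?_
    rw [D.leibniz _ hc'.1]

theorem comp_coeff (D E : HS k A Δ) {α : Fin p →₀ ℕ} (hα : α ∈ Δ) :
    (D.comp E).coeff α = ∑ c ∈ antidiagonal α, D.coeff c.1 * E.coeff c.2 := if_pos hα

theorem upTo_zero (Δ : CoIdeal p) : Δ.upTo 0 = {0} := by
  ext α
  rw [CoIdeal.mem_upTo, Finset.mem_singleton, Nat.le_zero, Finsupp.degree_eq_zero_iff]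
  exact ⟨fun h => h.1, fun h => ⟨h, by rw [h]; exact Δ.zero_mem⟩⟩

/-- The power series `∑_α D_α(a) s^α`. -/
def series (D : HS k A Δ) (a : A) : MvPowerSeries (Fin p) A := fun α => D.coeff α a

theorem coeff_series (D : HS k A Δ) (a : A) (α : Fin p →₀ ℕ) :
    MvPowerSeries.coeff α (D.series a) = D.coeff α a := rfl

/-- The coefficients of `φ • D` express the map `a ↦ φ(∑_α D_α(a) s^α)`. -/
theorem subst_aux (φ : SubstMap A Δ nab) (D : HS k A Δ) (e : Fin q →₀ ℕ) (a : A) :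
    (∑ α ∈ Δ.upTo e.degree, φ.C e α • D.coeff α) a =
      TruncSeries.coeff e (φ.toAlgHom (TruncSeries.ofSeries Δ (D.series a))) := by
  rw [φ.coeff_apply, LinearMap.sum_apply]
  rfl

/-- The action `φ • D` of a substitution map, with
`(φ • D)_e = ∑_{α ∈ Δ, |α| ≤ |e|} C_e(φ, α) D_α`. -/
noncomputable def subst (φ : SubstMap A Δ nab) (D : HS k A Δ) : HS k A nab where
  coeff e := ∑ α ∈ Δ.upTo e.degree, φ.C e α • D.coeff α
  coeff_of_notMem e he := by
    refine Finset.sum_eq_zero fun α _ => ?_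
    unfold SubstMap.C
    rw [TruncSeries.coeff_of_notMem he, zero_smul]
  coeff_zero := by
    have h1 : φ.C 0 0 = 1 := by
      unfold SubstMap.C
      have : (MvPowerSeries.monomial (0 : Fin p →₀ ℕ) (1 : A)) = 1 := rfl
      rw [this, map_one, map_one, ← map_one (TruncSeries.ofSeries nab),
        TruncSeries.coeff_ofSeries nab.zero_mem]
      simp
    rw [map_zero, upTo_zero, Finset.sum_singleton, h1, D.coeff_zero, one_smul]
  leibniz := by
    intro e he x y
    rw [subst_aux]
    have h1 : TruncSeries.ofSeries Δ (D.series (x * y)) =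
        TruncSeries.ofSeries Δ (D.series x) *
          TruncSeries.ofSeries Δ (D.series y) := by
      rw [← map_mul]
      refine TruncSeries.ofSeries_eq fun α hα => ?_
      rw [MvPowerSeries.coeff_mul]
      exact D.leibniz α hα x y
    rw [h1, map_mul, TruncSeries.coeff_mul he]
    refine Finset.sum_congr rfl fun c _ => ?_
    rw [subst_aux, subst_aux]

/-- Multiplication of the variables by `a`, as a scaling: `(a • D)_α = a^{|α|} D_α`. -/
noncomputable def scale (a : A) (D : HS k A Δ) : HS k A Δ where
  coeff α := a ^ α.degree • D.coeff α
  coeff_of_notMem α hα := by rw [D.coeff_of_notMem α hα, smul_zero]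
  coeff_zero := by rw [map_zero, pow_zero, one_smul, D.coeff_zero]
  leibniz := by
    intro α hα x y
    rw [LinearMap.smul_apply, D.leibniz α hα, smul_eq_mul, Finset.mul_sum]
    refine Finset.sum_congr rfl fun c hc => ?_
    rw [mem_antidiagonal] at hc
    rw [← hc, map_add, pow_add, LinearMap.smul_apply, LinearMap.smul_apply, smul_eq_mul,
      smul_eq_mul]
    ring

end HS

/-- The co-ideal `{0, …, m}` of `ℕ`. -/
abbrev CoIdeal.interval (m : ℕ) : CoIdeal 1 := CoIdeal.total 1 m

/-- The multi-index `i ∈ ℕ = ℕ^1`. -/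
noncomputable abbrev idx (i : ℕ) : Fin 1 →₀ ℕ := Finsupp.single 0 i

theorem idx_mem {m i : ℕ} (h : i ≤ m) : idx i ∈ CoIdeal.interval m := by
  rw [CoIdeal.mem_total, Finsupp.degree_single]
  exact h

variable {k A} in
/-- Hasse–Schmidt derivations of length `m` in the classical indexing. -/
noncomputable def HS.nth {m : ℕ} (D : HS k A (CoIdeal.interval m)) (i : ℕ) : Module.End k A :=
  D.coeff (idx i)

variable {k A} in
theorem HS.sum_nth {M : Type*} [AddCommMonoid M] (f : (Fin 1 →₀ ℕ) → (Fin 1 →₀ ℕ) → M) (i : ℕ) :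
    ∑ c ∈ antidiagonal (idx i), f c.1 c.2 = ∑ c ∈ antidiagonal i, f (idx c.1) (idx c.2) := by
  rw [Finsupp.antidiagonal_single, Finset.sum_map]
  rfl

variable {k A} in
theorem HS.nth_leibniz {m : ℕ} (D : HS k A (CoIdeal.interval m)) {i : ℕ} (hi : i ≤ m) (x y : A) :
    D.nth i (x * y) = ∑ c ∈ antidiagonal i, D.nth c.1 x * D.nth c.2 y :=
  (D.leibniz _ (idx_mem hi) x y).trans
    (HS.sum_nth (fun b c => D.coeff b x * D.coeff c y) i)

variable {k A} in
theorem HS.nth_zero {m : ℕ} (D : HS k A (CoIdeal.interval m)) : D.nth 0 = 1 := by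
  unfold HS.nth idx
  rw [Finsupp.single_zero, D.coeff_zero]

variable {k A} in
theorem HS.comp_nth {m : ℕ} (D E : HS k A (CoIdeal.interval m)) {i : ℕ} (hi : i ≤ m) :
    (D.comp E).nth i = ∑ c ∈ antidiagonal i, D.nth c.1 * E.nth c.2 :=
  (D.comp_coeff E (idx_mem hi)).trans
    (HS.sum_nth (fun b c => D.coeff b * E.coeff c) i)

variable {k A} in
theorem HS.scale_nth {m : ℕ} (a : A) (D : HS k A (CoIdeal.interval m)) (i : ℕ) :
    (D.scale a).nth i = a ^ i • D.nth i := by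
  unfold HS.nth HS.scale
  simp

variable {k A} in
open Classical in
/-- The truncation of a Hasse–Schmidt derivation to a smaller length. -/
noncomputable def HS.truncate {m m' : ℕ} (h : m ≤ m') (D : HS k A (CoIdeal.interval m')) :
    HS k A (CoIdeal.interval m) where
  coeff α := if α ∈ CoIdeal.interval m then D.coeff α else 0
  coeff_of_notMem α hα := if_neg hα
  coeff_zero := by rw [if_pos (CoIdeal.zero_mem _), D.coeff_zero]
  leibniz := by
    intro α hα x y
    rw [if_pos hα, D.leibniz α (le_trans (CoIdeal.mem_total.1 hα) h)]
    refine Finset.sum_congr rfl fun c hc => ?_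
    have hc' := CoIdeal.mem_of_antidiagonal _ hα hc
    rw [if_pos hc'.1, if_pos hc'.2]

variable {k A} in
theorem HS.truncate_nth {m m' : ℕ} (h : m ≤ m') (D : HS k A (CoIdeal.interval m')) {i : ℕ}
    (hi : i ≤ m) : (D.truncate h).nth i = D.nth i := if_pos (idx_mem hi)

/-- The `A`-module `Ider_k(A; m)` of the `m`-integrable `k`-derivations `δ : A → A`: there is a
Hasse–Schmidt derivation `D` of length `m` with `D_1 = δ`. -/
def Ider (m : ℕ) (hm : 1 ≤ m) : Submodule A (Derivation k A A) where
  carrier := {δ | ∃ D : HS k A (CoIdeal.interval m), D.nth 1 = δ}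
  zero_mem' := by
    refine ⟨HS.one k A _, ?_⟩
    ext x
    simp [HS.nth, HS.one]
  add_mem' := by
    rintro δ ε ⟨D, hD⟩ ⟨E, hE⟩
    refine ⟨D.comp E, ?_⟩
    rw [HS.comp_nth _ _ hm, Derivation.coe_add_linearMap, ← hD, ← hE,
      Finset.Nat.antidiagonal_succ]
    simp [HS.nth_zero, add_comm]
  smul_mem' := by
    rintro a δ ⟨D, hD⟩
    refine ⟨D.scale a, ?_⟩
    rw [HS.scale_nth, pow_one, hD]
    rfl

/-- The `A`-module `Ider^f_k(A)` of the f-integrable derivations, i.e. those that are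
`m`-integrable for all integers `m ≥ 1`. -/
def Iderf : Submodule A (Derivation k A A) := ⨅ (m : ℕ) (hm : 1 ≤ m), Ider k A m hm

variable {k A} in
theorem Ider_anti {m m' : ℕ} (hm : 1 ≤ m) (hm' : 1 ≤ m') (h : m ≤ m') :
    Ider k A m' hm' ≤ Ider k A m hm := by
  rintro δ ⟨D, hD⟩
  exact ⟨D.truncate h, (D.truncate_nth h hm).trans hD⟩

variable {k A} in
theorem Iderf_le (m : ℕ) (hm : 1 ≤ m) : Iderf k A ≤ Ider k A m hm :=
  iInf₂_le m hm

end HasseSchmidtDerivations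

/-! ### Differential operators -/

section DifferentialOperators

variable (k A : Type*) [CommRing k] [CommRing A] [Algebra k A] {p q : ℕ}

variable {A} in
/-- Multiplication by `a`, as an endomorphism of `A`. -/
abbrev mulBy (a : A) : Module.End k A := Algebra.lmul k A a

variable {k A} in
/-- The bracket `[P, a] = P ∘ a - a ∘ P`. -/
def bracket (a : A) : Module.End k A →ₗ[k] Module.End k A where
  toFun P := P * mulBy k a - mulBy k a * P
  map_add' P Q := by rw [add_mul, mul_add]; abel
  map_smul' c P := by rw [smul_mul_assoc, mul_smul_comm, smul_sub]; rfl

variable {k A} in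
theorem bracket_apply (a : A) (P : Module.End k A) :
    bracket a P = P * mulBy k a - mulBy k a * P := rfl

variable {k A} in
theorem bracket_mul (a : A) (P Q : Module.End k A) :
    bracket a (P * Q) = P * bracket a Q + bracket a P * Q := by
  simp only [bracket_apply, mul_sub, sub_mul, mul_assoc]
  abel

variable {k A} in
theorem mulBy_one : mulBy k (1 : A) = 1 := map_one (Algebra.lmul k A)

variable {k A} in
theorem mulBy_zero : mulBy k (0 : A) = 0 := map_zero (Algebra.lmul k A)

variable {k A} in
theorem mulBy_mul (a b : A) : mulBy k (a * b) = mulBy k a * mulBy k b :=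
  map_mul (Algebra.lmul k A) a b

variable {k A} in
theorem mulBy_apply (a x : A) : mulBy k a x = a * x := rfl

variable {k A} in
theorem bracket_mulBy (a b : A) : bracket a (mulBy k b) = 0 := by
  rw [bracket_apply, ← mulBy_mul, ← mulBy_mul, mul_comm, sub_self]

/-- The `k`-linear differential operators `A → A` of order `< n`: only `0` for `n = 0`, and `P` has
order `< n + 1` if and only if all the brackets `[P, a]` have order `< n`. -/
def diffLT : ℕ → Submodule k (Module.End k A)
  | 0 => ⊥
  | n + 1 => ⨅ a : A, (diffLT n).comap (bracket a)

variable {k A}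

theorem mem_diffLT_zero {P : Module.End k A} : P ∈ diffLT k A 0 ↔ P = 0 := by
  simp [diffLT]

theorem mem_diffLT_succ {n : ℕ} {P : Module.End k A} :
    P ∈ diffLT k A (n + 1) ↔ ∀ a, bracket a P ∈ diffLT k A n := by
  simp [diffLT, Submodule.mem_iInf]

theorem diffLT_le_succ (n : ℕ) : diffLT k A n ≤ diffLT k A (n + 1) := by
  induction n with
  | zero => exact bot_le
  | succ n ih =>
    intro P hP
    rw [mem_diffLT_succ] at hP ⊢
    exact fun a => ih (hP a)

theorem diffLT_mono : Monotone (diffLT k A) := monotone_nat_of_le_succ diffLT_le_succ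

theorem mulBy_mem (a : A) : mulBy k a ∈ diffLT k A 1 := by
  rw [mem_diffLT_succ]
  intro b
  rw [bracket_mulBy]
  exact zero_mem _

theorem one_mem_diffLT : (1 : Module.End k A) ∈ diffLT k A 1 := by
  have := mulBy_mem (k := k) (1 : A)
  rwa [mulBy_one] at this

theorem mul_mem_diffLT_aux (n : ℕ) : ∀ i j : ℕ, i + j = n → ∀ P Q : Module.End k A,
    P ∈ diffLT k A i → Q ∈ diffLT k A (j + 1) → P * Q ∈ diffLT k A n := by
  induction n with
  | zero =>
    intro i j hij P Q hP _
    obtain rfl : i = 0 := by omega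
    rw [mem_diffLT_zero] at hP ⊢
    rw [hP, zero_mul]
  | succ n ih =>
    intro i j hij P Q hP hQ
    cases i with
    | zero =>
      rw [mem_diffLT_zero] at hP
      rw [hP, zero_mul]
      exact zero_mem _
    | succ i =>
      rw [mem_diffLT_succ]
      intro a
      rw [bracket_mul]
      refine add_mem ?_ (ih i j (by omega) _ _ (mem_diffLT_succ.1 hP a) hQ)
      have hQa := mem_diffLT_succ.1 hQ a
      cases j with
      | zero =>
        rw [mem_diffLT_zero] at hQa
        rw [hQa, mul_zero]
        exact zero_mem _
      | succ j => exact ih (i + 1) j (by omega) _ _ hP hQa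

theorem mul_mem_diffLT {i j : ℕ} {P Q : Module.End k A} (hP : P ∈ diffLT k A i)
    (hQ : Q ∈ diffLT k A (j + 1)) : P * Q ∈ diffLT k A (i + j) :=
  mul_mem_diffLT_aux _ i j rfl P Q hP hQ

theorem mul_mem_diffLT' {i j : ℕ} {P Q : Module.End k A} (hP : P ∈ diffLT k A (i + 1))
    (hQ : Q ∈ diffLT k A j) : P * Q ∈ diffLT k A (i + j) := by
  cases j with
  | zero =>
    rw [mem_diffLT_zero] at hQ
    rw [hQ, mul_zero]
    exact zero_mem _
  | succ j =>
    have := mul_mem_diffLT hP hQ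
    rwa [show i + (j + 1) = i + 1 + j by omega]

theorem mulBy_mul_mem {n : ℕ} (a : A) {P : Module.End k A} (hP : P ∈ diffLT k A n) :
    mulBy k a * P ∈ diffLT k A n := by
  have := mul_mem_diffLT' (i := 0) (mulBy_mem (k := k) a) hP
  rwa [zero_add] at this

theorem commutator_mem_diffLT (n : ℕ) : ∀ i j : ℕ, i + j = n → ∀ P Q : Module.End k A,
    P ∈ diffLT k A (i + 1) → Q ∈ diffLT k A (j + 1) → P * Q - Q * P ∈ diffLT k A n := by
  induction n with
  | zero =>
    intro i j hij P Q hP hQ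
    obtain rfl : i = 0 := by omega
    obtain rfl : j = 0 := by omega
    have key : ∀ P : Module.End k A, P ∈ diffLT k A (0 + 1) → P = mulBy k (P 1) := by
      intro P hP
      ext x
      have h := mem_diffLT_zero.1 (mem_diffLT_succ.1 hP x)
      rw [bracket_apply, sub_eq_zero] at h
      have h1 := LinearMap.congr_fun h 1
      rw [Module.End.mul_apply, Module.End.mul_apply, mulBy_apply, mulBy_apply, mul_one] at h1
      rw [h1, mulBy_apply, mul_comm]
    rw [mem_diffLT_zero, key P hP, key Q hQ, ← mulBy_mul, ← mulBy_mul, mul_comm, sub_self]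
  | succ n ih =>
    intro i j hij P Q hP hQ
    rw [mem_diffLT_succ]
    intro a
    have e : bracket a (P * Q - Q * P) = (bracket a P * Q - Q * bracket a P) +
        (P * bracket a Q - bracket a Q * P) := by
      rw [map_sub, bracket_mul, bracket_mul]
      abel
    rw [e]
    have hPa := mem_diffLT_succ.1 hP a
    have hQa := mem_diffLT_succ.1 hQ a
    refine add_mem ?_ ?_
    · cases i with
      | zero =>
        rw [mem_diffLT_zero] at hPa
        rw [hPa, zero_mul, mul_zero, sub_zero]
        exact zero_mem _
      | succ i => exact ih i j (by omega) _ _ hPa hQ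
    · cases j with
      | zero =>
        rw [mem_diffLT_zero] at hQa
        rw [hQa, zero_mul, mul_zero, sub_zero]
        exact zero_mem _
      | succ j => exact ih i j (by omega) _ _ hP hQa

variable (k A) in
/-- The `k`-algebra `𝒟_{A/k}` of `k`-linear differential operators of `A`. -/
def diffRing : Subalgebra k (Module.End k A) where
  carrier := {P | ∃ n, P ∈ diffLT k A n}
  mul_mem' := by
    rintro P Q ⟨i, hP⟩ ⟨j, hQ⟩
    exact ⟨i + j, mul_mem_diffLT hP (diffLT_le_succ j hQ)⟩
  add_mem' := by
    rintro P Q ⟨i, hP⟩ ⟨j, hQ⟩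
    exact ⟨max i j, add_mem (diffLT_mono (le_max_left i j) hP) (diffLT_mono (le_max_right i j) hQ)⟩
  algebraMap_mem' c := ⟨1, by
    rw [Algebra.algebraMap_eq_smul_one]
    exact Submodule.smul_mem _ _ one_mem_diffLT⟩

variable (k A) in
/-- The filtration of `𝒟_{A/k}` by the order: `F_d` consists of the operators of order `≤ d`. -/
def diffFiltration : RingFiltration k (diffRing k A) where
  deg d := (diffLT k A (d + 1)).comap (diffRing k A).val.toLinearMap
  mono := fun i j h P hP => diffLT_mono (Nat.add_le_add_right h 1) hP
  one_mem := one_mem_diffLT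
  mul_mem := by
    intro i j P Q hP hQ
    have h := mul_mem_diffLT (k := k) (A := A) (i := i + 1) (j := j) hP hQ
    have h' : (P : Module.End k A) * Q ∈ diffLT k A (i + j + 1) := by
      rwa [show i + j + 1 = i + 1 + j by omega]
    exact h'

theorem mem_diffFiltration_deg {d : ℕ} {P : diffRing k A} :
    P ∈ (diffFiltration k A).deg d ↔ (P : Module.End k A) ∈ diffLT k A (d + 1) := Iff.rfl

theorem mem_diffFiltration_below {d : ℕ} {P : diffRing k A} :
    P ∈ (diffFiltration k A).below d ↔ (P : Module.End k A) ∈ diffLT k A d := by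
  cases d with
  | zero =>
    change P ∈ (⊥ : Submodule k (diffRing k A)) ↔ _
    rw [Submodule.mem_bot, mem_diffLT_zero]
    exact Subtype.ext_iff
  | succ d => exact Iff.rfl

variable (k A) in
/-- The graded ring `gr 𝒟_{A/k}`. -/
abbrev GrD : Type _ := (diffFiltration k A).Gr

noncomputable instance instCommRingGrD : CommRing (GrD k A) where
  mul_comm := (diffFiltration k A).gr_mul_comm fun i j P Q hP hQ =>
    mem_diffFiltration_below.2 (by
      have h := commutator_mem_diffLT (i + j) i j rfl (P : Module.End k A) Q hP hQ
      exact h)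

variable (k A) in
/-- The map `A → 𝒟_{A/k}`, `a ↦ (x ↦ a x)`. -/
def toDiffRing : A →ₐ[k] diffRing k A :=
  (Algebra.lmul k A).codRestrict (diffRing k A) fun a => ⟨1, mulBy_mem a⟩

noncomputable instance instAlgebraGrD :
    @Algebra A (GrD k A) _ (instCommRingGrD (k := k) (A := A)).toCommSemiring.toSemiring :=
  RingHom.toAlgebra (S := GrD k A) ((diffFiltration k A).structureMap (toDiffRing k A).toRingHom
    fun a => mem_diffFiltration_deg.2 (mulBy_mem a))

end DifferentialOperators

/-! ### Symbols of Hasse–Schmidt derivations -/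

section Symbols

variable {k A : Type*} [CommRing k] [CommRing A] [Algebra k A] {p : ℕ}

namespace HS

theorem bracket_coeff {Δ : CoIdeal p} (D : HS k A Δ) {α : Fin p →₀ ℕ} (hα : α ∈ Δ) (a : A) :
    bracket a (D.coeff α) =
      ∑ c ∈ (antidiagonal α).erase (0, α), mulBy k (D.coeff c.1 a) * D.coeff c.2 := by
  classical
  have h0 : ((0 : Fin p →₀ ℕ), α) ∈ antidiagonal α := by
    rw [mem_antidiagonal, zero_add]
  have h : D.coeff α * mulBy k a =
      ∑ c ∈ antidiagonal α, mulBy k (D.coeff c.1 a) * D.coeff c.2 := by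
    ext x
    rw [LinearMap.sum_apply]
    exact D.leibniz α hα a x
  rw [bracket_apply, h, ← Finset.add_sum_erase _ _ h0, D.coeff_zero]
  simp

theorem coeff_mem_diffLT_aux {Δ : CoIdeal p} (D : HS k A Δ) (ℓ : ℕ) (α : Fin p →₀ ℕ)
    (hα : α ∈ Δ) (hℓ : ∀ β ≤ α, β ≠ 0 → β.degree < ℓ → D.coeff β = 0) (n : ℕ) :
    ∀ γ ≤ α, γ.degree < n * ℓ → D.coeff γ ∈ diffLT k A n := by
  induction n with
  | zero =>
    intro γ _ h
    omega
  | succ n ih =>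
    intro γ hγ h
    rw [mem_diffLT_succ]
    intro a
    rw [D.bracket_coeff (Δ.lower hγ hα)]
    refine sum_mem fun c hc => ?_
    rw [Finset.mem_erase, mem_antidiagonal] at hc
    obtain ⟨hne, hc⟩ := hc
    have hc1 : c.1 ≤ α := le_trans (by rw [← hc]; exact le_self_add) hγ
    have hc2 : c.2 ≤ α := le_trans (by rw [← hc]; exact le_add_self) hγ
    have hc0 : c.1 ≠ 0 := by
      intro h0
      refine hne (Prod.ext h0 ?_)
      rw [← hc, h0, zero_add]
    by_cases hlt : c.1.degree < ℓ
    · rw [hℓ _ hc1 hc0 hlt, LinearMap.zero_apply, mulBy_zero, zero_mul]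
      exact zero_mem _
    · refine mulBy_mul_mem _ (ih _ hc2 ?_)
      have hd : c.1.degree + c.2.degree = γ.degree := by rw [← map_add, hc]
      have : (n + 1) * ℓ = n * ℓ + ℓ := by ring
      omega

/-- The number `ℓ_α(D) = min {r ≥ 1 : D_β ≠ 0 for some β ≤ α with |β| = r}`. When this set is empty,
`ℓ_α(D)` is `∞` and is represented here by `0`; since `n / 0 = 0` for natural numbers, the quotient
`⌊|α| / ℓ_α(D)⌋` is then `0`, as it has to be. -/
noncomputable def ell {Δ : CoIdeal p} (D : HS k A Δ) (α : Fin p →₀ ℕ) : ℕ :=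
  sInf {r | 1 ≤ r ∧ ∃ β ≤ α, β.degree = r ∧ D.coeff β ≠ 0}

theorem coeff_mem_diffLT {Δ : CoIdeal p} (D : HS k A Δ) (α : Fin p →₀ ℕ) (hα : α ∈ Δ) :
    D.coeff α ∈ diffLT k A (α.degree / D.ell α + 1) := by
  have hdeg : ∀ β : Fin p →₀ ℕ, β ≠ 0 → 1 ≤ β.degree := fun β hβ => by
    rw [Nat.one_le_iff_ne_zero, Ne, Finsupp.degree_eq_zero_iff]
    exact hβ
  rcases Set.eq_empty_or_nonempty {r | 1 ≤ r ∧ ∃ β ≤ α, β.degree = r ∧ D.coeff β ≠ 0} with h | h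
  · have h0 : D.ell α = 0 := by
      unfold ell
      rw [h, Nat.sInf_empty]
    rw [h0, Nat.div_zero]
    refine D.coeff_mem_diffLT_aux (α.degree + 1) α hα (fun β hβ hβ0 _ => ?_) 1 α le_rfl (by omega)
    by_contra hne
    have : β.degree ∈ {r | 1 ≤ r ∧ ∃ β ≤ α, β.degree = r ∧ D.coeff β ≠ 0} :=
      ⟨hdeg β hβ0, β, hβ, rfl, hne⟩
    rw [h] at this
    exact this
  · have hpos : 1 ≤ D.ell α := (Nat.sInf_mem h).1
    refine D.coeff_mem_diffLT_aux (D.ell α) α hα (fun β hβ hβ0 hlt => ?_) _ α le_rfl ?_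
    · by_contra hne
      exact Nat.notMem_of_lt_sInf hlt ⟨hdeg β hβ0, β, hβ, rfl, hne⟩
    · rw [mul_comm]
      exact Nat.lt_mul_div_succ _ hpos

variable {m : ℕ}

theorem nth_mem_diffLT (D : HS k A (CoIdeal.interval m)) (i : ℕ) :
    D.nth i ∈ diffLT k A (i + 1) := by
  by_cases h : idx i ∈ CoIdeal.interval m
  · refine D.coeff_mem_diffLT_aux 1 (idx i) h (fun β _ hβ hlt => ?_) (i + 1) _ le_rfl ?_
    · rw [Nat.lt_one_iff, Finsupp.degree_eq_zero_iff] at hlt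
      exact absurd hlt hβ
    · rw [Finsupp.degree_single]
      omega
  · unfold nth
    rw [D.coeff_of_notMem _ h]
    exact zero_mem _

theorem bracket_nth (D : HS k A (CoIdeal.interval m)) {i : ℕ} (hi : i + 1 ≤ m) (a : A) :
    bracket a (D.nth (i + 1)) - mulBy k (D.nth 1 a) * D.nth i ∈ diffLT k A i := by
  have h : D.nth (i + 1) * mulBy k a =
      ∑ c ∈ antidiagonal (i + 1), mulBy k (D.nth c.1 a) * D.nth c.2 := by
    ext x
    rw [LinearMap.sum_apply]
    exact D.nth_leibniz hi a x
  have h2 : bracket a (D.nth (i + 1)) =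
      ∑ c ∈ antidiagonal i, mulBy k (D.nth (c.1 + 1) a) * D.nth c.2 := by
    rw [bracket_apply, h, Finset.Nat.sum_antidiagonal_succ]
    simp [D.nth_zero]
  rw [h2]
  cases i with
  | zero => simp
  | succ i =>
    rw [Finset.Nat.sum_antidiagonal_succ, zero_add, add_sub_cancel_left]
    refine sum_mem fun c hc => mulBy_mul_mem _ ?_
    rw [mem_antidiagonal] at hc
    exact diffLT_mono (by omega) (D.nth_mem_diffLT c.2)

theorem nth_mul_nth (D : HS k A (CoIdeal.interval m)) (n : ℕ) : ∀ i j : ℕ, i + j = n → n ≤ m →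
    D.nth i * D.nth j - ((n.choose i : ℕ) : Module.End k A) * D.nth n ∈ diffLT k A n := by
  induction n with
  | zero =>
    intro i j hij _
    obtain rfl : i = 0 := by omega
    obtain rfl : j = 0 := by omega
    simp [D.nth_zero]
  | succ n ih =>
    intro i j hij hm
    rcases Nat.eq_zero_or_pos i with rfl | hi
    · obtain rfl : j = n + 1 := by omega
      simp [D.nth_zero]
    rcases Nat.eq_zero_or_pos j with rfl | hj
    · obtain rfl : i = n + 1 := by omega
      simp [D.nth_zero]
    obtain ⟨i, rfl⟩ := Nat.exists_eq_succ_of_ne_zero hi.ne'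
    obtain ⟨j, rfl⟩ := Nat.exists_eq_succ_of_ne_zero hj.ne'
    simp only [Nat.succ_eq_add_one] at hij ⊢
    rw [mem_diffLT_succ]
    intro a
    set d := mulBy k (D.nth 1 a) with hd
    have hdm : d ∈ diffLT k A 1 := mulBy_mem _
    have e1 := D.bracket_nth (i := i) (by omega) a
    have e2 := D.bracket_nth (i := j) (by omega) a
    have e3 := D.bracket_nth (i := n) (by omega) a
    have i1 := ih i (j + 1) (by omega) (by omega)
    have i2 := ih (i + 1) j (by omega) (by omega)
    rw [← hd] at e1 e2 e3
    have t1 : D.nth (i + 1) * (bracket a (D.nth (j + 1)) - d * D.nth j) ∈ diffLT k A n := by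
      have := mul_mem_diffLT' (D.nth_mem_diffLT (i + 1)) e2
      rwa [show i + 1 + j = n by omega] at this
    have t2 : (bracket a (D.nth (i + 1)) - d * D.nth i) * D.nth (j + 1) ∈ diffLT k A n := by
      have := mul_mem_diffLT e1 (D.nth_mem_diffLT (j + 1))
      rwa [show i + (j + 1) = n by omega] at this
    have t3 : (D.nth (i + 1) * d - d * D.nth (i + 1)) * D.nth j ∈ diffLT k A n := by
      have h := commutator_mem_diffLT (i + 1) (i + 1) 0 rfl _ _ (D.nth_mem_diffLT (i + 1)) hdm
      have := mul_mem_diffLT h (D.nth_mem_diffLT j)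
      rwa [show i + 1 + j = n by omega] at this
    have t4 := mulBy_mul_mem (D.nth 1 a) i1
    have t5 := mulBy_mul_mem (D.nth 1 a) i2
    rw [← hd] at t4 t5
    have t6 : ((n + 1).choose (i + 1) : Module.End k A) *
        (bracket a (D.nth (n + 1)) - d * D.nth n) ∈ diffLT k A n := by
      rw [← nsmul_eq_mul]
      exact nsmul_mem e3 _
    have hb : bracket a (D.nth (i + 1) * D.nth (j + 1) -
        (((n + 1).choose (i + 1) : ℕ) : Module.End k A) * D.nth (n + 1)) =
        D.nth (i + 1) * (bracket a (D.nth (j + 1)) - d * D.nth j) +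
        (bracket a (D.nth (i + 1)) - d * D.nth i) * D.nth (j + 1) +
        (D.nth (i + 1) * d - d * D.nth (i + 1)) * D.nth j +
        d * (D.nth i * D.nth (j + 1) - ((n.choose i : ℕ) : Module.End k A) * D.nth n) +
        d * (D.nth (i + 1) * D.nth j - ((n.choose (i + 1) : ℕ) : Module.End k A) * D.nth n) -
        ((n + 1).choose (i + 1) : Module.End k A) *
          (bracket a (D.nth (n + 1)) - d * D.nth n) := by
      rw [map_sub, bracket_mul, ← nsmul_eq_mul, map_nsmul, nsmul_eq_mul]
      have c1 : d * (((n.choose i : ℕ) : Module.End k A) * D.nth n) =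
          ((n.choose i : ℕ) : Module.End k A) * (d * D.nth n) := by
        rw [← mul_assoc, ← mul_assoc, (Nat.cast_commute _ _).eq]
      have c2 : d * (((n.choose (i + 1) : ℕ) : Module.End k A) * D.nth n) =
          ((n.choose (i + 1) : ℕ) : Module.End k A) * (d * D.nth n) := by
        rw [← mul_assoc, ← mul_assoc, (Nat.cast_commute _ _).eq]
      rw [mul_sub d, mul_sub d, c1, c2, Nat.choose_succ_succ, Nat.cast_add]
      simp only [mul_sub, sub_mul, add_mul, mul_assoc, Nat.succ_eq_add_one]
      abel
    rw [hb]
    exact sub_mem (add_mem (add_mem (add_mem (add_mem t1 t2) t3) t4) t5) t6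

theorem nth_sub_nth {m' : ℕ} (D : HS k A (CoIdeal.interval m)) (E : HS k A (CoIdeal.interval m'))
    (h1 : D.nth 1 = E.nth 1) (i : ℕ) (hi : i ≤ m) (hi' : i ≤ m') :
    D.nth i - E.nth i ∈ diffLT k A i := by
  induction i with
  | zero => simp [D.nth_zero, E.nth_zero]
  | succ i ih =>
    rw [mem_diffLT_succ]
    intro a
    have e1 := D.bracket_nth hi a
    have e2 := E.bracket_nth hi' a
    have e3 := mulBy_mul_mem (D.nth 1 a) (ih (by omega) (by omega))
    rw [← h1] at e2
    have := add_mem (sub_mem e1 e2) e3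
    convert! this using 1
    rw [map_sub, mul_sub]
    abel

/-- `D_i` as a differential operator of order `≤ i`. -/
noncomputable def op (D : HS k A (CoIdeal.interval m)) (i : ℕ) : (diffFiltration k A).deg i :=
  ⟨⟨D.nth i, i + 1, D.nth_mem_diffLT i⟩, D.nth_mem_diffLT i⟩

/-- The symbol `σ_i(D_i) ∈ gr 𝒟_{A/k}`. -/
noncomputable def sigma (D : HS k A (CoIdeal.interval m)) (i : ℕ) : GrD k A :=
  (diffFiltration k A).symbol i (D.op i)

theorem sigma_eq {m' : ℕ} (D : HS k A (CoIdeal.interval m)) (E : HS k A (CoIdeal.interval m'))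
    (h1 : D.nth 1 = E.nth 1) (i : ℕ) (hi : i ≤ m) (hi' : i ≤ m') : D.sigma i = E.sigma i :=
  (diffFiltration k A).symbol_eq (mem_diffFiltration_below.2 (D.nth_sub_nth E h1 i hi hi'))

theorem sigma_zero (D : HS k A (CoIdeal.interval m)) : D.sigma 0 = 1 :=
  (diffFiltration k A).symbol_congr rfl (D.op 0) ⟨1, (diffFiltration k A).one_mem⟩
    (Subtype.ext D.nth_zero)

theorem choose_mul_sigma (D : HS k A (CoIdeal.interval m)) (i j : ℕ) (h : i + j ≤ m) :
    ((i + j).choose i : GrD k A) * D.sigma (i + j) = D.sigma i * D.sigma j := by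
  have hs : ∀ (n d : ℕ) (x : (diffFiltration k A).deg d),
      (n : GrD k A) * (diffFiltration k A).symbol d x =
        (diffFiltration k A).symbol d (n • x) := by
    intro n d x
    rw [← nsmul_eq_mul]
    simp only [RingFiltration.symbol, map_nsmul]
  unfold sigma
  rw [hs, RingFiltration.symbol_mul]
  symm
  refine (diffFiltration k A).symbol_eq (mem_diffFiltration_below.2 ?_)
  have := D.nth_mul_nth (i + j) i j rfl h
  rw [← nsmul_eq_mul] at this
  exact this

theorem sigma_comp (D E : HS k A (CoIdeal.interval m)) (n : ℕ) (hn : n ≤ m) :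
    (D.comp E).sigma n = ∑ c ∈ antidiagonal n, D.sigma c.1 * E.sigma c.2 := by
  let g : ∀ c : ℕ × ℕ, c.1 + c.2 = n → (diffFiltration k A).deg n := fun c hc =>
    ⟨(D.op c.1 : diffRing k A) * E.op c.2,
      hc ▸ (diffFiltration k A).mul_mem (D.op c.1).2 (E.op c.2).2⟩
  have hg : ∀ c ∈ (antidiagonal n).attach, D.sigma c.1.1 * E.sigma c.1.2 =
      (diffFiltration k A).symbol n (g c.1 (mem_antidiagonal.1 c.2)) := fun c _ => by
    unfold sigma
    rw [RingFiltration.symbol_mul]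
    exact (diffFiltration k A).symbol_congr (mem_antidiagonal.1 c.2) _ _ rfl
  rw [← Finset.sum_attach (antidiagonal n), Finset.sum_congr rfl hg]
  have hsum : ∀ (s : Finset {x // x ∈ antidiagonal n}),
      ∑ c ∈ s, (diffFiltration k A).symbol n (g c.1 (mem_antidiagonal.1 c.2)) =
        (diffFiltration k A).symbol n (∑ c ∈ s, g c.1 (mem_antidiagonal.1 c.2)) := fun s => by
    simp only [RingFiltration.symbol, map_sum]
  rw [hsum]
  refine (diffFiltration k A).symbol_congr rfl _ _ (Subtype.ext ?_)
  change (D.comp E).nth n = _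
  rw [HS.comp_nth _ _ hn, ← Finset.sum_attach]
  simp only [AddSubmonoidClass.coe_finsetSum]
  rfl

theorem sigma_scale (D : HS k A (CoIdeal.interval m)) (a : A) (n : ℕ) :
    (D.scale a).sigma n = algebraMap A (GrD k A) a ^ n * D.sigma n := by
  have h0 : algebraMap A (GrD k A) a ^ n = algebraMap A (GrD k A) (a ^ n) := (map_pow _ _ _).symm
  rw [h0]
  change _ = (diffFiltration k A).symbol 0 _ * _
  unfold sigma
  rw [RingFiltration.symbol_mul]
  refine (diffFiltration k A).symbol_congr (zero_add n).symm _ _ (Subtype.ext ?_)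
  change (D.scale a).nth n = mulBy k (a ^ n) * D.nth n
  rw [HS.scale_nth]
  rfl

end HS

variable (k A)

theorem exists_integral (δ : Iderf k A) (m : ℕ) (hm : 1 ≤ m) :
    ∃ D : HS k A (CoIdeal.interval m), D.nth 1 = (δ : Derivation k A A) := Iderf_le m hm δ.2

variable {k A} in
/-- A chosen `(n+1)`-integral of an f-integrable derivation. -/
noncomputable def integral (δ : Iderf k A) (n : ℕ) : HS k A (CoIdeal.interval (n + 1)) :=
  (exists_integral k A δ (n + 1) (Nat.le_add_left 1 n)).choose

variable {k A} in
theorem integral_one (δ : Iderf k A) (n : ℕ) : (integral δ n).nth 1 = (δ : Derivation k A A) :=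
  (exists_integral k A δ (n + 1) (Nat.le_add_left 1 n)).choose_spec

variable {k A} in
theorem sigma_integral (δ : Iderf k A) (n m : ℕ) (hn : n ≤ m) (D : HS k A (CoIdeal.interval m))
    (hD : D.nth 1 = (δ : Derivation k A A)) : (integral δ n).sigma n = D.sigma n :=
  HS.sigma_eq _ _ ((integral_one δ n).trans hD.symm) _ (Nat.le_succ n) hn

/-- The map `χ^f : Ider^f_k(A) → EXP(gr 𝒟_{A/k})`, `δ ↦ ∑_n σ_n(D^n_n) t^n`, where `D^n` is any
integral of `δ` of length at least `n`. -/
noncomputable def chif : Iderf k A →ₗ[A] ExpSeries ⊤ (GrD k A) where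
  toFun δ :=
    { coeff := fun n => (integral δ n).sigma n
      coeff_of_lt := fun i hi => absurd hi (by simp)
      coeff_zero := HS.sigma_zero _
      choose_mul := by
        intro i j _
        rw [sigma_integral δ i _ (by omega) _ (integral_one δ (i + j)),
          sigma_integral δ j _ (by omega) _ (integral_one δ (i + j))]
        exact HS.choose_mul_sigma _ i j (Nat.le_succ _) }
  map_add' δ ε := by
    refine ExpSeries.ext_of_le fun n _ => ?_
    rw [ExpSeries.coeff_add_of_le _ _ _ le_top]
    have h : ((integral δ n).comp (integral ε n)).nth 1 =
        ((δ + ε : Iderf k A) : Derivation k A A) := by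
      rw [HS.comp_nth _ _ (Nat.le_add_left 1 n), Finset.Nat.antidiagonal_succ]
      simp [HS.nth_zero, integral_one, add_comm]
    change (integral (δ + ε) n).sigma n = _
    rw [sigma_integral (δ + ε) n _ (Nat.le_succ n) _ h, HS.sigma_comp _ _ n (Nat.le_succ n)]
    refine Finset.sum_congr rfl fun c hc => ?_
    rw [mem_antidiagonal] at hc
    change _ = (integral δ c.1).sigma c.1 * (integral ε c.2).sigma c.2
    rw [sigma_integral δ c.1 _ (by omega) _ (integral_one δ n),
      sigma_integral ε c.2 _ (by omega) _ (integral_one ε n)]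
  map_smul' a δ := by
    refine ExpSeries.ext_of_le fun n _ => ?_
    have h : ((integral δ n).scale a).nth 1 = ((a • δ : Iderf k A) : Derivation k A A) := by
      rw [HS.scale_nth, pow_one, integral_one]
      rfl
    change (integral (a • δ) n).sigma n = _
    rw [sigma_integral (a • δ) n _ (Nat.le_succ n) _ h, HS.sigma_scale]
    rfl

/-- The map `ϑ^f_{A/k} : Γ_A Ider^f_k(A) → gr 𝒟_{A/k}` that the universal property of divided powers
attaches to `χ^f`. -/
noncomputable def varthetaF : DividedPowerAlgebra A (Iderf k A) →ₐ[A] GrD k A :=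
  gammaLift (chif k A)

/-- `ϑ^f(γ_n(δ)) = σ_n(D_n)` for every integral `D` of `δ` of length `m ≥ n`. -/
theorem varthetaF_dp (δ : Iderf k A) (n m : ℕ) (hn : n ≤ m) (D : HS k A (CoIdeal.interval m))
    (hD : D.nth 1 = (δ : Derivation k A A)) :
    varthetaF k A (DividedPowerAlgebra.dp A n δ) = D.sigma n :=
  (gammaLift_dp _ _ _).trans (sigma_integral δ n m hn D hD)

end Symbols

/-! ### The enveloping algebra of Hasse–Schmidt derivations -/

section EnvelopingAlgebra

variable (k A : Type*) [CommRing k] [CommRing A] [Algebra k A]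

/-- The generators `S_a` and `T_{p,Δ,D,α}` (with `α ∈ Δ`) of the enveloping algebra. -/
inductive Gen : Type _
  | S (a : A) : Gen
  | T (p : ℕ) (Δ : CoIdeal p) (D : HS k A Δ) (α : Fin p →₀ ℕ) (hα : α ∈ Δ) : Gen

variable {A} in
/-- The generator `S_a` in the free algebra. -/
def sGen (a : A) : FreeAlgebra k (Gen k A) := FreeAlgebra.ι k (Gen.S a)

variable {k A}

open Classical in
/-- The generator `T_{p,Δ,D,α}` in the free algebra (and `0` if `α ∉ Δ`). -/
noncomputable def tGen {p : ℕ} {Δ : CoIdeal p} (D : HS k A Δ) (α : Fin p →₀ ℕ) :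
    FreeAlgebra k (Gen k A) :=
  if hα : α ∈ Δ then FreeAlgebra.ι k (Gen.T p Δ D α hα) else 0

/-- The degree of a generator: `deg S_a = 0` and `deg T_{p,Δ,D,α} = ⌊|α| / ℓ_α(D)⌋`. -/
noncomputable def Gen.deg : Gen k A → ℕ
  | .S _ => 0
  | .T _ _ D α _ => α.degree / D.ell α

variable (k A) in
/-- The defining relations of the enveloping algebra. -/
inductive URel : FreeAlgebra k (Gen k A) → FreeAlgebra k (Gen k A) → Prop
  | scalar (c : k) : URel (sGen k (c • (1 : A))) (algebraMap k _ c)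
  | add (a a' : A) : URel (sGen k (a + a')) (sGen k a + sGen k a')
  | mul (a a' : A) : URel (sGen k (a * a')) (sGen k a * sGen k a')
  | one_zero (p : ℕ) : URel (tGen (HS.one k A (CoIdeal.origin p)) 0) 1
  | one_pos (p : ℕ) (Δ : CoIdeal p) (α : Fin p →₀ ℕ) (hα : α ∈ Δ) (h : 0 < α.degree) :
      URel (tGen (HS.one k A Δ) α) 0
  | comp (p : ℕ) (Δ : CoIdeal p) (D E : HS k A Δ) (α : Fin p →₀ ℕ) (hα : α ∈ Δ) :
      URel (tGen (D.comp E) α) (∑ c ∈ antidiagonal α, tGen D c.1 * tGen E c.2)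
  | leibniz (p : ℕ) (Δ : CoIdeal p) (D : HS k A Δ) (α : Fin p →₀ ℕ) (hα : α ∈ Δ) (a : A) :
      URel (tGen D α * sGen k a)
        (∑ c ∈ antidiagonal α, sGen k (D.coeff c.1 a) * tGen D c.2)
  | subst (p q : ℕ) (Δ : CoIdeal p) (nab : CoIdeal q) (φ : SubstMap A Δ nab) (D : HS k A Δ)
      (β : Fin q →₀ ℕ) (hβ : β ∈ nab) :
      URel (tGen (D.subst φ) β)
        (∑ α ∈ Δ.upTo β.degree, sGen k (φ.C β α) * tGen D α)

variable (k A) in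
/-- The enveloping algebra `U_{A/k}` of the Hasse–Schmidt derivations of `A` over `k`. -/
abbrev U : Type _ := RingQuot (URel k A)

variable (k A) in
/-- The projection of the free algebra onto `U_{A/k}`. -/
noncomputable abbrev toU : FreeAlgebra k (Gen k A) →ₐ[k] U k A := RingQuot.mkAlgHom k (URel k A)

/-- The image of a generator in `U_{A/k}`. -/
noncomputable def Gen.toU (g : Gen k A) : U k A := HasseSchmidt.toU k A (FreeAlgebra.ι k g)

/-- The element `𝐓_{p,Δ,D,α}` of `U_{A/k}` (and `0` if `α ∉ Δ`). -/
noncomputable def HS.uT {p : ℕ} {Δ : CoIdeal p} (D : HS k A Δ) (α : Fin p →₀ ℕ) : U k A :=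
  toU k A (tGen D α)

theorem HS.uT_of_mem {p : ℕ} {Δ : CoIdeal p} (D : HS k A Δ) {α : Fin p →₀ ℕ} (hα : α ∈ Δ) :
    D.uT α = (Gen.T p Δ D α hα).toU := by
  unfold HS.uT tGen
  rw [dif_pos hα]
  rfl

theorem HS.uT_of_notMem {p : ℕ} {Δ : CoIdeal p} (D : HS k A Δ) {α : Fin p →₀ ℕ} (hα : α ∉ Δ) :
    D.uT α = 0 := by
  unfold HS.uT tGen
  rw [dif_neg hα, map_zero]

variable (k A) in
/-- The map `A → U_{A/k}`, `a ↦ 𝐒_a`. -/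
noncomputable def uS : A →ₐ[k] U k A :=
  have hs : ∀ c : k, toU k A (sGen k (c • (1 : A))) = algebraMap k _ c := fun c =>
    (RingQuot.mkAlgHom_rel k (URel.scalar c)).trans (AlgHom.commutes _ c)
  { toFun := fun a => toU k A (sGen k a)
    map_one' := by simpa using hs 1
    map_zero' := by simpa using hs 0
    map_add' := fun a b => (RingQuot.mkAlgHom_rel k (URel.add a b)).trans (map_add _ _ _)
    map_mul' := fun a b => (RingQuot.mkAlgHom_rel k (URel.mul a b)).trans (map_mul _ _ _)
    commutes' := fun c => by
      rw [Algebra.algebraMap_eq_smul_one]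
      exact hs c }

variable (k A) in
/-- The filtration of `U_{A/k}` induced by the grading of the free algebra: `F_d` is spanned over `k`
by the products of generators of total degree `≤ d`. -/
noncomputable def uFiltration : RingFiltration k (U k A) where
  deg d := Submodule.span k
    {z | ∃ l : List (Gen k A), (l.map Gen.deg).sum ≤ d ∧ z = (l.map Gen.toU).prod}
  mono := by
    intro i j h
    refine Submodule.span_mono ?_
    rintro z ⟨l, hl, rfl⟩
    exact ⟨l, hl.trans h, rfl⟩
  one_mem := Submodule.subset_span ⟨[], by simp⟩
  mul_mem := by
    intro i j x y hx hy
    have h := Submodule.mul_mem_mul hx hy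
    rw [Submodule.span_mul_span] at h
    refine Submodule.span_mono ?_ h
    rintro z ⟨_, ⟨l, hl, rfl⟩, _, ⟨l', hl', rfl⟩, rfl⟩
    refine ⟨l ++ l', ?_, ?_⟩
    · rw [List.map_append, List.sum_append]
      exact add_le_add hl hl'
    · rw [List.map_append, List.prod_append]

theorem Gen.toU_mem (g : Gen k A) {d : ℕ} (h : g.deg ≤ d) : g.toU ∈ (uFiltration k A).deg d :=
  Submodule.subset_span ⟨[g], by simpa using h, by simp⟩

theorem HS.uT_mem {p : ℕ} {Δ : CoIdeal p} (D : HS k A Δ) (α : Fin p →₀ ℕ) {d : ℕ}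
    (h : α.degree / D.ell α ≤ d) : D.uT α ∈ (uFiltration k A).deg d := by
  by_cases hα : α ∈ Δ
  · rw [D.uT_of_mem hα]
    exact Gen.toU_mem _ h
  · rw [D.uT_of_notMem hα]
    exact zero_mem _

theorem uS_mem (a : A) : uS k A a ∈ (uFiltration k A).deg 0 :=
  Gen.toU_mem (Gen.S a) le_rfl

variable (k A) in
/-- The graded ring `gr U_{A/k}`. -/
abbrev GrU : Type _ := (uFiltration k A).Gr

noncomputable instance instCommRingGrU [h : IsMulCommutative (GrU k A)] : CommRing (GrU k A) where
  mul_comm := h.is_comm.comm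

/-- Once it is known to be commutative, `gr U_{A/k}` is an algebra over `A` through
`a ↦ σ_0(𝐒_a)`. -/
noncomputable instance instAlgebraGrU [IsMulCommutative (GrU k A)] :
    @Algebra A (GrU k A) _ (instCommRingGrU (k := k) (A := A)).toCommSemiring.toSemiring :=
  RingHom.toAlgebra (S := GrU k A) ((uFiltration k A).structureMap (uS k A).toRingHom uS_mem)

/-- The symbol `σ_i(𝐓_{1,m,D,i}) ∈ gr U_{A/k}` for a Hasse–Schmidt derivation `D` of length `m`. -/
noncomputable def HS.uSigma {m : ℕ} (D : HS k A (CoIdeal.interval m)) (i : ℕ) : GrU k A :=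
  (uFiltration k A).symbol i ⟨D.uT (idx i), D.uT_mem _ (by
    rw [Finsupp.degree_single]
    exact Nat.div_le_self _ _)⟩

/-- `D_α` as an element of `𝒟_{A/k}`. -/
noncomputable def HS.diff {p : ℕ} {Δ : CoIdeal p} (D : HS k A Δ) (α : Fin p →₀ ℕ) :
    diffRing k A :=
  ⟨D.coeff α, by
    by_cases hα : α ∈ Δ
    · exact ⟨_, D.coeff_mem_diffLT α hα⟩
    · rw [D.coeff_of_notMem α hα]
      exact zero_mem _⟩

/-- The images `S_a ↦ a` and `T_{p,Δ,D,α} ↦ D_α` of the generators in `𝒟_{A/k}`. -/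
noncomputable def Gen.toDiff : Gen k A → diffRing k A
  | .S a => toDiffRing k A a
  | .T _ _ D α _ => D.diff α

theorem lift_sGen (a : A) : FreeAlgebra.lift k Gen.toDiff (sGen k a) = toDiffRing k A a :=
  FreeAlgebra.lift_ι_apply _ _

theorem lift_tGen {p : ℕ} {Δ : CoIdeal p} (D : HS k A Δ) (α : Fin p →₀ ℕ) :
    FreeAlgebra.lift k Gen.toDiff (tGen D α) = D.diff α := by
  unfold tGen
  by_cases hα : α ∈ Δ
  · rw [dif_pos hα]
    exact FreeAlgebra.lift_ι_apply _ _
  · rw [dif_neg hα, map_zero]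
    exact Subtype.ext (D.coeff_of_notMem α hα).symm

theorem lift_rel ⦃x y : FreeAlgebra k (Gen k A)⦄ (h : URel k A x y) :
    FreeAlgebra.lift k Gen.toDiff x = FreeAlgebra.lift k Gen.toDiff y := by
  induction h with
  | scalar c =>
    rw [lift_sGen, AlgHom.commutes, map_smul, map_one, Algebra.algebraMap_eq_smul_one]
  | add a a' => rw [map_add, lift_sGen, lift_sGen, lift_sGen, map_add]
  | mul a a' => rw [map_mul, lift_sGen, lift_sGen, lift_sGen, map_mul]
  | one_zero p =>
    rw [lift_tGen, map_one]
    exact Subtype.ext (HS.one k A (CoIdeal.origin p)).coeff_zero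
  | one_pos p Δ α hα h =>
    rw [lift_tGen, map_zero]
    refine Subtype.ext (if_neg ?_)
    rintro rfl
    simp at h
  | comp p Δ D E α hα =>
    simp only [map_sum, map_mul, lift_tGen]
    refine Subtype.ext ?_
    rw [AddSubmonoidClass.coe_finsetSum]
    exact D.comp_coeff E hα
  | leibniz p Δ D α hα a =>
    simp only [map_sum, map_mul, lift_tGen, lift_sGen]
    refine Subtype.ext ?_
    rw [AddSubmonoidClass.coe_finsetSum]
    ext x
    rw [LinearMap.sum_apply]
    exact D.leibniz α hα a x
  | subst p q Δ nab φ D β hβ =>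
    simp only [map_sum, map_mul, lift_tGen, lift_sGen]
    refine Subtype.ext ?_
    rw [AddSubmonoidClass.coe_finsetSum]
    rfl

variable (k A) in
/-- The map `υ : U_{A/k} → 𝒟_{A/k}` of `k`-algebras with `𝐒_a ↦ a` and `𝐓_{p,Δ,D,α} ↦ D_α`. -/
noncomputable def upsilon : U k A →ₐ[k] diffRing k A :=
  RingQuot.liftAlgHom k ⟨FreeAlgebra.lift k Gen.toDiff, lift_rel⟩

theorem upsilon_toU (x : FreeAlgebra k (Gen k A)) :
    upsilon k A (toU k A x) = FreeAlgebra.lift k Gen.toDiff x :=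
  RingQuot.liftAlgHom_mkAlgHom_apply _ _ _ _

theorem upsilon_uS (a : A) : upsilon k A (uS k A a) = toDiffRing k A a :=
  (upsilon_toU _).trans (lift_sGen a)

theorem upsilon_uT {p : ℕ} {Δ : CoIdeal p} (D : HS k A Δ) (α : Fin p →₀ ℕ) :
    upsilon k A (D.uT α) = D.diff α :=
  (upsilon_toU _).trans (lift_tGen D α)

theorem Gen.toDiff_mem (g : Gen k A) : g.toDiff ∈ (diffFiltration k A).deg g.deg := by
  cases g with
  | S a => exact mulBy_mem a
  | T p Δ D α hα => exact D.coeff_mem_diffLT α hα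

theorem upsilon_filtered (d : ℕ) (x : U k A) (hx : x ∈ (uFiltration k A).deg d) :
    upsilon k A x ∈ (diffFiltration k A).deg d := by
  have key : ∀ l : List (Gen k A),
      upsilon k A (l.map Gen.toU).prod ∈ (diffFiltration k A).deg (l.map Gen.deg).sum := by
    intro l
    induction l with
    | nil =>
      change upsilon k A 1 ∈ _
      rw [map_one]
      exact (diffFiltration k A).one_mem
    | cons g l ih =>
      change upsilon k A (g.toU * (l.map Gen.toU).prod) ∈ _
      rw [map_mul, List.map_cons, List.sum_cons]
      refine (diffFiltration k A).mul_mem ?_ ih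
      have : upsilon k A g.toU = g.toDiff :=
        (upsilon_toU _).trans (FreeAlgebra.lift_ι_apply _ _)
      rw [this]
      exact g.toDiff_mem
  induction hx using Submodule.span_induction with
  | mem x h =>
    obtain ⟨l, hl, rfl⟩ := h
    exact (diffFiltration k A).mono hl (key l)
  | zero =>
    rw [map_zero]
    exact zero_mem _
  | add x y _ _ hx hy =>
    rw [map_add]
    exact add_mem hx hy
  | smul c x _ hx =>
    rw [map_smul]
    exact Submodule.smul_mem _ _ hx

variable (k A) in
/-- The map `gr υ : gr U_{A/k} → gr 𝒟_{A/k}`. -/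
noncomputable def grUpsilon : GrU k A →+* GrD k A :=
  RingFiltration.grMap (uFiltration k A) (diffFiltration k A) (upsilon k A) upsilon_filtered

theorem grUpsilon_uSigma {m : ℕ} (D : HS k A (CoIdeal.interval m)) (i : ℕ) :
    grUpsilon k A (D.uSigma i) = D.sigma i :=
  (RingFiltration.grMap_symbol _ _ _ _ _ _).trans
    ((diffFiltration k A).symbol_congr rfl _ _ (upsilon_uT D (idx i)))

end EnvelopingAlgebra

end HasseSchmidt

open HasseSchmidt

/-!
The ring `gr U` is commutative because generators of `U` commute modulo lower degree. For two
generators `𝐓_{D,α}` and `𝐓_{E,β}`, place `D` and `E` in disjoint sets of variables `s` and `t`.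
The relation for compositions turns `𝐓_{D,α} 𝐓_{E,β}` and `𝐓_{E,β} 𝐓_{D,α}` into the generators of
degree `(α, β)` of `D(s) ∘ E(t)` and `E(t) ∘ D(s)`. Hasse–Schmidt derivations form a group, so
that `D(s) ∘ E(t) = G ∘ E(t) ∘ D(s)` for some `G` (`HS.exists_comp_eq`). A nontrivial term of `G`
has degree at least `ℓ_α(D)` in `s` and at least `ℓ_β(E)` in `t`, whence `ℓ(G) ≥ ℓ_α(D) + ℓ_β(E)`,
and the generators of `G` of positive degree only contribute to lower steps of the filtration
(`HS.uT_commutator`).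

The maps `χ_m` rest on the same device: two Hasse–Schmidt derivations with equal terms of degree
`1` differ by a factor `G` with `ℓ(G) ≥ 2`, and a generator of `G` of degree `r ≥ 1` lies in the
step `⌊r/2⌋ < r` of the filtration. So their generators have equal symbols
(`HS.uT_sub_uT_mem_below`). Applied to two integrals of a derivation, this shows that `χ_m` is
well defined. Applied to `D(s + t)` and `D(s) ∘ D(t)`, it gives `binom (i+j) i 𝐓_{D,i+j} ≡ 𝐓_{D,i}
𝐓_{D,j}` modulo lower degree, i.e. the symbols form a series of exponential type
(`HS.choose_smul_uT_sub_mem_below`). The relations for compositions and for the substitution `s ↦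
a s` give the `A`-linearity. The map `ϑ` is then supplied by the universal property of divided
powers, and its properties are checked on the generators `γ_n(δ)`.
-/

namespace HasseSchmidt

open Finset.HasAntidiagonal (antidiagonal mem_antidiagonal)

/-! ### Division in the group of Hasse–Schmidt derivations -/

section Division

variable {k A : Type*} [CommRing k] [CommRing A] [Algebra k A] {p : ℕ} {Δ : CoIdeal p}

namespace HS

theorem coeff_eq_zero_or_mem (D : HS k A Δ) (α : Fin p →₀ ℕ) : D.coeff α = 0 ∨ α ∈ Δ := by
  by_cases h : α ∈ Δ
  · exact Or.inr h
  · exact Or.inl (D.coeff_of_notMem α h)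

theorem lt_of_mem_antidiagonal {α : Fin p →₀ ℕ} {c : (Fin p →₀ ℕ) × (Fin p →₀ ℕ)}
    (hc : c ∈ antidiagonal α) (hne : c ≠ (α, 0)) : c.1 < α := by
  rw [mem_antidiagonal] at hc
  refine lt_of_le_of_ne (by rw [← hc]; exact le_self_add) fun h => hne (Prod.ext h ?_)
  rw [h] at hc
  exact left_eq_add.1 hc.symm

/-- A family of endomorphisms `G` with `P_α = ∑_{β+γ=α} G_β ∘ Q_γ`, where `P` and `Q` are
Hasse–Schmidt derivations, satisfies the Leibniz rule: modulo the lower terms, the Leibniz rule for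
`P_α` is the one for `G_α`. -/
theorem leibniz_of_mul_eq (P Q : HS k A Δ) (G : (Fin p →₀ ℕ) → Module.End k A)
    (hG : ∀ α, ∑ c ∈ antidiagonal α, G c.1 * Q.coeff c.2 = P.coeff α)
    (α : Fin p →₀ ℕ) (hα : α ∈ Δ) (x y : A) :
    G α (x * y) = ∑ c ∈ antidiagonal α, G c.1 x * G c.2 y := by
  classical
  induction α using WellFoundedLT.induction generalizing x y with
  | _ α ih =>
  have e1 : P.coeff α (x * y) = ∑ c ∈ antidiagonal α, ∑ v ∈ antidiagonal c.2,
      G c.1 (Q.coeff v.1 x * Q.coeff v.2 y) := by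
    rw [← hG, LinearMap.sum_apply]
    refine Finset.sum_congr rfl fun c hc => ?_
    rw [Module.End.mul_apply, Q.leibniz _ (Δ.mem_of_antidiagonal hα hc).2, map_sum]
  have e2 : P.coeff α (x * y) = ∑ c ∈ antidiagonal α, ∑ v ∈ antidiagonal c.2,
      ∑ u ∈ antidiagonal c.1, G u.1 (Q.coeff v.1 x) * G u.2 (Q.coeff v.2 y) := by
    rw [P.leibniz α hα]
    trans ∑ c ∈ antidiagonal α, ∑ u ∈ antidiagonal c.1, ∑ v ∈ antidiagonal c.2,
      G u.1 (Q.coeff u.2 x) * G v.1 (Q.coeff v.2 y)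
    · refine Finset.sum_congr rfl fun c _ => ?_
      rw [← hG c.1, ← hG c.2, LinearMap.sum_apply, LinearMap.sum_apply, Finset.sum_mul_sum]
      rfl
    · rw [sum_four (fun a b c d => G a (Q.coeff b x) * G c (Q.coeff d y))]
      exact Finset.sum_congr rfl fun c _ => Finset.sum_comm
  have hmem : (α, (0 : Fin p →₀ ℕ)) ∈ antidiagonal α := by rw [mem_antidiagonal, add_zero]
  have e3 := e1.symm.trans e2
  rw [← Finset.add_sum_erase _ _ hmem, ← Finset.add_sum_erase _ _ hmem,
    Finset.sum_congr rfl (fun c hc => Finset.sum_congr rfl fun v _ =>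
      ih c.1 (lt_of_mem_antidiagonal (Finset.mem_of_mem_erase hc) (Finset.ne_of_mem_erase hc))
        (Δ.mem_of_antidiagonal hα (Finset.mem_of_mem_erase hc)).1 _ _)] at e3
  have e4 := add_right_cancel e3
  simpa [Q.coeff_zero] using e4

/-- Right division: Hasse–Schmidt derivations form a group under composition, here in the form that
`P = G ∘ Q` can be solved for `G`. -/
theorem exists_comp_eq (P Q : HS k A Δ) : ∃ G : HS k A Δ, G.comp Q = P := by
  classical
  let Qs : MvPowerSeries (Fin p) (Module.End k A) := Q.coeff
  let Ps : MvPowerSeries (Fin p) (Module.End k A) := P.coeff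
  let g : MvPowerSeries (Fin p) (Module.End k A) := Ps * MvPowerSeries.invOfUnit Qs 1
  have hQ : MvPowerSeries.constantCoeff Qs = ((1 : (Module.End k A)ˣ) : Module.End k A) :=
    Q.coeff_zero
  have hg : g * Qs = Ps := by
    change Ps * _ * Qs = Ps
    rw [mul_assoc, MvPowerSeries.invOfUnit_mul _ _ hQ, mul_one]
  have hG : ∀ α, ∑ c ∈ antidiagonal α, g c.1 * Q.coeff c.2 = P.coeff α := fun α => by
    have := congrArg (MvPowerSeries.coeff α) hg
    rw [MvPowerSeries.coeff_mul] at this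
    exact this
  have hcut : ∀ α ∈ Δ, ∀ c ∈ antidiagonal α,
      (if c.1 ∈ Δ then g c.1 else 0) = g c.1 ∧ (if c.2 ∈ Δ then g c.2 else 0) = g c.2 :=
    fun α hα c hc => ⟨if_pos (Δ.mem_of_antidiagonal hα hc).1,
      if_pos (Δ.mem_of_antidiagonal hα hc).2⟩
  refine ⟨{ coeff := fun α => if α ∈ Δ then g α else 0
            coeff_of_notMem := fun α hα => if_neg hα
            coeff_zero := ?_
            leibniz := ?_ }, ?_⟩
  · rw [if_pos Δ.zero_mem]
    simpa [Q.coeff_zero, P.coeff_zero] using hG 0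
  · intro α hα x y
    rw [if_pos hα, leibniz_of_mul_eq P Q g hG α hα]
    refine Finset.sum_congr rfl fun c hc => ?_
    rw [(hcut α hα c hc).1, (hcut α hα c hc).2]
  · ext1
    funext α
    by_cases hα : α ∈ Δ
    · rw [comp_coeff _ _ hα]
      refine (Finset.sum_congr rfl fun c hc => ?_).trans (hG α)
      rw [← (hcut α hα c hc).1]
    · rw [coeff_of_notMem _ _ hα, coeff_of_notMem _ _ hα]

/-- If `G ∘ Q` and `Q` agree up to `α`, then `G` is trivial up to `α`. -/
theorem coeff_eq_zero_of_comp_eq (G Q : HS k A Δ) (α : Fin p →₀ ℕ)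
    (h : ∀ β ≤ α, (G.comp Q).coeff β = Q.coeff β) : ∀ β ≤ α, β ≠ 0 → G.coeff β = 0 := by
  classical
  intro β hβ hβ0
  induction β using WellFoundedLT.induction with
  | _ β ih =>
  rcases G.coeff_eq_zero_or_mem β with h0 | hmem
  · exact h0
  have e := h β hβ
  have h1 : (β, (0 : Fin p →₀ ℕ)) ∈ antidiagonal β := by rw [mem_antidiagonal, add_zero]
  have h2 : ((0 : Fin p →₀ ℕ), β) ∈ (antidiagonal β).erase (β, 0) := by
    rw [Finset.mem_erase, mem_antidiagonal, zero_add]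
    exact ⟨fun h => hβ0 (Prod.ext_iff.1 h).2, rfl⟩
  rw [comp_coeff _ _ hmem, ← Finset.add_sum_erase _ _ h1, ← Finset.add_sum_erase _ _ h2,
    Finset.sum_eq_zero, G.coeff_zero, Q.coeff_zero, mul_one, one_mul, add_zero] at e
  · exact left_eq_add.1 (by rw [add_comm]; exact e.symm)
  · intro c hc
    rw [Finset.mem_erase, Finset.mem_erase] at hc
    have hlt := lt_of_mem_antidiagonal hc.2.2 hc.2.1
    rw [ih c.1 hlt (hlt.le.trans hβ), zero_mul]
    intro h0
    refine hc.1 (Prod.ext h0 ?_)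
    have := mem_antidiagonal.1 hc.2.2
    rwa [h0, zero_add] at this

end HS

end Division

/-! ### Substitution maps with prescribed values on the variables -/

section SubstitutionMaps

variable {A : Type*} [CommRing A] {p q : ℕ} {Δ : CoIdeal p} {nab : CoIdeal q}

namespace SubstMap

open TruncSeries

theorem truncIdeal_le_comap_subst (a : Fin p → MvPowerSeries (Fin q) A)
    (ha : MvPowerSeries.HasSubst a)
    (h : ∀ α, α ∉ Δ → ∀ e ∈ nab, MvPowerSeries.coeff e (α.prod fun i n => a i ^ n) = 0) :
    truncIdeal A Δ ≤ (truncIdeal A nab).comap (MvPowerSeries.substAlgHom (R := A) ha) := by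
  intro f hf
  change MvPowerSeries.substAlgHom (R := A) ha f ∈ truncIdeal A nab
  intro e he
  rw [MvPowerSeries.substAlgHom_apply, MvPowerSeries.coeff_subst ha]
  refine finsum_eq_zero_of_forall_eq_zero fun α => ?_
  by_cases hα : α ∈ Δ
  · rw [hf α hα, zero_smul]
  · rw [h α hα e he, smul_zero]

/-- The substitution map `s_i ↦ a_i`, for series `a_i` without constant term such that the monomials
outside `Δ` are sent to series with support outside `∇`. -/
noncomputable def ofVars (a : Fin p → MvPowerSeries (Fin q) A)
    (ha : ∀ i, MvPowerSeries.constantCoeff (a i) = 0)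
    (h : ∀ α, α ∉ Δ → ∀ e ∈ nab, MvPowerSeries.coeff e (α.prod fun i n => a i ^ n) = 0) :
    SubstMap A Δ nab where
  toAlgHom := Ideal.quotientMapₐ (truncIdeal A nab)
    (MvPowerSeries.substAlgHom (MvPowerSeries.hasSubst_of_constantCoeff_zero ha))
    (truncIdeal_le_comap_subst a _ h)
  order_pos i := by
    change coeff 0 (ofSeries nab (MvPowerSeries.substAlgHom
      (MvPowerSeries.hasSubst_of_constantCoeff_zero ha) (MvPowerSeries.X i))) = 0
    rw [coeff_ofSeries nab.zero_mem, MvPowerSeries.substAlgHom_X]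
    exact ha i

theorem C_ofVars (a : Fin p → MvPowerSeries (Fin q) A)
    (ha : ∀ i, MvPowerSeries.constantCoeff (a i) = 0)
    (h : ∀ α, α ∉ Δ → ∀ e ∈ nab, MvPowerSeries.coeff e (α.prod fun i n => a i ^ n) = 0)
    {e : Fin q →₀ ℕ} (he : e ∈ nab) (α : Fin p →₀ ℕ) :
    (ofVars a ha h).C e α = MvPowerSeries.coeff e (α.prod fun i n => a i ^ n) := by
  change coeff e (ofSeries nab (MvPowerSeries.substAlgHom
    (MvPowerSeries.hasSubst_of_constantCoeff_zero ha) (MvPowerSeries.monomial α 1))) = _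
  rw [coeff_ofSeries he, MvPowerSeries.substAlgHom_monomial, map_one, one_mul]

theorem prod_X_pow (f : Fin p → Fin q) (α : Fin p →₀ ℕ) :
    (α.prod fun i n => (MvPowerSeries.X (f i) : MvPowerSeries (Fin q) A) ^ n) =
      MvPowerSeries.monomial (α.mapDomain f) 1 := by
  induction α using Finsupp.induction_linear with
  | zero => simp [Finsupp.mapDomain_zero]
  | add α β hα hβ =>
    rw [Finsupp.prod_add_index' (by simp) (fun i m n => pow_add _ m n), hα, hβ,
      Finsupp.mapDomain_add, MvPowerSeries.monomial_mul_monomial, mul_one]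
  | single i n =>
    rw [Finsupp.prod_single_index (by simp), Finsupp.mapDomain_single, MvPowerSeries.X_pow_eq]

open Classical in
/-- The substitution map `s_i ↦ t_{f(i)}`. With `f` the identity and `∇ ⊂ Δ` it is the truncation;
with `f` injective it is an inclusion of variables. -/
noncomputable def ofRename (f : Fin p → Fin q)
    (h : ∀ α : Fin p →₀ ℕ, α.mapDomain f ∈ nab → α ∈ Δ) : SubstMap A Δ nab :=
  ofVars (fun i => MvPowerSeries.X (f i)) (fun i => MvPowerSeries.constantCoeff_X _) (by
    intro α hα e he
    rw [prod_X_pow, MvPowerSeries.coeff_monomial, if_neg]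
    rintro rfl
    exact hα (h α he))

open Classical in
theorem C_ofRename (f : Fin p → Fin q) (h : ∀ α : Fin p →₀ ℕ, α.mapDomain f ∈ nab → α ∈ Δ)
    {e : Fin q →₀ ℕ} (he : e ∈ nab) (α : Fin p →₀ ℕ) :
    (ofRename (A := A) f h).C e α = if e = α.mapDomain f then 1 else 0 := by
  refine (C_ofVars _ _ _ he α).trans ?_
  rw [prod_X_pow, MvPowerSeries.coeff_monomial]

theorem prod_smul_X_pow (a : A) (α : Fin p →₀ ℕ) :
    (α.prod fun i n => (a • MvPowerSeries.X i : MvPowerSeries (Fin p) A) ^ n) =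
      a ^ α.degree • MvPowerSeries.monomial α 1 := by
  have h := prod_X_pow (A := A) (fun i : Fin p => i) α
  rw [show α.mapDomain (fun i : Fin p => i) = α from Finsupp.mapDomain_id] at h
  rw [← h, Finsupp.degree_eq_sum, Finsupp.prod_fintype _ _ (by simp),
    Finsupp.prod_fintype _ _ (by simp)]
  simp only [smul_pow]
  rw [Finset.prod_smul, Finset.prod_pow_eq_pow_sum]

open Classical in
/-- The substitution map `s_i ↦ a s_i`. -/
noncomputable def ofScale (a : A) : SubstMap A Δ Δ :=
  ofVars (fun i => a • MvPowerSeries.X i) (fun i => by simp) (by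
    intro α hα e he
    rw [prod_smul_X_pow, MvPowerSeries.coeff_smul, MvPowerSeries.coeff_monomial, if_neg, mul_zero]
    rintro rfl
    exact hα he)

open Classical in
theorem C_ofScale (a : A) {e : Fin p →₀ ℕ} (he : e ∈ Δ) (α : Fin p →₀ ℕ) :
    (ofScale (Δ := Δ) a).C e α = if e = α then a ^ α.degree else 0 := by
  refine (C_ofVars _ _ _ he α).trans ?_
  rw [prod_smul_X_pow, MvPowerSeries.coeff_smul, MvPowerSeries.coeff_monomial]
  simp

theorem coeff_X_add_X_pow (n : ℕ) (e : Fin 2 →₀ ℕ) :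
    MvPowerSeries.coeff e
        ((MvPowerSeries.X 0 + MvPowerSeries.X 1 : MvPowerSeries (Fin 2) A) ^ n) =
      if e.degree = n then (n.choose (e 0) : A) else 0 := by
  classical
  have hdeg : e.degree = e 0 + e 1 := by
    rw [Finsupp.degree_eq_sum, Fin.sum_univ_two]
  have hmon : ∀ c : ℕ × ℕ, MvPowerSeries.coeff e
      (MvPowerSeries.X 0 ^ c.1 * MvPowerSeries.X 1 ^ c.2 : MvPowerSeries (Fin 2) A) =
        if c = (e 0, e 1) then 1 else 0 := fun c => by
    rw [MvPowerSeries.X_pow_eq, MvPowerSeries.X_pow_eq, MvPowerSeries.monomial_mul_monomial,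
      mul_one, MvPowerSeries.coeff_monomial]
    refine if_congr ⟨?_, ?_⟩ rfl rfl
    · rintro rfl
      simp
    · rintro rfl
      ext i
      fin_cases i <;> simp
  rw [(Commute.all _ _).add_pow', map_sum]
  simp only [map_nsmul, hmon]
  split_ifs with h
  · rw [Finset.sum_eq_single (e 0, e 1)]
    · simp
    · intro c _ hc
      rw [if_neg hc, smul_zero]
    · intro hc
      exact absurd (mem_antidiagonal.2 (hdeg.symm.trans h)) hc
  · refine Finset.sum_eq_zero fun c hc => ?_
    rw [if_neg, smul_zero]
    rintro rfl
    exact h (hdeg.trans (mem_antidiagonal.1 hc))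

theorem prod_fin_one {B : Type*} [CommRing B] (b : B) (α : Fin 1 →₀ ℕ) :
    (α.prod fun _ n => b ^ n) = b ^ α.degree := by
  rw [Finsupp.prod_fintype _ _ (by simp), Finsupp.degree_eq_sum, Finset.prod_pow_eq_pow_sum]

/-- The substitution map `A[[s]]_m → A[[t_0, t_1]]_m`, `s ↦ t_0 + t_1`, where the target is
truncated at the total degree `m`. -/
noncomputable def ofAdd (A : Type*) [CommRing A] (m : ℕ) :
    SubstMap A (CoIdeal.interval m) (CoIdeal.total 2 m) :=
  ofVars (fun _ => MvPowerSeries.X 0 + MvPowerSeries.X 1) (fun i => by simp) (by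
    intro α hα e he
    rw [prod_fin_one, coeff_X_add_X_pow, if_neg]
    intro h
    exact hα (CoIdeal.mem_total.2 (h ▸ CoIdeal.mem_total.1 he)))

theorem C_ofAdd {m : ℕ} {e : Fin 2 →₀ ℕ} (he : e ∈ CoIdeal.total 2 m) (α : Fin 1 →₀ ℕ) :
    (ofAdd A m).C e α = if e.degree = α.degree then (α.degree.choose (e 0) : A) else 0 := by
  refine (C_ofVars _ _ _ he α).trans ?_
  rw [prod_fin_one, coeff_X_add_X_pow]

end SubstMap

end SubstitutionMaps

/-! ### The generators of the enveloping algebra -/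

section Generators

variable {k A : Type*} [CommRing k] [CommRing A] [Algebra k A] {p q : ℕ}
  {Δ : CoIdeal p} {nab : CoIdeal q}

namespace HS

theorem uT_comp (D E : HS k A Δ) {α : Fin p →₀ ℕ} (hα : α ∈ Δ) :
    (D.comp E).uT α = ∑ c ∈ antidiagonal α, D.uT c.1 * E.uT c.2 := by
  have h := RingQuot.mkAlgHom_rel k (URel.comp p Δ D E α hα)
  rw [map_sum] at h
  simp only [map_mul] at h
  exact h

theorem uT_mul_uS (D : HS k A Δ) {α : Fin p →₀ ℕ} (hα : α ∈ Δ) (a : A) :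
    D.uT α * uS k A a = ∑ c ∈ antidiagonal α, uS k A (D.coeff c.1 a) * D.uT c.2 := by
  have h := RingQuot.mkAlgHom_rel k (URel.leibniz p Δ D α hα a)
  rw [map_sum] at h
  simp only [map_mul] at h
  exact h

theorem uT_subst (φ : SubstMap A Δ nab) (D : HS k A Δ) {β : Fin q →₀ ℕ} (hβ : β ∈ nab) :
    (D.subst φ).uT β = ∑ α ∈ Δ.upTo β.degree, uS k A (φ.C β α) * D.uT α := by
  have h := RingQuot.mkAlgHom_rel k (URel.subst p q Δ nab φ D β hβ)
  rw [map_sum] at h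
  simp only [map_mul] at h
  exact h

theorem subst_coeff (φ : SubstMap A Δ nab) (D : HS k A Δ) (β : Fin q →₀ ℕ) :
    (D.subst φ).coeff β = ∑ α ∈ Δ.upTo β.degree, φ.C β α • D.coeff α := rfl

/-- If at most one monomial `s^α` contributes to the coefficient of `t^β`, then `φ • D` has a
single term in degree `β`. -/
theorem subst_coeff_of_unique (φ : SubstMap A Δ nab) (D : HS k A Δ) {α : Fin p →₀ ℕ}
    {β : Fin q →₀ ℕ} (hdeg : α.degree ≤ β.degree)
    (hC : ∀ α' ∈ Δ, α' ≠ α → φ.C β α' = 0) :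
    (D.subst φ).coeff β = φ.C β α • D.coeff α := by
  rw [subst_coeff]
  refine Finset.sum_eq_single α (fun α' hα' hne => ?_) fun hα => ?_
  · rw [hC α' (CoIdeal.mem_upTo.1 hα').2 hne, zero_smul]
  · rw [D.coeff_of_notMem α fun h => hα (CoIdeal.mem_upTo.2 ⟨hdeg, h⟩), smul_zero]

theorem uT_subst_of_unique (φ : SubstMap A Δ nab) (D : HS k A Δ) {α : Fin p →₀ ℕ}
    {β : Fin q →₀ ℕ} (hβ : β ∈ nab) (hdeg : α.degree ≤ β.degree)
    (hC : ∀ α' ∈ Δ, α' ≠ α → φ.C β α' = 0) :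
    (D.subst φ).uT β = uS k A (φ.C β α) * D.uT α := by
  rw [uT_subst _ _ hβ]
  refine Finset.sum_eq_single α (fun α' hα' hne => ?_) fun hα => ?_
  · rw [hC α' (CoIdeal.mem_upTo.1 hα').2 hne, map_zero, zero_mul]
  · rw [D.uT_of_notMem fun h => hα (CoIdeal.mem_upTo.2 ⟨hdeg, h⟩), mul_zero]

/-! ### Renaming of the variables and truncation -/

section Rename

variable (D : HS k A Δ) (f : Fin p → Fin q) (h : ∀ α : Fin p →₀ ℕ, α.mapDomain f ∈ nab → α ∈ Δ)

theorem rename_coeff (hf : Function.Injective f) {α : Fin p →₀ ℕ} (hα : α.mapDomain f ∈ nab) :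
    (D.subst (SubstMap.ofRename (A := A) f h)).coeff (α.mapDomain f) = D.coeff α := by
  rw [subst_coeff_of_unique _ D (α := α) (Finsupp.degree_mapDomain f α).ge,
    SubstMap.C_ofRename _ _ hα, if_pos rfl, one_smul]
  intro α' _ hne
  rw [SubstMap.C_ofRename _ _ hα, if_neg]
  exact fun e => hne (Finsupp.mapDomain_injective hf e).symm

theorem rename_uT (hf : Function.Injective f) {α : Fin p →₀ ℕ} (hα : α.mapDomain f ∈ nab) :
    (D.subst (SubstMap.ofRename (A := A) f h)).uT (α.mapDomain f) = D.uT α := by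
  rw [uT_subst_of_unique _ D (α := α) hα (Finsupp.degree_mapDomain f α).ge,
    SubstMap.C_ofRename _ _ hα, if_pos rfl, map_one, one_mul]
  intro α' _ hne
  rw [SubstMap.C_ofRename _ _ hα, if_neg]
  exact fun e => hne (Finsupp.mapDomain_injective hf e).symm

theorem rename_coeff_of_notMem_range {β : Fin q →₀ ℕ}
    (hβ : β ∉ Set.range (Finsupp.mapDomain f)) :
    (D.subst (SubstMap.ofRename (A := A) f h)).coeff β = 0 := by
  by_cases hmem : β ∈ nab
  · refine Finset.sum_eq_zero fun α _ => ?_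
    rw [SubstMap.C_ofRename _ _ hmem, if_neg, zero_smul]
    rintro rfl
    exact hβ ⟨α, rfl⟩
  · exact coeff_of_notMem _ _ hmem

theorem rename_uT_of_notMem_range {β : Fin q →₀ ℕ}
    (hβ : β ∉ Set.range (Finsupp.mapDomain f)) :
    (D.subst (SubstMap.ofRename (A := A) f h)).uT β = 0 := by
  by_cases hmem : β ∈ nab
  · rw [uT_subst _ _ hmem]
    refine Finset.sum_eq_zero fun α _ => ?_
    rw [SubstMap.C_ofRename _ _ hmem, if_neg, map_zero, zero_mul]
    rintro rfl
    exact hβ ⟨α, rfl⟩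
  · exact uT_of_notMem _ hmem

end Rename

/-- The restriction of a Hasse–Schmidt derivation to a smaller co-ideal. -/
noncomputable def restrict {Δ' : CoIdeal p} (h : ∀ α ∈ Δ', α ∈ Δ) (D : HS k A Δ) : HS k A Δ' :=
  D.subst (SubstMap.ofRename id fun α hα => h α (by rwa [Finsupp.mapDomain_id] at hα))

theorem restrict_coeff {Δ' : CoIdeal p} (h : ∀ α ∈ Δ', α ∈ Δ) (D : HS k A Δ)
    {α : Fin p →₀ ℕ} (hα : α ∈ Δ') : (D.restrict h).coeff α = D.coeff α := by
  rw [← Finsupp.mapDomain_id (v := α)] at hα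
  have := D.rename_coeff id (fun α hα => h α (by rwa [Finsupp.mapDomain_id] at hα))
    Function.injective_id hα
  rwa [Finsupp.mapDomain_id] at this

theorem restrict_uT {Δ' : CoIdeal p} (h : ∀ α ∈ Δ', α ∈ Δ) (D : HS k A Δ)
    {α : Fin p →₀ ℕ} (hα : α ∈ Δ') : (D.restrict h).uT α = D.uT α := by
  rw [← Finsupp.mapDomain_id (v := α)] at hα
  have := D.rename_uT id (fun α hα => h α (by rwa [Finsupp.mapDomain_id] at hα))
    Function.injective_id hα
  rwa [Finsupp.mapDomain_id] at this

/-- The relation `𝐓_{p,{0},𝕀,0} = 1` propagates to all `𝐓_{p,Δ,D,0}` by truncation. -/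
theorem uT_zero (D : HS k A Δ) : D.uT 0 = 1 := by
  have h0 : ∀ α ∈ CoIdeal.origin p, α ∈ Δ := by
    rintro α rfl
    exact Δ.zero_mem
  have h1 : D.restrict h0 = HS.one k A (CoIdeal.origin p) := by
    ext1
    funext α
    by_cases hα : α ∈ CoIdeal.origin p
    · rw [show α = 0 from hα, coeff_zero, coeff_zero]
    · rw [coeff_of_notMem _ _ hα, coeff_of_notMem _ _ hα]
  rw [← D.restrict_uT h0 (CoIdeal.origin p).zero_mem, h1]
  exact (RingQuot.mkAlgHom_rel k (URel.one_zero p)).trans (map_one _)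

/-- A generator in a degree up to which `D` is trivial vanishes in `U`: truncated there, `D` is the
identity. -/
theorem uT_eq_zero_of_trivial (D : HS k A Δ) {α : Fin p →₀ ℕ} (hα0 : α ≠ 0)
    (h : ∀ β ≤ α, β ≠ 0 → D.coeff β = 0) : D.uT α = 0 := by
  by_cases hα : α ∈ Δ
  · let Δ' : CoIdeal p :=
      { carrier := Set.Iic α
        lower := fun hβ hα => le_trans hβ hα
        nonempty := ⟨α, Set.mem_Iic.2 le_rfl⟩ }
    have hΔ : ∀ β ∈ Δ', β ∈ Δ := fun β hβ => Δ.lower hβ hα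
    have hα' : α ∈ Δ' := le_refl α
    have h1 : D.restrict hΔ = HS.one k A Δ' := by
      ext1
      funext β
      by_cases hβ : β ∈ Δ'
      · by_cases h0 : β = 0
        · rw [h0, coeff_zero, coeff_zero]
        · rw [restrict_coeff _ _ hβ, h β hβ h0]
          exact (if_neg h0).symm
      · rw [coeff_of_notMem _ _ hβ, coeff_of_notMem _ _ hβ]
    rw [← D.restrict_uT hΔ hα', h1]
    refine (RingQuot.mkAlgHom_rel k (URel.one_pos p Δ' α hα' ?_)).trans (map_zero _)
    rw [Nat.pos_iff_ne_zero, Ne, Finsupp.degree_eq_zero_iff]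
    exact hα0
  · exact D.uT_of_notMem hα

/-! ### Degrees -/

/-- `D` vanishes in the degrees `1, …, ℓ - 1`, on the multi-indices up to `α`. For `ℓ ≥ 1` this says
that `ℓ_α(D) ≥ ℓ`. -/
def VanishesBelow (D : HS k A Δ) (α : Fin p →₀ ℕ) (ℓ : ℕ) : Prop :=
  ∀ β ≤ α, β ≠ 0 → β.degree < ℓ → D.coeff β = 0

theorem VanishesBelow.mono {D : HS k A Δ} {α β : Fin p →₀ ℕ} {ℓ : ℕ} (h : D.VanishesBelow α ℓ)
    (hβ : β ≤ α) : D.VanishesBelow β ℓ :=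
  fun γ hγ => h γ (hγ.trans hβ)

theorem degree_pos {α : Fin p →₀ ℕ} (h : α ≠ 0) : 1 ≤ α.degree := by
  rw [Nat.one_le_iff_ne_zero, Ne, Finsupp.degree_eq_zero_iff]
  exact h

theorem vanishesBelow_ell (D : HS k A Δ) (α : Fin p →₀ ℕ) : D.VanishesBelow α (D.ell α) := by
  intro β hβ h0 hlt
  by_contra hne
  exact Nat.notMem_of_lt_sInf hlt ⟨degree_pos h0, β, hβ, rfl, hne⟩

/-- The value `0` of `ell` encodes `ℓ_α(D) = ∞`. -/
theorem coeff_eq_zero_of_ell_eq_zero (D : HS k A Δ) {α : Fin p →₀ ℕ} (h : D.ell α = 0)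
    {β : Fin p →₀ ℕ} (hβ : β ≤ α) (h0 : β ≠ 0) : D.coeff β = 0 := by
  by_contra hne
  have hmem : β.degree ∈ {r | 1 ≤ r ∧ ∃ β ≤ α, β.degree = r ∧ D.coeff β ≠ 0} :=
    ⟨degree_pos h0, β, hβ, rfl, hne⟩
  have := (Nat.sInf_mem ⟨_, hmem⟩).1
  change 1 ≤ D.ell α at this
  omega

theorem VanishesBelow.div_ell_le {D : HS k A Δ} {α : Fin p →₀ ℕ} {ℓ : ℕ}
    (h : D.VanishesBelow α ℓ) (hℓ : 1 ≤ ℓ) : α.degree / D.ell α ≤ α.degree / ℓ := by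
  rcases Nat.eq_zero_or_pos (D.ell α) with h0 | hpos
  · rw [h0, Nat.div_zero]
    exact Nat.zero_le _
  · refine Nat.div_le_div_left ?_ hℓ
    obtain ⟨h1, β, hβ, hr, hne⟩ := Nat.sInf_mem (Nat.nonempty_of_pos_sInf hpos)
    change β.degree = D.ell α at hr
    by_contra! hlt
    refine hne (h β hβ ?_ (hr ▸ hlt))
    rintro rfl
    rw [map_zero] at hr
    omega

theorem VanishesBelow.uT_mem {D : HS k A Δ} {α : Fin p →₀ ℕ} {ℓ : ℕ}
    (h : D.VanishesBelow α ℓ) (hℓ : 1 ≤ ℓ) :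
    D.uT α ∈ (uFiltration k A).deg (α.degree / ℓ) :=
  HS.uT_mem _ _ (h.div_ell_le hℓ)

theorem uT_mem_degree (D : HS k A Δ) (α : Fin p →₀ ℕ) :
    D.uT α ∈ (uFiltration k A).deg α.degree :=
  D.uT_mem α (Nat.div_le_self _ _)

end HS

namespace RingFiltration

variable {R : Type*} [Ring R] [Algebra k R] (F : RingFiltration k R)

theorem below_mono : Monotone F.below := by
  intro i j h
  cases i with
  | zero => exact bot_le
  | succ i =>
    cases j with
    | zero => omega
    | succ j => exact F.mono (Nat.le_of_succ_le_succ h)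

theorem mem_below_of_lt {i j : ℕ} {x : R} (hx : x ∈ F.deg i) (h : i < j) : x ∈ F.below j :=
  F.below_mono h hx

end RingFiltration

end Generators

/-! ### External products -/

section ExternalProducts

variable {p q : ℕ}

/-- The first `p` entries of a multi-index of length `p + q`. -/
noncomputable def leftPart : (Fin (p + q) →₀ ℕ) →+ (Fin p →₀ ℕ) :=
  Finsupp.comapDomain.addMonoidHom (Fin.castAdd_injective p q)

/-- The last `q` entries of a multi-index of length `p + q`. -/
noncomputable def rightPart : (Fin (p + q) →₀ ℕ) →+ (Fin q →₀ ℕ) :=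
  Finsupp.comapDomain.addMonoidHom (Fin.natAdd_injective q p)

/-- A multi-index of length `p`, extended by zeros at the end. -/
noncomputable abbrev leftIncl (q : ℕ) (α : Fin p →₀ ℕ) : Fin (p + q) →₀ ℕ :=
  α.mapDomain (Fin.castAdd q)

/-- A multi-index of length `q`, extended by zeros at the beginning. -/
noncomputable abbrev rightIncl (p : ℕ) (β : Fin q →₀ ℕ) : Fin (p + q) →₀ ℕ :=
  β.mapDomain (Fin.natAdd p)

theorem leftPart_leftIncl (α : Fin p →₀ ℕ) : leftPart (leftIncl q α) = α :=
  Finsupp.comapDomain_mapDomain _ (Fin.castAdd_injective p q) α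

theorem rightPart_rightIncl (β : Fin q →₀ ℕ) : rightPart (rightIncl p β) = β :=
  Finsupp.comapDomain_mapDomain _ (Fin.natAdd_injective q p) β

theorem castAdd_ne_natAdd (i : Fin p) (j : Fin q) : Fin.castAdd q i ≠ Fin.natAdd p j := by
  intro h
  have := congrArg Fin.val h
  simp only [Fin.val_castAdd, Fin.val_natAdd] at this
  omega

theorem leftPart_rightIncl (β : Fin q →₀ ℕ) : leftPart (rightIncl p β) = 0 := by
  ext i
  refine Finsupp.mapDomain_of_notMem_range _ _ ?_
  rintro ⟨j, hj⟩
  exact castAdd_ne_natAdd i j hj.symm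

theorem rightPart_leftIncl (α : Fin p →₀ ℕ) : rightPart (leftIncl q α) = 0 := by
  ext i
  refine Finsupp.mapDomain_of_notMem_range _ _ ?_
  rintro ⟨j, hj⟩
  exact castAdd_ne_natAdd j i hj

theorem leftIncl_add_rightIncl (e : Fin (p + q) →₀ ℕ) :
    leftIncl q (leftPart e) + rightIncl p (rightPart e) = e := by
  have h1 : leftPart (leftIncl q (leftPart e) + rightIncl p (rightPart e)) = leftPart e := by
    rw [map_add, leftPart_leftIncl, leftPart_rightIncl, add_zero]
  have h2 : rightPart (leftIncl q (leftPart e) + rightIncl p (rightPart e)) = rightPart e := by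
    rw [map_add, rightPart_leftIncl, rightPart_rightIncl, zero_add]
  ext i
  induction i using Fin.addCases with
  | left i => exact DFunLike.congr_fun h1 i
  | right i => exact DFunLike.congr_fun h2 i

theorem degree_leftPart_add (e : Fin (p + q) →₀ ℕ) :
    (leftPart e).degree + (rightPart e).degree = e.degree := by
  conv_rhs => rw [← leftIncl_add_rightIncl e]
  rw [map_add, Finsupp.degree_mapDomain, Finsupp.degree_mapDomain]

theorem leftPart_mono {e e' : Fin (p + q) →₀ ℕ} (h : e ≤ e') : leftPart e ≤ leftPart e' :=
  fun i => h (Fin.castAdd q i)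

theorem rightPart_mono {e e' : Fin (p + q) →₀ ℕ} (h : e ≤ e') : rightPart e ≤ rightPart e' :=
  fun i => h (Fin.natAdd p i)

/-- A product of a family supported on the first `p` variables by a family supported on the last `q`
variables has a single term in each degree. -/
theorem sum_antidiagonal_left_right {M : Type*} [AddCommMonoid M]
    (w : (Fin (p + q) →₀ ℕ) → (Fin (p + q) →₀ ℕ) → M)
    (hl : ∀ c d, c ∉ Set.range (leftIncl (p := p) q) → w c d = 0)
    (hr : ∀ c d, d ∉ Set.range (rightIncl (q := q) p) → w c d = 0) (e : Fin (p + q) →₀ ℕ) :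
    ∑ c ∈ antidiagonal e, w c.1 c.2 = w (leftIncl q (leftPart e)) (rightIncl p (rightPart e)) := by
  refine Finset.sum_eq_single (leftIncl q (leftPart e), rightIncl p (rightPart e)) ?_ ?_
  · rintro ⟨c, d⟩ hcd hne
    by_cases h1 : c ∈ Set.range (leftIncl (p := p) q)
    · by_cases h2 : d ∈ Set.range (rightIncl (q := q) p)
      · obtain ⟨x, rfl⟩ := h1
        obtain ⟨y, rfl⟩ := h2
        rw [mem_antidiagonal] at hcd
        refine absurd ?_ hne
        rw [← hcd, map_add, map_add, leftPart_leftIncl, leftPart_rightIncl, rightPart_leftIncl,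
          rightPart_rightIncl, add_zero, zero_add]
      · exact hr _ _ h2
    · exact hl _ _ h1
  · intro h
    exact absurd (mem_antidiagonal.2 (leftIncl_add_rightIncl e)) h

/-- The same with the two factors in the opposite order. -/
theorem sum_antidiagonal_right_left {M : Type*} [AddCommMonoid M]
    (w : (Fin (p + q) →₀ ℕ) → (Fin (p + q) →₀ ℕ) → M)
    (hl : ∀ c d, c ∉ Set.range (leftIncl (p := p) q) → w c d = 0)
    (hr : ∀ c d, d ∉ Set.range (rightIncl (q := q) p) → w c d = 0) (e : Fin (p + q) →₀ ℕ) :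
    ∑ c ∈ antidiagonal e, w c.2 c.1 = w (leftIncl q (leftPart e)) (rightIncl p (rightPart e)) := by
  rw [← sum_antidiagonal_left_right w hl hr e]
  exact Finset.sum_nbij' Prod.swap Prod.swap (fun c hc => by simpa [add_comm] using hc)
    (fun c hc => by simpa [add_comm] using hc) (by simp) (by simp) (by simp)

/-- The product of two co-ideals. -/
def CoIdeal.prod (Δ : CoIdeal p) (nab : CoIdeal q) : CoIdeal (p + q) where
  carrier := {e | leftPart e ∈ Δ ∧ rightPart e ∈ nab}
  lower := fun h he => ⟨Δ.lower (leftPart_mono h) he.1, nab.lower (rightPart_mono h) he.2⟩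
  nonempty := ⟨0, by
    rw [Set.mem_ofPred_eq, map_zero, map_zero]
    exact ⟨Δ.zero_mem, nab.zero_mem⟩⟩

variable {k A : Type*} [CommRing k] [CommRing A] [Algebra k A] {Δ : CoIdeal p} {nab : CoIdeal q}

namespace CoIdeal

theorem mem_prod {e : Fin (p + q) →₀ ℕ} :
    e ∈ Δ.prod nab ↔ leftPart e ∈ Δ ∧ rightPart e ∈ nab := Iff.rfl

theorem leftIncl_mem_prod {α : Fin p →₀ ℕ} : leftIncl q α ∈ Δ.prod nab ↔ α ∈ Δ := by
  rw [mem_prod, leftPart_leftIncl, rightPart_leftIncl]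
  exact and_iff_left nab.zero_mem

theorem rightIncl_mem_prod {β : Fin q →₀ ℕ} : rightIncl p β ∈ Δ.prod nab ↔ β ∈ nab := by
  rw [mem_prod, leftPart_rightIncl, rightPart_rightIncl]
  exact and_iff_right Δ.zero_mem

end CoIdeal

namespace HS

/-- A Hasse–Schmidt derivation in `p` variables, in terms of the first `p` of `p + q` variables. -/
noncomputable def extendLeft (D : HS k A Δ) (nab : CoIdeal q) : HS k A (Δ.prod nab) :=
  D.subst (SubstMap.ofRename (Fin.castAdd q) fun _ => CoIdeal.leftIncl_mem_prod.1)

/-- A Hasse–Schmidt derivation in `q` variables, in terms of the last `q` of `p + q` variables. -/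
noncomputable def extendRight (Δ : CoIdeal p) (E : HS k A nab) : HS k A (Δ.prod nab) :=
  E.subst (SubstMap.ofRename (Fin.natAdd p) fun _ => CoIdeal.rightIncl_mem_prod.1)

variable (D : HS k A Δ) (E : HS k A nab) {e : Fin (p + q) →₀ ℕ}

theorem extend_comp_coeff (he : e ∈ Δ.prod nab) :
    ((D.extendLeft nab).comp (E.extendRight Δ)).coeff e =
      D.coeff (leftPart e) * E.coeff (rightPart e) := by
  rw [comp_coeff _ _ he]
  refine (sum_antidiagonal_left_right
    (fun c d => (D.extendLeft nab).coeff c * (E.extendRight Δ).coeff d) ?_ ?_ e).trans ?_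
  · intro c d hc
    rw [extendLeft, rename_coeff_of_notMem_range _ _ _ hc, zero_mul]
  · intro c d hd
    rw [extendRight, rename_coeff_of_notMem_range _ _ _ hd, mul_zero]
  · rw [extendLeft, extendRight,
      rename_coeff _ _ _ (Fin.castAdd_injective p q) (CoIdeal.leftIncl_mem_prod.2 he.1),
      rename_coeff _ _ _ (Fin.natAdd_injective q p) (CoIdeal.rightIncl_mem_prod.2 he.2)]

theorem extend_comp_coeff' (he : e ∈ Δ.prod nab) :
    ((E.extendRight Δ).comp (D.extendLeft nab)).coeff e =
      E.coeff (rightPart e) * D.coeff (leftPart e) := by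
  rw [comp_coeff _ _ he]
  refine (sum_antidiagonal_right_left
    (fun c d => (E.extendRight Δ).coeff d * (D.extendLeft nab).coeff c) ?_ ?_ e).trans ?_
  · intro c d hc
    rw [extendLeft, rename_coeff_of_notMem_range _ _ _ hc, mul_zero]
  · intro c d hd
    rw [extendRight, rename_coeff_of_notMem_range _ _ _ hd, zero_mul]
  · rw [extendLeft, extendRight,
      rename_coeff _ _ _ (Fin.castAdd_injective p q) (CoIdeal.leftIncl_mem_prod.2 he.1),
      rename_coeff _ _ _ (Fin.natAdd_injective q p) (CoIdeal.rightIncl_mem_prod.2 he.2)]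

theorem extend_comp_uT (he : e ∈ Δ.prod nab) :
    ((D.extendLeft nab).comp (E.extendRight Δ)).uT e =
      D.uT (leftPart e) * E.uT (rightPart e) := by
  rw [uT_comp _ _ he]
  refine (sum_antidiagonal_left_right
    (fun c d => (D.extendLeft nab).uT c * (E.extendRight Δ).uT d) ?_ ?_ e).trans ?_
  · intro c d hc
    rw [extendLeft, rename_uT_of_notMem_range _ _ _ hc, zero_mul]
  · intro c d hd
    rw [extendRight, rename_uT_of_notMem_range _ _ _ hd, mul_zero]
  · rw [extendLeft, extendRight,
      rename_uT _ _ _ (Fin.castAdd_injective p q) (CoIdeal.leftIncl_mem_prod.2 he.1),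
      rename_uT _ _ _ (Fin.natAdd_injective q p) (CoIdeal.rightIncl_mem_prod.2 he.2)]

theorem extend_comp_uT' (he : e ∈ Δ.prod nab) :
    ((E.extendRight Δ).comp (D.extendLeft nab)).uT e =
      E.uT (rightPart e) * D.uT (leftPart e) := by
  rw [uT_comp _ _ he]
  refine (sum_antidiagonal_right_left
    (fun c d => (E.extendRight Δ).uT d * (D.extendLeft nab).uT c) ?_ ?_ e).trans ?_
  · intro c d hc
    rw [extendLeft, rename_uT_of_notMem_range _ _ _ hc, mul_zero]
  · intro c d hd
    rw [extendRight, rename_uT_of_notMem_range _ _ _ hd, zero_mul]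
  · rw [extendLeft, extendRight,
      rename_uT _ _ _ (Fin.castAdd_injective p q) (CoIdeal.leftIncl_mem_prod.2 he.1),
      rename_uT _ _ _ (Fin.natAdd_injective q p) (CoIdeal.rightIncl_mem_prod.2 he.2)]

end HS

end ExternalProducts

/-! ### Commutativity of the associated graded ring -/

section Commutativity

variable {k A : Type*} [CommRing k] [CommRing A] [Algebra k A] {p q : ℕ}
  {Δ : CoIdeal p} {nab : CoIdeal q}

namespace HS

/-- The degree estimate for the commutator of two generators: a factor `G` with `ℓ(G) ≥ l + l'`, of
degree `x ≥ l` in the first and `y ≥ l'` in the last variables, lowers the total degree. -/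
theorem div_add_div_lt {l l' x x' y y' : ℕ} (hl : 1 ≤ l) (hl' : 1 ≤ l') (hx : l ≤ x)
    (hy : l' ≤ y) :
    (x + y) / (l + l') + (y' / l' + x' / l) < (x + x') / l + (y + y') / l' := by
  have h1 : x / l + x' / l ≤ (x + x') / l := Nat.div_add_div_le_add_div
  have h2 : y / l' + y' / l' ≤ (y + y') / l' := Nat.div_add_div_le_add_div
  have h3 : (x + y) / (l + l') < x / l + y / l' := by
    rw [Nat.div_lt_iff_lt_mul (by omega)]
    have a1 : 1 ≤ x / l := (Nat.one_le_div_iff hl).2 hx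
    have b1 : 1 ≤ y / l' := (Nat.one_le_div_iff hl').2 hy
    have a2 := Nat.lt_mul_div_succ x hl
    have b2 := Nat.lt_mul_div_succ y hl'
    have a3 : l * (x / l + 1) ≤ l * (x / l + y / l') := Nat.mul_le_mul_left _ (by omega)
    have b3 : l' * (y / l' + 1) ≤ l' * (x / l + y / l') := Nat.mul_le_mul_left _ (by omega)
    rw [mul_comm, add_mul]
    omega
  omega

/-- Two generators `𝐓` commute modulo lower degree. In the variables `s, t`, the series
`D(s) ∘ E(t) = G ∘ E(t) ∘ D(s)` differ by a commutator `G`, all of whose non-trivial terms have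
degree `≥ ℓ(D)` in `s` and `≥ ℓ(E)` in `t`; hence `ℓ(G) ≥ ℓ(D) + ℓ(E)`, which makes the terms of
positive degree in `G` contribute less than the sum of the degrees of the generators. -/
theorem uT_commutator (D : HS k A Δ) (E : HS k A nab) (α : Fin p →₀ ℕ) (β : Fin q →₀ ℕ) :
    D.uT α * E.uT β - E.uT β * D.uT α ∈
      (uFiltration k A).below (α.degree / D.ell α + β.degree / E.ell β) := by
  classical
  by_cases hα : α ∈ Δ
  swap
  · rw [D.uT_of_notMem hα, zero_mul, mul_zero, sub_zero]
    exact zero_mem _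
  by_cases hβ : β ∈ nab
  swap
  · rw [E.uT_of_notMem hβ, zero_mul, mul_zero, sub_zero]
    exact zero_mem _
  by_cases hα0 : α = 0
  · rw [hα0, uT_zero, one_mul, mul_one, sub_self]
    exact zero_mem _
  by_cases hβ0 : β = 0
  · rw [hβ0, uT_zero, one_mul, mul_one, sub_self]
    exact zero_mem _
  rcases Nat.eq_zero_or_pos (D.ell α) with hD | hl
  · rw [D.uT_eq_zero_of_trivial hα0 fun γ h h0 => D.coeff_eq_zero_of_ell_eq_zero hD h h0, zero_mul,
      mul_zero, sub_zero]
    exact zero_mem _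
  rcases Nat.eq_zero_or_pos (E.ell β) with hE | hl'
  · rw [E.uT_eq_zero_of_trivial hβ0 fun γ h h0 => E.coeff_eq_zero_of_ell_eq_zero hE h h0, zero_mul,
      mul_zero, sub_zero]
    exact zero_mem _
  have hDl := D.vanishesBelow_ell α
  have hEl := E.vanishesBelow_ell β
  set l := D.ell α
  set l' := E.ell β
  set P := (D.extendLeft nab).comp (E.extendRight Δ) with hP
  set Q := (E.extendRight Δ).comp (D.extendLeft nab) with hQ
  obtain ⟨G, hG⟩ := exists_comp_eq P Q
  set e := leftIncl q α + rightIncl p β with he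
  have el : leftPart e = α := by
    rw [he, map_add, leftPart_leftIncl, leftPart_rightIncl, add_zero]
  have er : rightPart e = β := by
    rw [he, map_add, rightPart_leftIncl, rightPart_rightIncl, zero_add]
  have hmem : e ∈ Δ.prod nab := by
    rw [CoIdeal.mem_prod, el, er]
    exact ⟨hα, hβ⟩
  have hlow : ∀ b ≤ e, b ∈ Δ.prod nab ∧ leftPart b ≤ α ∧ rightPart b ≤ β := fun b hb =>
    ⟨CoIdeal.lower _ hb hmem, el ▸ leftPart_mono hb, er ▸ rightPart_mono hb⟩
  -- If `b` has degree `< l` in the first variables or `< l'` in the last ones, one of the two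
  -- factors is trivial up to `b`; they commute there, and `G` is trivial up to `b`.
  have htriv : ∀ b ≤ e, ((leftPart b).degree < l ∨ (rightPart b).degree < l') →
      ∀ b' ≤ b, b' ≠ 0 → G.coeff b' = 0 := by
    intro b hb hlt
    refine G.coeff_eq_zero_of_comp_eq Q b fun c hc => ?_
    obtain ⟨hc0, hc1, hc2⟩ := hlow c (hc.trans hb)
    rw [hG, hP, hQ, extend_comp_coeff _ _ hc0, extend_comp_coeff' _ _ hc0]
    rcases hlt with hlt | hlt
    · by_cases h0 : leftPart c = 0
      · rw [h0, D.coeff_zero, one_mul, mul_one]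
      · rw [hDl _ hc1 h0 ((Finsupp.degree_mono (leftPart_mono hc)).trans_lt hlt), zero_mul,
          mul_zero]
    · by_cases h0 : rightPart c = 0
      · rw [h0, E.coeff_zero, one_mul, mul_one]
      · rw [hEl _ hc2 h0 ((Finsupp.degree_mono (rightPart_mono hc)).trans_lt hlt), zero_mul,
          mul_zero]
  have hGl : G.VanishesBelow e (l + l') := by
    intro b hb h0 hlt
    have := degree_leftPart_add b
    exact htriv b hb (by omega) b le_rfl h0
  have h0e : ((0 : Fin (p + q) →₀ ℕ), e) ∈ antidiagonal e := by
    rw [mem_antidiagonal, zero_add]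
  have key : D.uT α * E.uT β - E.uT β * D.uT α =
      ∑ c ∈ (antidiagonal e).erase (0, e), G.uT c.1 * Q.uT c.2 := by
    have h1 : P.uT e = D.uT α * E.uT β := by rw [hP, extend_comp_uT _ _ hmem, el, er]
    have h2 : Q.uT e = E.uT β * D.uT α := by rw [hQ, extend_comp_uT' _ _ hmem, el, er]
    rw [← h1, ← h2, ← hG, uT_comp _ _ hmem, ← Finset.add_sum_erase _ _ h0e, uT_zero, one_mul,
      add_sub_cancel_left]
  rw [key]
  refine sum_mem fun c hc => ?_
  rw [Finset.mem_erase, mem_antidiagonal] at hc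
  obtain ⟨hne, hc⟩ := hc
  have hc1 : c.1 ≤ e := by rw [← hc]; exact le_self_add
  have hc2 : c.2 ≤ e := by rw [← hc]; exact le_add_self
  have h0 : c.1 ≠ 0 := by
    intro h0
    refine hne (Prod.ext h0 ?_)
    rw [← hc, h0, zero_add]
  by_cases hlt : (leftPart c.1).degree < l ∨ (rightPart c.1).degree < l'
  · rw [G.uT_eq_zero_of_trivial h0 (htriv c.1 hc1 hlt), zero_mul]
    exact zero_mem _
  · obtain ⟨m2, l2, r2⟩ := hlow c.2 hc2
    rw [hQ, extend_comp_uT' _ _ m2]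
    refine (uFiltration k A).mem_below_of_lt ((uFiltration k A).mul_mem
      ((hGl.mono hc1).uT_mem (by omega)) ((uFiltration k A).mul_mem
        ((hEl.mono r2).uT_mem hl') ((hDl.mono l2).uT_mem hl))) ?_
    rw [← degree_leftPart_add c.1]
    have hα' : α.degree = (leftPart c.1).degree + (leftPart c.2).degree := by
      rw [← map_add, ← map_add, hc, el]
    have hβ' : β.degree = (rightPart c.1).degree + (rightPart c.2).degree := by
      rw [← map_add, ← map_add, hc, er]
    rw [hα', hβ']
    exact div_add_div_lt hl hl' (by omega) (by omega)

/-- A generator `𝐓` commutes with `A` modulo lower degree. -/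
theorem uT_uS_commutator (D : HS k A Δ) (α : Fin p →₀ ℕ) (a : A) :
    D.uT α * uS k A a - uS k A a * D.uT α ∈ (uFiltration k A).below (α.degree / D.ell α) := by
  classical
  by_cases hα : α ∈ Δ
  swap
  · rw [D.uT_of_notMem hα, zero_mul, mul_zero, sub_zero]
    exact zero_mem _
  have h0 : ((0 : Fin p →₀ ℕ), α) ∈ antidiagonal α := by
    rw [mem_antidiagonal, zero_add]
  rw [D.uT_mul_uS hα, ← Finset.add_sum_erase _ _ h0, D.coeff_zero, Module.End.one_apply,
    add_sub_cancel_left]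
  refine sum_mem fun c hc => ?_
  rw [Finset.mem_erase, mem_antidiagonal] at hc
  obtain ⟨hne, hc⟩ := hc
  have hc1 : c.1 ≤ α := by rw [← hc]; exact le_self_add
  have hc2 : c.2 ≤ α := by rw [← hc]; exact le_add_self
  have h1 : c.1 ≠ 0 := by
    intro h1
    refine hne (Prod.ext h1 ?_)
    rw [← hc, h1, zero_add]
  rcases Nat.eq_zero_or_pos (D.ell α) with hD | hl
  · rw [D.coeff_eq_zero_of_ell_eq_zero hD hc1 h1, LinearMap.zero_apply, map_zero, zero_mul]
    exact zero_mem _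
  by_cases hlt : c.1.degree < D.ell α
  · rw [D.vanishesBelow_ell α _ hc1 h1 hlt, LinearMap.zero_apply, map_zero, zero_mul]
    exact zero_mem _
  · refine (uFiltration k A).mem_below_of_lt ((uFiltration k A).mul_mem (uS_mem _)
      (((D.vanishesBelow_ell α).mono hc2).uT_mem hl)) ?_
    have h2 : α.degree = c.1.degree + c.2.degree := by rw [← map_add, hc]
    have h3 : c.1.degree / D.ell α + c.2.degree / D.ell α ≤ α.degree / D.ell α := by
      rw [h2]
      exact Nat.div_add_div_le_add_div
    have h4 := (Nat.one_le_div_iff hl).2 (not_lt.1 hlt)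
    omega

end HS

theorem Gen.commutator (g h : Gen k A) :
    g.toU * h.toU - h.toU * g.toU ∈ (uFiltration k A).below (g.deg + h.deg) := by
  cases g with
  | S a =>
    cases h with
    | S b =>
      change uS k A a * uS k A b - uS k A b * uS k A a ∈ _
      rw [← map_mul, ← map_mul, mul_comm, sub_self]
      exact zero_mem _
    | T q nab E β hβ =>
      rw [← E.uT_of_mem hβ, ← neg_sub]
      change -(E.uT β * uS k A a - uS k A a * E.uT β) ∈
        (uFiltration k A).below (0 + β.degree / E.ell β)
      rw [zero_add]
      exact neg_mem (E.uT_uS_commutator β a)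
  | T p Δ D α hα =>
    rw [← D.uT_of_mem hα]
    cases h with
    | S b => exact D.uT_uS_commutator α b
    | T q nab E β hβ =>
      rw [← E.uT_of_mem hβ]
      exact D.uT_commutator E α β

theorem Gen.list_prod_mem (l : List (Gen k A)) :
    (l.map Gen.toU).prod ∈ (uFiltration k A).deg (l.map Gen.deg).sum :=
  Submodule.subset_span ⟨l, le_rfl, rfl⟩

theorem Gen.commutator_list (g : Gen k A) (l : List (Gen k A)) :
    g.toU * (l.map Gen.toU).prod - (l.map Gen.toU).prod * g.toU ∈
      (uFiltration k A).below (g.deg + (l.map Gen.deg).sum) := by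
  induction l with
  | nil => simp
  | cons h l ih =>
    simp only [List.map_cons, List.prod_cons, List.sum_cons]
    set x := (l.map Gen.toU).prod with hx
    have e : g.toU * (h.toU * x) - h.toU * x * g.toU =
        (g.toU * h.toU - h.toU * g.toU) * x + h.toU * (g.toU * x - x * g.toU) := by
      simp only [mul_sub, sub_mul, mul_assoc]
      abel
    rw [e]
    refine add_mem ?_ ?_
    · have := (uFiltration k A).below_mul (g.commutator h) (Gen.list_prod_mem l)
      rwa [add_assoc] at this
    · have := (uFiltration k A).mul_below (h.toU_mem le_rfl) ih
      rwa [← add_assoc, add_comm h.deg, add_assoc] at this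

theorem Gen.list_commutator_list (l l' : List (Gen k A)) :
    (l.map Gen.toU).prod * (l'.map Gen.toU).prod - (l'.map Gen.toU).prod * (l.map Gen.toU).prod ∈
      (uFiltration k A).below ((l.map Gen.deg).sum + (l'.map Gen.deg).sum) := by
  induction l with
  | nil => simp
  | cons g l ih =>
    simp only [List.map_cons, List.prod_cons, List.sum_cons]
    set x := (l.map Gen.toU).prod with hx
    set y := (l'.map Gen.toU).prod with hy
    have e : g.toU * x * y - y * (g.toU * x) =
        g.toU * (x * y - y * x) + (g.toU * y - y * g.toU) * x := by
      simp only [mul_sub, sub_mul, mul_assoc]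
      abel
    rw [e]
    refine add_mem ?_ ?_
    · have := (uFiltration k A).mul_below (g.toU_mem le_rfl) ih
      rwa [← add_assoc] at this
    · have := (uFiltration k A).below_mul (g.commutator_list l') (Gen.list_prod_mem l)
      rwa [add_right_comm] at this

theorem uFiltration_commutator (i j : ℕ) (x y : U k A) (hx : x ∈ (uFiltration k A).deg i)
    (hy : y ∈ (uFiltration k A).deg j) : x * y - y * x ∈ (uFiltration k A).below (i + j) := by
  induction hx, hy using Submodule.span_induction₂ with
  | mem_mem x y hx hy =>
    obtain ⟨l, hl, rfl⟩ := hx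
    obtain ⟨l', hl', rfl⟩ := hy
    exact (uFiltration k A).below_mono (add_le_add hl hl') (Gen.list_commutator_list l l')
  | zero_left y hy =>
    rw [zero_mul, mul_zero, sub_zero]
    exact zero_mem _
  | zero_right x hx =>
    rw [zero_mul, mul_zero, sub_zero]
    exact zero_mem _
  | add_left x y z _ _ _ h1 h2 =>
    rw [show (x + y) * z - z * (x + y) = (x * z - z * x) + (y * z - z * y) by noncomm_ring]
    exact add_mem h1 h2
  | add_right x y z _ _ _ h1 h2 =>
    rw [show x * (y + z) - (y + z) * x = (x * y - y * x) + (x * z - z * x) by noncomm_ring]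
    exact add_mem h1 h2
  | smul_left c x y _ _ h =>
    rw [smul_mul_assoc, mul_smul_comm, ← smul_sub]
    exact Submodule.smul_mem _ _ h
  | smul_right c x y _ _ h =>
    rw [smul_mul_assoc, mul_smul_comm, ← smul_sub]
    exact Submodule.smul_mem _ _ h

instance isMulCommutative_GrU : IsMulCommutative (GrU k A) :=
  ⟨⟨(uFiltration k A).gr_mul_comm uFiltration_commutator⟩⟩

end Commutativity

/-! ### Symbols of the generators -/

section GeneratorSymbols

variable {k A : Type*} [CommRing k] [CommRing A] [Algebra k A] {p : ℕ} {Δ : CoIdeal p}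

namespace HS

/-- Hasse–Schmidt derivations with the same terms of degree `1` differ by a factor `G` with
`ℓ(G) ≥ 2`, which does not affect the symbols of their generators. -/
theorem uT_sub_uT_mem_below (P Q : HS k A Δ) (h : ∀ α ∈ Δ, α.degree = 1 → P.coeff α = Q.coeff α)
    (α : Fin p →₀ ℕ) : P.uT α - Q.uT α ∈ (uFiltration k A).below α.degree := by
  classical
  by_cases hα : α ∈ Δ
  swap
  · rw [P.uT_of_notMem hα, Q.uT_of_notMem hα, sub_self]
    exact zero_mem _
  obtain ⟨G, hG⟩ := exists_comp_eq P Q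
  have hGl : G.VanishesBelow α 2 := by
    intro β hβ h0 hlt
    refine G.coeff_eq_zero_of_comp_eq Q β (fun c hc => ?_) β le_rfl h0
    rw [hG]
    by_cases hc0 : c = 0
    · rw [hc0, P.coeff_zero, Q.coeff_zero]
    · have := degree_pos hc0
      have := Finsupp.degree_mono hc
      exact h c (Δ.lower (hc.trans hβ) hα) (by omega)
  have h0α : ((0 : Fin p →₀ ℕ), α) ∈ antidiagonal α := by
    rw [mem_antidiagonal, zero_add]
  rw [← hG, uT_comp _ _ hα, ← Finset.add_sum_erase _ _ h0α, uT_zero, one_mul, add_sub_cancel_left]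
  refine sum_mem fun c hc => ?_
  rw [Finset.mem_erase, mem_antidiagonal] at hc
  obtain ⟨hne, hc⟩ := hc
  have hc1 : c.1 ≤ α := by rw [← hc]; exact le_self_add
  have h0 : c.1 ≠ 0 := by
    intro h0
    refine hne (Prod.ext h0 ?_)
    rw [← hc, h0, zero_add]
  refine (uFiltration k A).mem_below_of_lt ((uFiltration k A).mul_mem
    ((hGl.mono hc1).uT_mem one_le_two) (Q.uT_mem_degree c.2)) ?_
  have := degree_pos h0
  have h2 : α.degree = c.1.degree + c.2.degree := by rw [← map_add, hc]
  omega

theorem eq_idx (α : Fin 1 →₀ ℕ) : α = idx α.degree := by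
  refine Finsupp.ext fun i => ?_
  rw [Subsingleton.elim i 0, Finsupp.degree_eq_sum]
  simp

theorem degree_idx (i : ℕ) : (idx i).degree = i := Finsupp.degree_single _ _

variable {m : ℕ}

theorem uT_sub_uT_idx_mem_below {m' : ℕ} (D : HS k A (CoIdeal.interval m))
    (E : HS k A (CoIdeal.interval m')) (h : D.nth 1 = E.nth 1) {i : ℕ} (hi : i ≤ m)
    (hi' : i ≤ m') : D.uT (idx i) - E.uT (idx i) ∈ (uFiltration k A).below i := by
  have hm : ∀ α ∈ CoIdeal.interval i, α ∈ CoIdeal.interval m := fun α hα =>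
    (CoIdeal.mem_total.1 hα).trans hi
  have hm' : ∀ α ∈ CoIdeal.interval i, α ∈ CoIdeal.interval m' := fun α hα =>
    (CoIdeal.mem_total.1 hα).trans hi'
  have := uT_sub_uT_mem_below (D.restrict hm) (E.restrict hm') (fun α hα h1 => by
    rw [restrict_coeff _ _ hα, restrict_coeff _ _ hα, eq_idx α, h1]
    exact h) (idx i)
  rwa [restrict_uT _ _ (idx_mem le_rfl), restrict_uT _ _ (idx_mem le_rfl), degree_idx] at this

theorem C_ofAdd_eq_zero {e : Fin 2 →₀ ℕ} (he : e ∈ CoIdeal.total 2 m) (α : Fin 1 →₀ ℕ)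
    (hα : α ≠ idx e.degree) : (SubstMap.ofAdd A m).C e α = 0 := by
  rw [SubstMap.C_ofAdd he, if_neg]
  intro h
  exact hα (by rw [h]; exact eq_idx α)

theorem subst_ofAdd_coeff (D : HS k A (CoIdeal.interval m)) {e : Fin 2 →₀ ℕ}
    (he : e ∈ CoIdeal.total 2 m) :
    (D.subst (SubstMap.ofAdd A m)).coeff e = e.degree.choose (e 0) • D.nth e.degree := by
  rw [subst_coeff_of_unique _ D (degree_idx _).le fun α _ => C_ofAdd_eq_zero he α,
    SubstMap.C_ofAdd he, degree_idx, if_pos rfl, Nat.cast_smul_eq_nsmul]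
  rfl

theorem subst_ofAdd_uT (D : HS k A (CoIdeal.interval m)) {e : Fin 2 →₀ ℕ}
    (he : e ∈ CoIdeal.total 2 m) :
    (D.subst (SubstMap.ofAdd A m)).uT e = e.degree.choose (e 0) • D.uT (idx e.degree) := by
  rw [uT_subst_of_unique _ D he (degree_idx _).le fun α _ => C_ofAdd_eq_zero he α,
    SubstMap.C_ofAdd he, degree_idx, if_pos rfl, map_natCast, nsmul_eq_mul]

/-- The exponential identity `D(s + t) ≡ D(s) ∘ D(t)` modulo lower degree: both sides have the same
terms of degree `1`. -/
theorem choose_smul_uT_sub_mem_below (D : HS k A (CoIdeal.interval m)) {i j : ℕ}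
    (h : i + j ≤ m) : (i + j).choose i • D.uT (idx (i + j)) - D.uT (idx i) * D.uT (idx j) ∈
      (uFiltration k A).below (i + j) := by
  -- `D(s) ∘ D(t)` and `D(s + t)`, both truncated at the total degree `m`
  let Q₀ := (D.extendLeft (CoIdeal.interval m)).comp (D.extendRight (CoIdeal.interval m))
  have hsub : ∀ e ∈ CoIdeal.total (1 + 1) m,
      e ∈ (CoIdeal.interval m).prod (CoIdeal.interval m) := by
    intro e he
    have h1 := degree_leftPart_add e
    have h2 := CoIdeal.mem_total.1 he
    rw [CoIdeal.mem_prod, CoIdeal.mem_total, CoIdeal.mem_total]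
    omega
  let P : HS k A (CoIdeal.total (1 + 1) m) := D.subst (SubstMap.ofAdd A m)
  let Q : HS k A (CoIdeal.total (1 + 1) m) := Q₀.restrict hsub
  have hl : ∀ e : Fin (1 + 1) →₀ ℕ, leftPart e = idx (e 0) := fun e => by
    refine Finsupp.ext fun i => ?_
    rw [Subsingleton.elim i 0, idx, Finsupp.single_eq_same]
    rfl
  have hQ : ∀ e ∈ CoIdeal.total (1 + 1) m,
      Q.coeff e = D.coeff (leftPart e) * D.coeff (rightPart e) :=
    fun e he => (restrict_coeff _ _ he).trans (extend_comp_coeff _ _ (hsub e he))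
  have hPQ : ∀ e ∈ CoIdeal.total (1 + 1) m, e.degree = 1 → P.coeff e = Q.coeff e := by
    intro e he h1
    rw [hQ e he]
    refine (D.subst_ofAdd_coeff he).trans ?_
    have h2 := degree_leftPart_add e
    have h3 : e 0 = (leftPart (p := 1) (q := 1) e).degree := by rw [hl, degree_idx]
    rw [h3, eq_idx (leftPart e), eq_idx (rightPart e), degree_idx]
    obtain h4 | h4 : (leftPart (p := 1) (q := 1) e).degree = 0 ∨
      (leftPart (p := 1) (q := 1) e).degree = 1 := by omega
    · have h5 : (rightPart (p := 1) (q := 1) e).degree = 1 := by omega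
      rw [h1, h4, h5]
      change _ = D.nth 0 * D.nth 1
      rw [D.nth_zero, Nat.choose_zero_right, one_smul, one_mul]
    · have h5 : (rightPart (p := 1) (q := 1) e).degree = 0 := by omega
      rw [h1, h4, h5]
      change _ = D.nth 1 * D.nth 0
      rw [D.nth_zero, Nat.choose_self, one_smul, mul_one]
  set e : Fin (1 + 1) →₀ ℕ := leftIncl 1 (idx i) + rightIncl 1 (idx j) with he
  have el : leftPart e = idx i := by
    rw [he, map_add, leftPart_leftIncl, leftPart_rightIncl, add_zero]
  have er : rightPart e = idx j := by
    rw [he, map_add, rightPart_leftIncl, rightPart_rightIncl, zero_add]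
  have hdeg : e.degree = i + j := by
    rw [← degree_leftPart_add, el, er, degree_idx, degree_idx]
  have he0 : e 0 = i := by
    rw [← degree_idx (e 0), ← hl, el, degree_idx]
  have hmem : e ∈ CoIdeal.total (1 + 1) m := CoIdeal.mem_total.2 (hdeg.trans_le h)
  have h1 : P.uT e = (i + j).choose i • D.uT (idx (i + j)) := by
    refine (D.subst_ofAdd_uT hmem).trans ?_
    rw [hdeg, he0]
  have h2 : Q.uT e = D.uT (idx i) * D.uT (idx j) := by
    refine (restrict_uT _ _ hmem).trans ((extend_comp_uT _ _ (hsub e hmem)).trans ?_)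
    rw [el, er]
  rw [← h1, ← h2, ← hdeg]
  exact uT_sub_uT_mem_below P Q hPQ e

theorem subst_ofScale_uT (D : HS k A (CoIdeal.interval m)) (a : A) {i : ℕ} (hi : i ≤ m) :
    (D.subst (SubstMap.ofScale a)).uT (idx i) = uS k A (a ^ i) * D.uT (idx i) := by
  rw [uT_subst_of_unique _ D (idx_mem hi) le_rfl, SubstMap.C_ofScale _ (idx_mem hi), if_pos rfl,
    degree_idx]
  intro α _ hne
  rw [SubstMap.C_ofScale _ (idx_mem hi), if_neg hne.symm]

theorem subst_ofScale_nth (D : HS k A (CoIdeal.interval m)) (a : A) {i : ℕ} (hi : i ≤ m) :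
    (D.subst (SubstMap.ofScale a)).nth i = a ^ i • D.nth i := by
  unfold nth
  rw [subst_coeff_of_unique _ D le_rfl, SubstMap.C_ofScale _ (idx_mem hi), if_pos rfl, degree_idx]
  intro α _ hne
  rw [SubstMap.C_ofScale _ (idx_mem hi), if_neg hne.symm]

/-! ### The exponential type series of a Hasse–Schmidt derivation -/

theorem uSigma_eq {m' : ℕ} (D : HS k A (CoIdeal.interval m)) (E : HS k A (CoIdeal.interval m'))
    (h1 : D.nth 1 = E.nth 1) {i : ℕ} (hi : i ≤ m) (hi' : i ≤ m') : D.uSigma i = E.uSigma i :=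
  (uFiltration k A).symbol_eq (D.uT_sub_uT_idx_mem_below E h1 hi hi')

theorem uSigma_zero (D : HS k A (CoIdeal.interval m)) : D.uSigma 0 = 1 :=
  (uFiltration k A).symbol_congr rfl _ ⟨1, (uFiltration k A).one_mem⟩ (by
    change D.uT (idx 0) = 1
    rw [idx, Finsupp.single_zero, D.uT_zero])

theorem uSigma_of_lt (D : HS k A (CoIdeal.interval m)) {i : ℕ} (hi : m < i) :
    D.uSigma i = 0 := by
  have hi' : idx i ∉ CoIdeal.interval m := by
    rw [CoIdeal.mem_total, degree_idx]
    omega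
  unfold uSigma
  rw [(uFiltration k A).symbol_congr rfl _ (0 : (uFiltration k A).deg i) (D.uT_of_notMem hi')]
  simp [RingFiltration.symbol]

theorem choose_mul_uSigma (D : HS k A (CoIdeal.interval m)) {i j : ℕ} (h : i + j ≤ m) :
    ((i + j).choose i : GrU k A) * D.uSigma (i + j) = D.uSigma i * D.uSigma j := by
  have hs : ∀ (n d : ℕ) (x : (uFiltration k A).deg d),
      (n : GrU k A) * (uFiltration k A).symbol d x = (uFiltration k A).symbol d (n • x) := by
    intro n d x
    rw [← nsmul_eq_mul]
    simp only [RingFiltration.symbol, map_nsmul]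
  unfold uSigma
  rw [hs, RingFiltration.symbol_mul]
  exact (uFiltration k A).symbol_eq (D.choose_smul_uT_sub_mem_below h)

theorem uSigma_comp (D E : HS k A (CoIdeal.interval m)) {n : ℕ} (hn : n ≤ m) :
    (D.comp E).uSigma n = ∑ c ∈ antidiagonal n, D.uSigma c.1 * E.uSigma c.2 := by
  have hmem : ∀ c ∈ antidiagonal n,
      D.uT (idx c.1) * E.uT (idx c.2) ∈ (uFiltration k A).deg n := fun c hc => by
    rw [mem_antidiagonal] at hc
    have := (uFiltration k A).mul_mem (D.uT_mem_degree (idx c.1)) (E.uT_mem_degree (idx c.2))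
    rwa [degree_idx, degree_idx, hc] at this
  have hg : ∀ c : {x // x ∈ antidiagonal n}, D.uSigma c.1.1 * E.uSigma c.1.2 =
      (uFiltration k A).symbol n ⟨_, hmem c.1 c.2⟩ := fun c => by
    unfold uSigma
    rw [RingFiltration.symbol_mul]
    exact (uFiltration k A).symbol_congr (mem_antidiagonal.1 c.2) _ _ rfl
  have hsum : ∀ (s : Finset {x // x ∈ antidiagonal n}) (g : _ → (uFiltration k A).deg n),
      ∑ c ∈ s, (uFiltration k A).symbol n (g c) = (uFiltration k A).symbol n (∑ c ∈ s, g c) :=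
    fun s g => by simp only [RingFiltration.symbol, map_sum]
  rw [← Finset.sum_attach (antidiagonal n), Finset.sum_congr rfl fun c _ => hg c, hsum]
  refine (uFiltration k A).symbol_congr rfl _ _ ?_
  change (D.comp E).uT (idx n) = _
  rw [uT_comp _ _ (idx_mem hn), sum_nth (fun b c => D.uT b * E.uT c), ← Finset.sum_attach]
  simp only [AddSubmonoidClass.coe_finsetSum]

theorem algebraMap_GrU (a : A) :
    algebraMap A (GrU k A) a = (uFiltration k A).symbol 0 ⟨uS k A a, uS_mem a⟩ := rfl

theorem uSigma_subst_ofScale (D : HS k A (CoIdeal.interval m)) (a : A) {n : ℕ} (hn : n ≤ m) :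
    (D.subst (SubstMap.ofScale a)).uSigma n = algebraMap A (GrU k A) a ^ n * D.uSigma n := by
  rw [← map_pow, algebraMap_GrU]
  unfold uSigma
  rw [RingFiltration.symbol_mul]
  exact (uFiltration k A).symbol_congr (zero_add n).symm _ _ (D.subst_ofScale_uT a hn)

/-- The series `∑_{i ≤ m} σ_i(𝐓_{1,m,D,i}) t^i` of exponential type. -/
noncomputable def expSeries (D : HS k A (CoIdeal.interval m)) :
    ExpSeries (m : ℕ∞) (GrU k A) where
  coeff := D.uSigma
  coeff_of_lt _ hi := D.uSigma_of_lt (Nat.cast_lt.1 hi)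
  coeff_zero := D.uSigma_zero
  choose_mul _ _ hij := D.choose_mul_uSigma (Nat.cast_le.1 hij)

theorem expSeries_coeff (D : HS k A (CoIdeal.interval m)) (n : ℕ) :
    D.expSeries.coeff n = D.uSigma n := rfl

theorem expSeries_congr (D E : HS k A (CoIdeal.interval m)) (h : D.nth 1 = E.nth 1) :
    D.expSeries = E.expSeries :=
  ExpSeries.ext_of_le fun _ hn => D.uSigma_eq E h (Nat.cast_le.1 hn) (Nat.cast_le.1 hn)

theorem expSeries_comp (D E : HS k A (CoIdeal.interval m)) :
    (D.comp E).expSeries = D.expSeries + E.expSeries := by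
  refine ExpSeries.ext_of_le fun n hn => ?_
  rw [ExpSeries.coeff_add_of_le _ _ n hn, expSeries_coeff, uSigma_comp D E (Nat.cast_le.1 hn)]
  refine Finset.sum_congr rfl fun c _ => ?_
  rw [expSeries_coeff, expSeries_coeff]

theorem expSeries_subst_ofScale (D : HS k A (CoIdeal.interval m)) (a : A) :
    (D.subst (SubstMap.ofScale a)).expSeries = a • D.expSeries :=
  ExpSeries.ext_of_le fun _ hn => D.uSigma_subst_ofScale a (Nat.cast_le.1 hn)

end HS

end GeneratorSymbols

/-! ### The map `ϑ` -/

section Vartheta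

variable (k A : Type*) [CommRing k] [CommRing A] [Algebra k A]

/-- The map `χ_m : Ider_k(A; m) → EXP_m(gr U_{A/k})`, which sends `δ` to the series of any of its
`m`-integrals. -/
noncomputable def chi (m : ℕ) (hm : 1 ≤ m) :
    Ider k A m hm →ₗ[A] ExpSeries (m : ℕ∞) (GrU k A) where
  toFun δ := (Classical.choose δ.2).expSeries
  map_add' δ ε := by
    rw [← HS.expSeries_comp]
    refine HS.expSeries_congr _ _ ?_
    rw [Classical.choose_spec (δ + ε).2, HS.comp_nth _ _ hm, Finset.Nat.antidiagonal_succ]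
    simp [HS.nth_zero, Classical.choose_spec δ.2, Classical.choose_spec ε.2, add_comm]
  map_smul' a δ := by
    rw [RingHom.id_apply, ← HS.expSeries_subst_ofScale]
    refine HS.expSeries_congr _ _ ?_
    rw [Classical.choose_spec (a • δ).2, HS.subst_ofScale_nth _ _ hm, pow_one,
      Classical.choose_spec δ.2]
    rfl

variable {k A}

theorem chi_coeff {m m' : ℕ} {hm : 1 ≤ m} (δ : Ider k A m hm) (D : HS k A (CoIdeal.interval m'))
    (hD : D.nth 1 = (δ : Derivation k A A)) {i : ℕ} (hi : i ≤ m) (hi' : i ≤ m') :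
    (chi k A m hm δ).coeff i = D.uSigma i :=
  HS.uSigma_eq _ _ ((Classical.choose_spec δ.2).trans hD.symm) hi hi'

theorem trunc_comp_chi {m m' : ℕ} (hm : 1 ≤ m) (hm' : 1 ≤ m') (h : m ≤ m') :
    ExpSeries.trunc (Nat.cast_le.2 h) ∘ₗ chi k A m' hm' =
      chi k A m hm ∘ₗ Submodule.inclusion (Ider_anti hm hm' h) := by
  refine LinearMap.ext fun δ => ExpSeries.ext_of_le fun n hn => ?_
  obtain ⟨D, hD⟩ := δ.2
  have hn' : n ≤ m := Nat.cast_le.1 hn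
  refine (if_pos hn).trans ((chi_coeff δ D hD (hn'.trans h) (hn'.trans h)).trans ?_)
  exact (chi_coeff (Submodule.inclusion (Ider_anti hm hm' h) δ) D hD hn' (hn'.trans h)).symm

theorem chi_inclusion_coeff {m m' : ℕ} (hm : 1 ≤ m) (hm' : 1 ≤ m') (δ : Iderf k A) {n : ℕ}
    (hn : n ≤ m) (hn' : n ≤ m') :
    (chi k A m hm (Submodule.inclusion (Iderf_le m hm) δ)).coeff n =
      (chi k A m' hm' (Submodule.inclusion (Iderf_le m' hm') δ)).coeff n := by
  obtain ⟨D, hD⟩ := exists_integral k A δ m' hm'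
  exact (chi_coeff (Submodule.inclusion (Iderf_le m hm) δ) D hD hn hn').trans
    (chi_coeff (Submodule.inclusion (Iderf_le m' hm') δ) D hD hn' hn').symm

variable (k A) in
/-- The inverse limit `χ : Ider^f_k(A) → EXP(gr U_{A/k})` of the maps `χ_m`: its coefficient of
`t^n` is that of `χ_{n+1}` (rather than `χ_n`, so that the length is positive also for `n = 0`). -/
noncomputable def chiLim : Iderf k A →ₗ[A] ExpSeries ⊤ (GrU k A) where
  toFun δ :=
    { coeff := fun n => (chi k A (n + 1) (Nat.le_add_left 1 n)
        (Submodule.inclusion (Iderf_le _ _) δ)).coeff n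
      coeff_of_lt := fun i hi => absurd hi (by simp)
      coeff_zero := ExpSeries.coeff_zero _
      choose_mul := by
        intro i j _
        rw [chi_inclusion_coeff (Nat.le_add_left 1 i) (Nat.le_add_left 1 (i + j)) δ
            (Nat.le_succ _) (by omega),
          chi_inclusion_coeff (Nat.le_add_left 1 j) (Nat.le_add_left 1 (i + j)) δ
            (Nat.le_succ _) (by omega)]
        exact ExpSeries.choose_mul _ _ _ (Nat.cast_le.2 (Nat.le_succ _)) }
  map_add' δ ε := by
    refine ExpSeries.ext_of_le fun n hn => ?_
    rw [ExpSeries.coeff_add_of_le _ _ _ le_top]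
    simp only [map_add]
    rw [ExpSeries.coeff_add_of_le _ _ _ (Nat.cast_le.2 (Nat.le_succ _))]
    refine Finset.sum_congr rfl fun c hc => ?_
    rw [mem_antidiagonal] at hc
    rw [chi_inclusion_coeff (Nat.le_add_left 1 n) (Nat.le_add_left 1 c.1) δ (by omega)
        (Nat.le_succ _),
      chi_inclusion_coeff (Nat.le_add_left 1 n) (Nat.le_add_left 1 c.2) ε (by omega)
        (Nat.le_succ _)]
  map_smul' a δ := by
    refine ExpSeries.ext_of_le fun n hn => ?_
    simp only [map_smul]
    rfl

theorem chiLim_coeff {m : ℕ} (δ : Iderf k A) (D : HS k A (CoIdeal.interval m))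
    (hD : D.nth 1 = (δ : Derivation k A A)) {n : ℕ} (hn : n ≤ m) :
    (chiLim k A δ).coeff n = D.uSigma n :=
  chi_coeff (Submodule.inclusion (Iderf_le (n + 1) (Nat.le_add_left 1 n)) δ) D hD (Nat.le_succ n) hn

theorem trunc_comp_chiLim (m : ℕ) (hm : 1 ≤ m) :
    ExpSeries.trunc le_top ∘ₗ chiLim k A = chi k A m hm ∘ₗ Submodule.inclusion (Iderf_le m hm) := by
  refine LinearMap.ext fun δ => ExpSeries.ext_of_le fun n hn => ?_
  exact (if_pos hn).trans (chi_inclusion_coeff _ hm δ (Nat.le_succ n) (Nat.cast_le.1 hn))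

variable (k A) in
/-- The map `ϑ : Γ_A Ider^f_k(A) → gr U_{A/k}` of `A`-algebras attached to `χ`. -/
noncomputable def vartheta : DividedPowerAlgebra A (Iderf k A) →ₐ[A] GrU k A :=
  gammaLift (chiLim k A)

theorem vartheta_dp {m : ℕ} (δ : Iderf k A) (D : HS k A (CoIdeal.interval m))
    (hD : D.nth 1 = (δ : Derivation k A A)) {n : ℕ} (hn : n ≤ m) :
    vartheta k A (DividedPowerAlgebra.dp A n δ) = D.uSigma n :=
  (gammaLift_dp _ _ _).trans (chiLim_coeff δ D hD hn)

theorem mul_mem_homogeneous {i j : ℕ} {x y : GrU k A} (hx : x ∈ (uFiltration k A).homogeneous i)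
    (hy : y ∈ (uFiltration k A).homogeneous j) :
    x * y ∈ (uFiltration k A).homogeneous (i + j) := by
  obtain ⟨x, rfl⟩ := hx
  obtain ⟨y, rfl⟩ := hy
  exact ⟨_, (DirectSum.of_mul_of x y).symm⟩

theorem vartheta_mem_homogeneous (d : ℕ) (x : DividedPowerAlgebra A (Iderf k A))
    (hx : x ∈ gammaHomogeneous A (Iderf k A) d) :
    vartheta k A x ∈ (uFiltration k A).homogeneous d := by
  induction hx using Submodule.span_induction with
  | mem x h =>
    obtain ⟨l, rfl, rfl⟩ := h
    induction l with
    | nil =>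
      simp only [List.map_nil, List.prod_nil, List.sum_nil, map_one]
      exact ⟨_, (uFiltration k A).symbol_one⟩
    | cons x l ih =>
      simp only [List.map_cons, List.prod_cons, List.sum_cons, map_mul]
      obtain ⟨D, hD⟩ := exists_integral k A x.2 (x.1 + 1) (Nat.le_add_left 1 _)
      rw [vartheta_dp x.2 D hD (Nat.le_succ _)]
      exact mul_mem_homogeneous ⟨_, rfl⟩ ih
  | zero =>
    rw [map_zero]
    exact zero_mem _
  | add x y _ _ hx hy =>
    rw [map_add]
    exact add_mem hx hy
  | smul a x _ hx =>
    rw [map_smul, Algebra.smul_def, ← zero_add d]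
    exact mul_mem_homogeneous ⟨_, rfl⟩ hx

theorem grUpsilon_algebraMap (a : A) :
    grUpsilon k A (algebraMap A (GrU k A) a) = algebraMap A (GrD k A) a :=
  (RingFiltration.grMap_symbol _ _ _ _ _ _).trans
    ((diffFiltration k A).symbol_congr rfl _ _ (upsilon_uS a))

theorem grUpsilon_vartheta (x : DividedPowerAlgebra A (Iderf k A)) :
    grUpsilon k A (vartheta k A x) = varthetaF k A x := by
  let g : GrU k A →ₐ[A] GrD k A :=
    { toRingHom := grUpsilon k A
      commutes' := grUpsilon_algebraMap }
  have h : g.comp (vartheta k A) = varthetaF k A := by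
    refine DividedPowerAlgebra.algHom_ext fun n δ => ?_
    obtain ⟨D, hD⟩ := exists_integral k A δ (n + 1) (Nat.le_add_left 1 n)
    rw [varthetaF_dp k A δ n _ (Nat.le_succ n) D hD, ← grUpsilon_uSigma, ←
      vartheta_dp δ D hD (Nat.le_succ n)]
    rfl
  exact DFunLike.congr_fun h x

end Vartheta

end HasseSchmidt

theorem mainTheorem4 (k A : Type*) [CommRing k] [CommRing A] [Algebra k A] :
    -- `gr U` is commutative, hence a commutative `A`-algebra
    ∃ _ : IsMulCommutative (GrU k A),
    -- the `A`-linear maps `χ_m`, computed with any `m`-integral, and compatible with truncations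
    ∃ χm : ∀ (m : ℕ) (hm : 1 ≤ m), Ider k A m hm →ₗ[A] ExpSeries (m : ℕ∞) (GrU k A),
      (∀ (m : ℕ) (hm : 1 ≤ m) (δ : Ider k A m hm) (D : HS k A (CoIdeal.interval m)),
        D.nth 1 = (δ : Derivation k A A) → ∀ i ≤ m, (χm m hm δ).coeff i = D.uSigma i) ∧
      (∀ (m m' : ℕ) (hm : 1 ≤ m) (hm' : 1 ≤ m') (h : m ≤ m'),
        ExpSeries.trunc (Nat.cast_le.2 h) ∘ₗ χm m' hm' =
          χm m hm ∘ₗ Submodule.inclusion (Ider_anti hm hm' h)) ∧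
    -- their inverse limit `χ`
    ∃ χ : Iderf k A →ₗ[A] ExpSeries ⊤ (GrU k A),
      (∀ (m : ℕ) (hm : 1 ≤ m),
        ExpSeries.trunc le_top ∘ₗ χ = χm m hm ∘ₗ Submodule.inclusion (Iderf_le m hm)) ∧
    -- the map `ϑ` of `A`-algebras that the universal property of divided powers attaches to `χ`
    ∃ ϑ : DividedPowerAlgebra A (Iderf k A) →ₐ[A] GrU k A,
      (∀ ϑ' : DividedPowerAlgebra A (Iderf k A) →ₐ[A] GrU k A,
        ExpSeries.map ϑ' ∘ₗ gammaSeries A (Iderf k A) = χ ↔ ϑ' = ϑ) ∧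
      (∀ (m : ℕ) (_ : 1 ≤ m) (δ : Iderf k A) (D : HS k A (CoIdeal.interval m)),
        D.nth 1 = (δ : Derivation k A A) →
          ϑ (DividedPowerAlgebra.dp A m δ) = D.uSigma m) ∧
      -- `ϑ` is graded
      (∀ (d : ℕ), ∀ x ∈ gammaHomogeneous A (Iderf k A) d,
        ϑ x ∈ (uFiltration k A).homogeneous d) ∧
      -- `gr υ ∘ ϑ = ϑ^f`
      (∀ x, grUpsilon k A (ϑ x) = varthetaF k A x) := by
  refine ⟨isMulCommutative_GrU, chi k A, ?_, ?_, chiLim k A, trunc_comp_chiLim, vartheta k A,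
    ?_, ?_, vartheta_mem_homogeneous, grUpsilon_vartheta⟩
  · intro m hm δ D hD i hi
    exact chi_coeff δ D hD hi hi
  · intro m m' hm hm' h
    exact trunc_comp_chi hm hm' h
  · intro ϑ'
    constructor
    · exact gammaLift_unique _ _
    · rintro rfl
      exact map_gammaLift _
  · intro m _ δ D hD
    exact vartheta_dp δ D hD le_rfl
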